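/- Let $\mathfrak g$ be the rotation algebra of the four-dimensional Carrollian conformal algebra (CCA) or of the four-dimensional Galilean conformal algebra (GCA), i.e. the real Lie algebra $\mathfrak{iso}(3)$ generated by the spatial rotations $J^{ij}=-J^{ji}$ and the boosts $B^i$ ($i,j=1,2,3$), with $$[J^{ij},J^{kl}]=\delta^{ik}J^{jl}-\delta^{il}J^{jk}+\delta^{jl}J^{ik}-\delta^{jk}J^{il},\qquad [J^{ij},B^k]=\delta^{ik}B^j-\delta^{jk}B^i,\qquad [B^i,B^j]=0 .$$ (Acting by commutators on the translations $P^0,\dots,P^3$ one has $[J^{ij},P^k]=\delta^{ik}P^j-\delta^{jk}P^i$, $[J^{ij},P^0]=0$ in both cases; $[B^i,P^j]=\delta^{ij}P^0$, $[B^i,P^0]=0$ for the CCA; and $[B^i,P^0]=-P^i$, $[B^i,P^j]=0$ for the GCA.) Consider representations of $\mathfrak g$ on finite-dimensional complex vector spaces $V$. A *sector* $(j)$, $j\in\{0\}\cup\frac12\mathbb Z_{+}$, is a subspace of $V$ that is invariant and irreducible under the rotations $J^{ij}$ and has dimension $2j+1$. The following holds both for the CCA and for the GCA rotation algebra. 1.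 **Multiplets.** Every finite-dimensional representation $V$ is a finite direct sum of sectors $S_k=(j_k)$, to which orders $o_k\in\{1,\dots,r\}$ can be assigned such that the sums $W_i=\bigoplus_{o_k\le i}S_k$ satisfy $0=W_0\subsetneq W_1\subsetneq\dots\subsetneq W_r=V$ and $B^a W_i\subseteq W_{i-1}$ for $i=1,\dots,r$ and all $a$. Moreover the boosts map $S_k$ into the sum of those sectors $S_l$ for which $o_l<o_k$ and $(j_l)$ occurs in $(1)\otimes(j_k)$ (that is, $j_l=j_k+1$, or $j_l=j_k\ne0$, or $j_l=j_k-1$), and if $o_k\ge2$, then some boost does not map $S_k$ into $W_{o_k-2}$. 2. **Chain patterns.** For $r\ge1$, a *chain representation* $(j_1)\to(j_2)\to\dots\to(j_r)$ of rank $r$ is a finite-dimensional representation with a decomposition $V=S_1\oplus\dots\oplus S_r$ into sectors $S_k=(j_k)$ such that for $k<r$ all boosts map $S_k$ into $S_{k+1}$ and at least one of them is non-zero on $S_k$, and all boosts vanish on $S_r$. A chain representation $(j_1)\to\dots\to(j_r)$ exists if and only if - $r=1$ (a singlet $(j)$, with $j$ arbitrary); or - $r=2$ and the chain is $(j)\to(j+1)$,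 or $(j)\to(j)$ with $j\ne0$, or $(j)\to(j-1)$ with $j\geq 1$; or - $r\ge3$ and the chain is increasing, $j_{k+1}=j_k+1$ for all $k<r$; or decreasing, $j_{k+1}=j_k-1$ for all $k<r$; or it is $(0)\to(1)\to(0)$. 3. **Matrix blocks.** Put $J=-iJ^{12}$, $J^\pm=\frac1{\sqrt2}(\mp J^{23}+iJ^{31})$, $B^\pm=\frac1{\sqrt2}(iB^1\pm B^2)$. Every chain representation as in 2, with sectors $S_1,\dots,S_r$, has a basis of vectors $|k,m\rangle\in S_k$ ($1\le k\le r$; $m=-j_k,-j_k+1,\dots,j_k$) such that, with $j=j_k$ and with $|k,m\rangle=0$ for all other $m$, $$J|k,m\rangle=m|k,m\rangle,\quad J^{+}|k,m\rangle=\sqrt{\tfrac12(j+m+1)(j-m)}\,|k,m+1\rangle,\quad J^{-}|k,m\rangle=\sqrt{\tfrac12(j-m+1)(j+m)}\,|k,m-1\rangle,$$ all boosts vanish on $S_r$, and for $k<r$ $$B^3|k,m\rangle=\beta^3|k+1,m\rangle,\qquad B^\pm|k,m\rangle=\beta^\pm|k+1,m\pm1\rangle,$$ where $(\beta^3,\beta^+,\beta^-)$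 equals - $\left(\sqrt{(j+m+1)(j-m+1)},\ \sqrt{\tfrac12(j+m+2)(j+m+1)},\ \sqrt{\tfrac12(j-m+2)(j-m+1)}\right)$ if $j_{k+1}=j+1$; - $\left(m,\ -\sqrt{\tfrac12(j+m+1)(j-m)},\ \sqrt{\tfrac12(j-m+1)(j+m)}\right)$ if $j_{k+1}=j$; - $\left(-\sqrt{(j+m)(j-m)},\ \sqrt{\tfrac12(j-m)(j-m-1)},\ \sqrt{\tfrac12(j+m)(j+m-1)}\right)$ if $j_{k+1}=j-1$. -/

import Mathlib

attribute [local instance 100] LieRing.ofAssociativeRing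

/-- The two non-Lorentzian conformal algebras: Carrollian (CCA) and Galilean (GCA), in `d = 4`. -/
inductive ConformalLimit
  | carrollian
  | galilean

/-- The spatial rotation `J^{ij}`, written as the matrix of `ad J^{ij}` on the span of the
translations `P^0, P^1, P^2, P^3` (both in the CCA and in the GCA):
`[J^{ij}, P^k] = δ^{ik} P^j - δ^{jk} P^i` and `[J^{ij}, P^0] = 0`. -/
def rotationMatrix (i j : Fin 3) : Matrix (Fin 4) (Fin 4) ℝ :=
  Matrix.single j.succ i.succ 1 - Matrix.single i.succ j.succ 1

/-- The boost `B^i`, written as the matrix of `ad B^i` on the span of `P^0, P^1, P^2, P^3`.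
Carrollian: `[B^i, P^j] = δ^{ij} P^0` and `[B^i, P^0] = 0`.
Galilean: `[B^i, P^0] = - P^i` and `[B^i, P^j] = 0`. -/
def boostMatrix : ConformalLimit → Fin 3 → Matrix (Fin 4) (Fin 4) ℝ
  | .carrollian, i => Matrix.single 0 i.succ 1
  | .galilean, i => - Matrix.single i.succ 0 1

/-- The commutation relations of `iso(3)` satisfied by the generators, in both cases. -/
theorem rotation_commutators (G : ConformalLimit) (i j k l : Fin 3) :
    ⁅rotationMatrix i j, rotationMatrix k l⁆ =
      (if i = k then rotationMatrix j l else 0) - (if i = l then rotationMatrix j k else 0)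
        + (if j = l then rotationMatrix i k else 0) - (if j = k then rotationMatrix i l else 0) ∧
    ⁅rotationMatrix i j, boostMatrix G k⁆ =
      (if i = k then boostMatrix G j else 0) - (if j = k then boostMatrix G i else 0) ∧
    ⁅boostMatrix G i, boostMatrix G j⁆ = 0 := by
  have h : ∀ a b c d : Fin 4, Matrix.single a b (1 : ℝ) * Matrix.single c d 1 =
      if b = c then Matrix.single a d 1 else 0 := by
    intro a b c d
    split_ifs with hbc
    · subst hbc; simp
    · rw [Matrix.single_mul_single_of_ne _ _ _ _ hbc]
  have h0 : ∀ a : Fin 3, (0 : Fin 4) ≠ a.succ := fun a => (Fin.succ_ne_zero a).symm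
  refine ⟨?_, ?_, ?_⟩
  · simp only [rotationMatrix, Ring.lie_def, mul_sub, sub_mul, h, Fin.succ_inj]
    split_ifs <;> subst_vars <;> first | (exfalso; tauto) | abel
  · cases G <;>
    simp only [rotationMatrix, boostMatrix, Ring.lie_def, mul_sub, sub_mul, mul_neg, neg_mul, h,
      Fin.succ_inj, h0, Fin.succ_ne_zero, if_false] <;>
    split_ifs <;> subst_vars <;> first | (exfalso; tauto) | abel
  · cases G <;> simp [boostMatrix, Ring.lie_def, h, h0]

/-- The rotation algebra `iso(3) = {J^{ij}, B^i}` of the four-dimensional CCA or GCA: the real Lie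
algebra generated by the spatial rotations and the boosts. -/
def rotationAlgebra (G : ConformalLimit) : LieSubalgebra ℝ (Matrix (Fin 4) (Fin 4) ℝ) :=
  LieSubalgebra.lieSpan ℝ (Matrix (Fin 4) (Fin 4) ℝ)
    (Set.range (fun p : Fin 3 × Fin 3 => rotationMatrix p.1 p.2) ∪ Set.range (boostMatrix G))

/-- `J^{ij}` as an element of the rotation algebra. -/
def genJ (G : ConformalLimit) (i j : Fin 3) : rotationAlgebra G :=
  ⟨rotationMatrix i j, LieSubalgebra.subset_lieSpan (Or.inl ⟨(i, j), rfl⟩)⟩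

/-- `B^i` as an element of the rotation algebra. -/
def genB (G : ConformalLimit) (i : Fin 3) : rotationAlgebra G :=
  ⟨boostMatrix G i, LieSubalgebra.subset_lieSpan (Or.inr ⟨i, rfl⟩)⟩

/-- Representations of the (real) rotation algebra by `ℂ`-linear endomorphisms of `V`. -/
abbrev RotationRep (G : ConformalLimit) (V : Type*) [AddCommGroup V] [Module ℂ V] :=
  rotationAlgebra G →ₗ⁅ℝ⁆ Module.End ℂ V

section Sectors

variable {G : ConformalLimit} {V : Type*} [AddCommGroup V] [Module ℂ V]

/-- The subspace `S` is invariant under the spatial rotations. -/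
def IsRotationInvariant (ρ : RotationRep G V) (S : Submodule ℂ V) : Prop :=
  ∀ i j, ∀ v ∈ S, ρ (genJ G i j) v ∈ S

/-- `S` is a sub-sector `(j)` with `2 j = n`: a subspace that is invariant and irreducible under
the spatial rotations, of dimension `2 j + 1 = n + 1`. All spins are given by the natural number
`n = 2 j`, so that `j` ranges over the non-negative half-integers. -/
structure IsSector (ρ : RotationRep G V) (S : Submodule ℂ V) (n : ℕ) : Prop where
  invariant : IsRotationInvariant ρ S
  ne_bot : S ≠ ⊥
  irreducible : ∀ T ≤ S, IsRotationInvariant ρ T → T = ⊥ ∨ T = S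
  finrank_eq : Module.finrank ℂ S = n + 1

/-- `(j')` occurs in `(1) ⊗ (j)`, where `n = 2 j` and `n' = 2 j'`: the spin `j'` is `j + 1`, or
`j` with `j ≠ 0`, or `j - 1`. -/
def SpinStep (n n' : ℕ) : Prop :=
  n' = n + 2 ∨ (n' = n ∧ n ≠ 0) ∨ n = n' + 2

/-- The step `W_i` of the filtration by the order: the sum of the sectors of order at most `i`. -/
def orderFiltration {N : ℕ} (S : Fin N → Submodule ℂ V) (ord : Fin N → ℕ) (i : ℕ) :
    Submodule ℂ V :=
  ⨆ k, ⨆ _ : ord k ≤ i, S k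

/-- A presentation of `ρ` as a multiplet of rank `r`: `V` is the direct sum of sectors `S k` of
spin `n k / 2` and order `ord k`, and the subspaces `W_i` spanned by the sectors of order at most
`i` form a strictly increasing sequence `0 = W_0 ⊊ W_1 ⊊ ⋯ ⊊ W_r = V`. -/
structure IsMultiplet (ρ : RotationRep G V) (r : ℕ) {N : ℕ}
    (S : Fin N → Submodule ℂ V) (n ord : Fin N → ℕ) : Prop where
  sector : ∀ k, IsSector ρ (S k) (n k)
  internal : DirectSum.IsInternal S
  filtration_zero : orderFiltration S ord 0 = ⊥
  filtration_lt : ∀ i < r, orderFiltration S ord i < orderFiltration S ord (i + 1)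
  filtration_rank : orderFiltration S ord r = ⊤
  /-- The boosts map `W_i` into `W_{i-1}`. -/
  boost_filtration : ∀ i < r, ∀ a, ∀ v ∈ orderFiltration S ord (i + 1),
    ρ (genB G a) v ∈ orderFiltration S ord i
  /-- The boosts map a sector `(j)` into the sectors of lower order whose spin occurs
  in `(1) ⊗ (j)`. -/
  boost_sector : ∀ k a, ∀ v ∈ S k,
    ρ (genB G a) v ∈ ⨆ l, ⨆ _ : ord l < ord k ∧ SpinStep (n k) (n l), S l
  /-- The order drops by exactly one: the image of a sector of order `i ≥ 2` under the boosts is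
  not contained in `W_{i-2}`. -/
  boost_sharp : ∀ k, 2 ≤ ord k → ∃ a, ∃ v ∈ S k,
    ρ (genB G a) v ∉ orderFiltration S ord (ord k - 2)

/-- `ρ` is the chain `(j_1) → (j_2) → ⋯ → (j_r)` with sectors `S 0, …, S (r - 1)`, where the list
`l` consists of the numbers `2 j_1, …, 2 j_r`: `V` is the direct sum of the sectors, the boosts map
each sector to the next one, not identically to zero, and they annihilate the last one. -/
structure IsChainRep (ρ : RotationRep G V) (l : List ℕ)
    (S : Fin l.length → Submodule ℂ V) : Prop where
  ne_nil : l ≠ []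
  sector : ∀ k, IsSector ρ (S k) (l.get k)
  internal : DirectSum.IsInternal S
  boost_next : ∀ k k' : Fin l.length, k'.val = k.val + 1 → ∀ a, ∀ v ∈ S k,
    ρ (genB G a) v ∈ S k'
  boost_last : ∀ k : Fin l.length, k.val + 1 = l.length → ∀ a, ∀ v ∈ S k,
    ρ (genB G a) v = 0
  arrow : ∀ k : Fin l.length, k.val + 1 < l.length → ∃ a, ∃ v ∈ S k,
    ρ (genB G a) v ≠ 0

end Sectors

/-- The list of chain patterns; the entries of the lists are the numbers `2 j`. -/
inductive AllowedChain : List ℕ → Prop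
  /-- rank 1: `(j)` -/
  | singlet (n : ℕ) : AllowedChain [n]
  /-- rank 2: `(j) → (j + 1)` -/
  | up (n : ℕ) : AllowedChain [n, n + 2]
  /-- rank 2: `(j) → (j)`, `j ≠ 0` -/
  | level (n : ℕ) (hn : n ≠ 0) : AllowedChain [n, n]
  /-- rank 2: `(j) → (j - 1)` -/
  | down (n : ℕ) : AllowedChain [n + 2, n]
  /-- rank at least 3: `(j) → (j + 1) → (j + 2) → ⋯` -/
  | increasing (l : List ℕ) (hl : 3 ≤ l.length) (h : l.IsChain fun n n' => n' = n + 2) :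
      AllowedChain l
  /-- rank at least 3: `(j) → (j - 1) → (j - 2) → ⋯` -/
  | decreasing (l : List ℕ) (hl : 3 ≤ l.length) (h : l.IsChain fun n n' => n = n' + 2) :
      AllowedChain l
  /-- `(0) → (1) → (0)` -/
  | exceptional : AllowedChain [0, 2, 0]

/-- The three spherical components `+, 3, -` of a vector operator. -/
inductive SphericalIndex
  | plus
  | three
  | minus

/-- The change of the magnetic quantum number. -/
def SphericalIndex.shift : SphericalIndex → ℝ
  | .plus => 1
  | .three => 0
  | .minus => -1

noncomputable section Blocks

variable {G : ConformalLimit} {V : Type*} [AddCommGroup V] [Module ℂ V]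

/-- `J^+ = (-J^{23} + i J^{31}) / √2`, `J = -i J^{12}`, `J^- = (J^{23} + i J^{31}) / √2`. -/
def sphericalJ (ρ : RotationRep G V) : SphericalIndex → Module.End ℂ V
  | .plus => ((√2 : ℝ) : ℂ)⁻¹ • (-ρ (genJ G 1 2) + Complex.I • ρ (genJ G 2 0))
  | .three => -Complex.I • ρ (genJ G 0 1)
  | .minus => ((√2 : ℝ) : ℂ)⁻¹ • (ρ (genJ G 1 2) + Complex.I • ρ (genJ G 2 0))

/-- `B^± = (i B^1 ± B^2) / √2` and `B^3`. -/
def sphericalB (ρ : RotationRep G V) : SphericalIndex → Module.End ℂ V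
  | .plus => ((√2 : ℝ) : ℂ)⁻¹ • (Complex.I • ρ (genB G 0) + ρ (genB G 1))
  | .three => ρ (genB G 2)
  | .minus => ((√2 : ℝ) : ℂ)⁻¹ • (Complex.I • ρ (genB G 0) - ρ (genB G 1))

/-- The matrix elements of `J^±` and `J` in the spin `j` representation. -/
def rotationCoeff (j m : ℝ) : SphericalIndex → ℝ
  | .plus => √(1 / 2 * (j + m + 1) * (j - m))
  | .three => m
  | .minus => √(1 / 2 * (j - m + 1) * (j + m))

/-- The matrix elements of the block `𝐁_{j → j + 1}`. -/
def boostCoeffUp (j m : ℝ) : SphericalIndex → ℝ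
  | .plus => √(1 / 2 * (j + m + 2) * (j + m + 1))
  | .three => √((j + m + 1) * (j - m + 1))
  | .minus => √(1 / 2 * (j - m + 2) * (j - m + 1))

/-- The matrix elements of the block `𝐁_{j → j}`. -/
def boostCoeffLevel (j m : ℝ) : SphericalIndex → ℝ
  | .plus => -√(1 / 2 * (j + m + 1) * (j - m))
  | .three => m
  | .minus => √(1 / 2 * (j - m + 1) * (j + m))

/-- The matrix elements of the block `𝐁_{j → j - 1}`. -/
def boostCoeffDown (j m : ℝ) : SphericalIndex → ℝ
  | .plus => √(1 / 2 * (j - m) * (j - m - 1))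
  | .three => -√((j + m) * (j - m))
  | .minus => √(1 / 2 * (j + m) * (j + m - 1))

/-- The matrix elements of the block `𝐁_{j → j'}`, where `n = 2 j` and `n' = 2 j'`. -/
def boostCoeff (n n' : ℕ) (m : ℝ) (a : SphericalIndex) : ℝ :=
  if n' = n + 2 then boostCoeffUp (n / 2) m a
  else if n' = n then boostCoeffLevel (n / 2) m a
  else if n = n' + 2 then boostCoeffDown (n / 2) m a
  else 0

/-- The magnetic quantum number `m = p - j ∈ {-j, …, j}` numbered by `p = 0, …, n`, `n = 2 j`. -/
def magneticNumber (n : ℕ) (p : Fin (n + 1)) : ℝ := (p.val : ℝ) - (n : ℝ) / 2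

open Classical in
/-- The vector `|j_k, m⟩` of a basis indexed by the sectors and their magnetic quantum numbers;
it is `0` if `m` is not one of `-j_k, …, j_k`. -/
def ket {l : List ℕ}
    (b : Module.Basis (Σ k : Fin l.length, Fin (l.get k + 1)) ℂ V) (k : Fin l.length) (m : ℝ) : V :=
  ∑ p : Fin (l.get k + 1), if magneticNumber (l.get k) p = m then b ⟨k, p⟩ else 0

/-- In the basis `|j_k, m⟩`, the representation `ρ` has the standard `J` blocks and Wigner–Eckart
`B` blocks of the chain `l`. -/
structure IsStandardBasis (ρ : RotationRep G V) (l : List ℕ)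
    (b : Module.Basis (Σ k : Fin l.length, Fin (l.get k + 1)) ℂ V) : Prop where
  rotation : ∀ (k : Fin l.length) (p : Fin (l.get k + 1)) (a : SphericalIndex),
    sphericalJ ρ a (b ⟨k, p⟩) =
      ((rotationCoeff ((l.get k : ℝ) / 2) (magneticNumber (l.get k) p) a : ℝ) : ℂ) •
        ket b k (magneticNumber (l.get k) p + a.shift)
  boost : ∀ (k k' : Fin l.length), k'.val = k.val + 1 →
    ∀ (p : Fin (l.get k + 1)) (a : SphericalIndex),
    sphericalB ρ a (b ⟨k, p⟩) =
      ((boostCoeff (l.get k) (l.get k') (magneticNumber (l.get k) p) a : ℝ) : ℂ) •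
        ket b k' (magneticNumber (l.get k) p + a.shift)
  boost_last : ∀ k : Fin l.length, k.val + 1 = l.length →
    ∀ (p : Fin (l.get k + 1)) (a : SphericalIndex), sphericalB ρ a (b ⟨k, p⟩) = 0

end Blocks

universe u

/-! Over `ℂ` the rotations become an `sl₂`-triple `J^+, J, J^-`, and the boosts become three
commuting operators that form a vector operator, i.e. transform with spin 1. The CCA and the GCA
give the same commutation relations, so nothing depends on the choice of limit beyond the matrices
that realise them.

Three facts about the rotations carry the proof. The first is complete reducibility, obtained from
the Casimir operator, whose eigenvalue `j(j+1)` separates spins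
(`IsSpinTriple.sSup_irreducible_eq_top`). The second is rigidity: a vector operator whose lowering
component kills the highest weight vector of an irreducible subspace vanishes on that subspace
(`IsVectorOperator.eq_zero_of_minus_eq_zero`). The third is the selection rule: a non-zero vector
operator between spins `j` and `j'` forces `(j')` to occur in `(1) ⊗ (j)`
(`IsVectorOperator.spinStep`).

Multiplets: `B^i ± i B^j` is an eigenvector of `ad J^{ij}`, hence nilpotent, and since the boosts
commute each of them is nilpotent too. The spaces of vectors killed by all products of `i` boosts
therefore grow strictly until they fill `V`. They are rotation invariant, so sectors can be chosen
adapted to all of them at once, and the order of a sector is the step at which it is added.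

Matrix blocks: by rigidity an arrow between two sectors is determined up to a scalar, as in the
Wigner–Eckart theorem. Rescaling the bases of the successive sectors makes every arrow of a chain
equal to the standard block.

Chain patterns: the remaining condition is that the boosts commute. Their antisymmetric square is
again a vector operator, and it maps each sector to the next but one. If the two spins violate the
selection rule, it vanishes automatically; if they satisfy the rule, an explicit matrix element of
`[B^-, B^3]` is non-zero. Hence a chain exists exactly when consecutive spins obey the rule and
next-to-consecutive ones do not, and elementary combinatorics turns this into the list of patterns.
The exception `(0) → (1) → (0)` arises because `(0)` does not occur in `(1) ⊗ (0)`. -/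

section SpinTriples

/-! ### Highest weight theory of the rotation algebra -/

variable {V : Type*} [AddCommGroup V] [Module ℂ V]

/-- The operators `J^+, J, J^-` satisfy `[J, J^±] = ± J^±` and `[J^+, J^-] = J`. -/
structure IsSpinTriple (J : SphericalIndex → Module.End ℂ V) : Prop where
  three_plus : ∀ v, J .three (J .plus v) = J .plus (J .three v) + J .plus v
  three_minus : ∀ v, J .three (J .minus v) = J .minus (J .three v) - J .minus v
  plus_minus : ∀ v, J .plus (J .minus v) = J .minus (J .plus v) + J .three v

/-- The subspace `U` is stable under all components of `J`. -/
def IsStable (J : SphericalIndex → Module.End ℂ V) (U : Submodule ℂ V) : Prop :=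
  ∀ a, ∀ v ∈ U, J a v ∈ U

/-- The subspace `U` is non-zero and has no proper non-zero stable subspaces. -/
structure IsIrreducibleUnder (J : SphericalIndex → Module.End ℂ V) (U : Submodule ℂ V) : Prop where
  stable : IsStable J U
  ne_bot : U ≠ ⊥
  eq_of_le : ∀ T ≤ U, IsStable J T → T = ⊥ ∨ T = U

/-- A non-zero highest weight vector of weight `μ`. -/
structure IsPrimitive (J : SphericalIndex → Module.End ℂ V) (μ : ℂ) (v : V) : Prop where
  ne_zero : v ≠ 0
  plus : J .plus v = 0
  three : J .three v = μ • v

theorem Module.End.exists_last_iterate {X : Module.End ℂ V} {v : V} (hv : v ≠ 0)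
    (h : ∃ N, (X ^ N) v = 0) : ∃ k : ℕ, (X ^ k) v ≠ 0 ∧ X ((X ^ k) v) = 0 := by
  obtain ⟨n, hn, hn'⟩ := Nat.exists_not_and_succ_of_not_zero_of_exists
    (p := fun k => (X ^ k) v = 0) (by simpa using hv) h
  exact ⟨n, hn, by rw [← Module.End.mul_apply, ← pow_succ']; exact hn'⟩

/-- If no power of `X` vanished, the powers `X ^ k` would be eigenvectors of `ad H` with the
pairwise distinct eigenvalues `k * c`, and in finite dimension there are only finitely many. -/
theorem Module.End.isNilpotent_of_commutator_eq_smul [FiniteDimensional ℂ V]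
    {H X : Module.End ℂ V} {c : ℂ} (hc : c ≠ 0) (h : ∀ v, H (X v) = X (H v) + c • X v) :
    IsNilpotent X := by
  by_contra hX
  have hX' : ∀ k, X ^ k ≠ 0 := fun k hk => hX ⟨k, hk⟩
  have hpow : ∀ (k : ℕ) v, H ((X ^ k) v) = (X ^ k) (H v) + (k * c) • (X ^ k) v := by
    intro k
    induction k with
    | zero => intro v; simp
    | succ k ih =>
      intro v
      rw [pow_succ', Module.End.mul_apply, h, ih, Module.End.mul_apply, map_add, map_smul]
      push_cast
      module
  let A : Module.End ℂ (Module.End ℂ V) := LinearMap.mulLeft ℂ H - LinearMap.mulRight ℂ H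
  have hA : ∀ k : ℕ, A.HasEigenvalue (k * c) := by
    intro k
    refine Module.End.hasEigenvalue_of_hasEigenvector (x := X ^ k)
      ⟨Module.End.mem_eigenspace_iff.2 ?_, hX' k⟩
    ext v
    simp [A, hpow]
  refine Set.infinite_range_of_injective (f := fun k : ℕ => (k : ℂ) * c) ?_
    ((A.finite_hasEigenvalue).subset ?_)
  · intro a b hab
    simpa [hc] using hab
  · rintro _ ⟨k, rfl⟩
    exact hA k

namespace IsSpinTriple

variable {J : SphericalIndex → Module.End ℂ V} (hJ : IsSpinTriple J)
include hJ

theorem isNilpotent_plus [FiniteDimensional ℂ V] : IsNilpotent (J .plus) :=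
  Module.End.isNilpotent_of_commutator_eq_smul (H := J .three) one_ne_zero
    (by simpa using hJ.three_plus)

theorem isNilpotent_minus [FiniteDimensional ℂ V] : IsNilpotent (J .minus) :=
  Module.End.isNilpotent_of_commutator_eq_smul (H := J .three) (neg_ne_zero.2 one_ne_zero)
    (by simpa [sub_eq_add_neg] using hJ.three_minus)

theorem three_minus_pow (k : ℕ) (v : V) :
    J .three ((J .minus ^ k) v) = (J .minus ^ k) (J .three v) - (k : ℂ) • (J .minus ^ k) v := by
  induction k generalizing v with
  | zero => simp
  | succ k ih =>
    rw [pow_succ, Module.End.mul_apply, ih, hJ.three_minus, map_sub, Module.End.mul_apply]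
    push_cast
    module

theorem three_plus_pow (k : ℕ) (v : V) :
    J .three ((J .plus ^ k) v) = (J .plus ^ k) (J .three v) + (k : ℂ) • (J .plus ^ k) v := by
  induction k generalizing v with
  | zero => simp
  | succ k ih =>
    rw [pow_succ, Module.End.mul_apply, ih, hJ.three_plus, map_add, Module.End.mul_apply]
    push_cast
    module

/-- Here `v` need not be an eigenvector of `J .three`; this generality is what later excludes Jordan
blocks of `J .three`. -/
theorem plus_minus_pow {v : V} (hv : J .plus v = 0) (k : ℕ) :
    J .plus ((J .minus ^ (k + 1)) v) =
      ((k : ℂ) + 1) • ((J .minus ^ k) (J .three v) - ((k : ℂ) / 2) • (J .minus ^ k) v) := by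
  induction k with
  | zero => simp [hJ.plus_minus, hv]
  | succ k ih =>
    have hs : ∀ w, J .minus ((J .minus ^ k) w) = (J .minus ^ (k + 1)) w := fun w => by
      rw [pow_succ', Module.End.mul_apply]
    rw [pow_succ', Module.End.mul_apply, hJ.plus_minus, ih, map_smul, map_sub, map_smul, hs, hs,
      hJ.three_minus_pow]
    push_cast
    module

/-- At the last non-zero power `n` of the lowering operator, `plus_minus_pow` reads `0 = (n + 1) (μ
- n / 2)` times a non-zero vector. -/
theorem exists_primitive_weight [FiniteDimensional ℂ V] {μ : ℂ} {v : V} (hv : IsPrimitive J μ v) :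
    ∃ n : ℕ, μ = n / 2 ∧ (∀ k ≤ n, (J .minus ^ k) v ≠ 0) ∧ (J .minus ^ (n + 1)) v = 0 := by
  obtain ⟨N, hN⟩ := hJ.isNilpotent_minus
  obtain ⟨n, hn, hn'⟩ := Nat.exists_not_and_succ_of_not_zero_of_exists
    (p := fun k => (J .minus ^ k) v = 0) (by simpa using hv.ne_zero) ⟨N, by simp [hN]⟩
  refine ⟨n, ?_, fun k hk h0 => hn ?_, hn'⟩
  · have h := hJ.plus_minus_pow hv.plus n
    rw [hn', map_zero, hv.three, map_smul, ← sub_smul, smul_smul] at h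
    have h1 := (smul_eq_zero.1 h.symm).resolve_right hn
    exact sub_eq_zero.1 ((mul_eq_zero.1 h1).resolve_left (Nat.cast_add_one_ne_zero n))
  · rw [← Nat.sub_add_cancel hk, pow_add, Module.End.mul_apply, h0, map_zero]

theorem three_string {μ : ℂ} {v : V} (hv : IsPrimitive J μ v) (k : ℕ) :
    J .three ((J .minus ^ k) v) = (μ - k) • (J .minus ^ k) v := by
  rw [hJ.three_minus_pow, hv.three, map_smul, sub_smul]

theorem plus_string {μ : ℂ} {v : V} (hv : IsPrimitive J μ v) (k : ℕ) :
    J .plus ((J .minus ^ (k + 1)) v) = ((k + 1) * (μ - k / 2)) • (J .minus ^ k) v := by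
  rw [hJ.plus_minus_pow hv.plus, hv.three, map_smul, ← sub_smul, smul_smul]

theorem linearIndependent_string {n : ℕ} {μ : ℂ} {v : V} (hv : IsPrimitive J μ v)
    (h : ∀ k ≤ n, (J .minus ^ k) v ≠ 0) :
    LinearIndependent ℂ fun k : Fin (n + 1) => (J .minus ^ k.val) v := by
  refine Module.End.eigenvectors_linearIndependent' (J .three) (fun k : Fin (n + 1) => μ - k.val)
    ?_ _ fun k => ⟨Module.End.mem_eigenspace_iff.2 (hJ.three_string hv k), h k (by omega)⟩
  intro a b hab
  have : ((a.val : ℕ) : ℂ) = b.val := sub_right_injective hab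
  exact Fin.ext (by exact_mod_cast this)

theorem isStable_string {n : ℕ} {μ : ℂ} {v : V} (hv : IsPrimitive J μ v)
    (h : (J .minus ^ (n + 1)) v = 0) :
    IsStable J (Submodule.span ℂ (Set.range fun k : Fin (n + 1) => (J .minus ^ k.val) v)) := by
  intro a
  suffices hs : Submodule.span ℂ (Set.range fun k : Fin (n + 1) => (J .minus ^ k.val) v) ≤
      (Submodule.span ℂ (Set.range fun k : Fin (n + 1) => (J .minus ^ k.val) v)).comap (J a) from hs
  rw [Submodule.span_le]
  rintro _ ⟨k, rfl⟩
  have hmem : ∀ i ≤ n, (J .minus ^ i) v ∈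
      Submodule.span ℂ (Set.range fun k : Fin (n + 1) => (J .minus ^ k.val) v) := fun i hi =>
    Submodule.subset_span ⟨⟨i, by omega⟩, rfl⟩
  simp only [SetLike.mem_coe, Submodule.mem_comap]
  cases a with
  | plus =>
    rcases hk : k.val with _ | i
    · simp [hv.plus]
    · rw [hJ.plus_string hv]
      exact Submodule.smul_mem _ _ (hmem i (by omega))
  | three =>
    rw [hJ.three_string hv]
    exact Submodule.smul_mem _ _ (hmem _ (by omega))
  | minus =>
    rw [← Module.End.mul_apply, ← pow_succ']
    by_cases hk : k.val + 1 ≤ n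
    · exact hmem _ hk
    · have : k.val = n := by omega
      rw [this, h]
      exact Submodule.zero_mem _

/-- In a stable subspace, a highest weight vector of weight `n / 2` generates a stable subspace of
dimension `n + 1`. -/
theorem exists_stable_string [FiniteDimensional ℂ V] {μ : ℂ} {v : V} (hv : IsPrimitive J μ v) :
    ∃ (n : ℕ) (T : Submodule ℂ V), μ = n / 2 ∧ v ∈ T ∧ IsStable J T ∧
      Module.finrank ℂ T = n + 1 ∧ ∀ U, IsStable J U → v ∈ U → T ≤ U := by
  obtain ⟨n, hn, h1, h2⟩ := hJ.exists_primitive_weight hv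
  refine ⟨n, _, hn, Submodule.subset_span (Set.mem_range.2 ⟨0, by simp⟩),
    hJ.isStable_string hv h2, ?_, ?_⟩
  · simpa using finrank_span_eq_card (hJ.linearIndependent_string hv h1)
  · intro U hU hvU
    rw [Submodule.span_le]
    rintro _ ⟨k, rfl⟩
    have : ∀ i : ℕ, (J .minus ^ i) v ∈ U := by
      intro i
      induction i with
      | zero => simpa using hvU
      | succ i ih =>
        rw [pow_succ', Module.End.mul_apply]
        exact hU _ _ ih
    exact this k

/-- An eigenvector of `J .three` in `U` is raised as long as the result is non-zero; nilpotency of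
`J .plus` makes this stop. -/
theorem exists_primitive [FiniteDimensional ℂ V] {U : Submodule ℂ V} (hU : IsStable J U)
    (hne : U ≠ ⊥) : ∃ v ∈ U, ∃ μ, IsPrimitive J μ v := by
  have : Nontrivial U := (Submodule.nontrivial_iff_ne_bot).2 hne
  obtain ⟨μ, hμ⟩ := Module.End.exists_eigenvalue ((J .three).restrict (hU .three))
  obtain ⟨w, hw⟩ := hμ.exists_hasEigenvector
  have hw3 : J .three w = μ • (w : V) := by
    simpa using congrArg Subtype.val hw.apply_eq_smul
  obtain ⟨k, hk, hk'⟩ := Module.End.exists_last_iterate (X := J .plus)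
    (v := (w : V)) (by simpa using hw.2) (hJ.isNilpotent_plus.imp fun i hi => by simp [hi])
  have hmem : ∀ i : ℕ, (J .plus ^ i) (w : V) ∈ U := by
    intro i
    induction i with
    | zero => simp
    | succ i ih =>
      rw [pow_succ', Module.End.mul_apply]
      exact hU _ _ ih
  exact ⟨_, hmem k, μ + k, hk, hk', by rw [hJ.three_plus_pow, hw3, map_smul, add_smul]⟩

/-- The string below `v` is stable, so by irreducibility it fills `S`, and its length fixes the
weight. -/
theorem primitive_weight_of_mem [FiniteDimensional ℂ V] {S : Submodule ℂ V}
    (hS : IsIrreducibleUnder J S) {n : ℕ} (hn : Module.finrank ℂ S = n + 1) {μ : ℂ} {v : V}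
    (hv : IsPrimitive J μ v) (hvS : v ∈ S) : μ = n / 2 := by
  obtain ⟨m, T, hm, hvT, hT, hmT, hle⟩ := hJ.exists_stable_string hv
  rcases hS.eq_of_le T (hle S hS.stable hvS) hT with h | h
  · exact absurd ((Submodule.eq_bot_iff _).1 h v hvT) hv.ne_zero
  · subst h
    have : m = n := by omega
    rw [hm, this]

/-- The quadratic Casimir expression commutes with the rotations. -/
theorem casimir_commutes (a : SphericalIndex) (v : V) :
    J a ((2 : ℂ) • J .minus (J .plus v) + J .three (J .three v) + J .three v) =
      (2 : ℂ) • J .minus (J .plus (J a v)) + J .three (J .three (J a v)) + J .three (J a v) := by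
  cases a <;> simp only [map_add, map_smul, map_sub, hJ.plus_minus, hJ.three_plus, hJ.three_minus]
    <;> module

end IsSpinTriple
end SpinTriples

/-! ### Complete reducibility through the Casimir operator -/

section CompleteReducibility

variable {V : Type*} [AddCommGroup V] [Module ℂ V]

/-- An eigenvector in a quotient lifts to a generalised eigenvector. -/
theorem Module.End.exists_lift_generalized_eigenvector [FiniteDimensional ℂ V]
    {Q : Type*} [AddCommGroup Q] [Module ℂ Q] (π : V →ₗ[ℂ] Q) (A : Module.End ℂ V) {v : V} {μ : ℂ}
    (h : ∀ p : Polynomial ℂ, π (Polynomial.aeval A p v) = p.eval μ • π v) :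
    ∃ p : Polynomial ℂ, π (Polynomial.aeval A p v) = π v ∧
      ∃ a : ℕ, ((A - μ • 1) ^ a) (Polynomial.aeval A p v) = 0 := by
  -- With the minimal polynomial written as `(X - μ)^a q` and `q(μ) ≠ 0`, the polynomial `q / q(μ)`
  -- projects onto the generalised eigenspace and takes the value 1 at `μ`, so it does not change
  -- the class of `v`.
  obtain ⟨q, hq, hdvd⟩ := Polynomial.exists_eq_pow_rootMultiplicity_mul_and_not_dvd
    (minpoly ℂ A) (minpoly.ne_zero (Algebra.IsIntegral.isIntegral A)) μ
  have hqμ : q.eval μ ≠ 0 := fun h0 => hdvd (Polynomial.dvd_iff_isRoot.2 h0)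
  refine ⟨Polynomial.C (q.eval μ)⁻¹ * q, ?_, (minpoly ℂ A).rootMultiplicity μ, ?_⟩
  · rw [h]
    simp [hqμ]
  · have h1 : (A - μ • 1) = Polynomial.aeval A (Polynomial.X - Polynomial.C μ) := by
      simp [Algebra.algebraMap_eq_smul_one]
    rw [h1, ← map_pow, ← Module.End.mul_apply, ← map_mul, mul_left_comm, ← hq, map_mul,
      minpoly.aeval, mul_zero, LinearMap.zero_apply]

/-- The quadratic Casimir operator of a spin triple. -/
def casimir (J : SphericalIndex → Module.End ℂ V) : Module.End ℂ V :=
  (2 : ℂ) • (J .minus * J .plus) + J .three * J .three + J .three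

theorem IsPrimitive.casimir_apply {J : SphericalIndex → Module.End ℂ V} {μ : ℂ} {v : V}
    (hv : IsPrimitive J μ v) : casimir J v = (μ * (μ + 1)) • v := by
  simp only [casimir, LinearMap.add_apply, LinearMap.smul_apply, Module.End.mul_apply, hv.plus,
    hv.three, map_zero, map_smul]
  module

/-- The Casimir eigenvalue separates spins: the difference of the two sides is a multiple of `(m -
n) (m + n + 2)`. -/
theorem half_mul_half_add_one_injective {m n : ℕ}
    (h : (m / 2 : ℂ) * (m / 2 + 1) = (n / 2 : ℂ) * (n / 2 + 1)) : m = n := by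
  have h1 : ((m : ℂ) - n) * ((m + n + 2 : ℕ) : ℂ) = 0 := by
    push_cast
    linear_combination 4 * h
  have h2 := (mul_eq_zero.1 h1).resolve_right (Nat.cast_ne_zero.2 (by omega))
  exact_mod_cast sub_eq_zero.1 h2

namespace IsSpinTriple

variable {J : SphericalIndex → Module.End ℂ V} (hJ : IsSpinTriple J)
include hJ

theorem commute_casimir (a : SphericalIndex) : Commute (J a) (casimir J) := by
  ext v
  simpa [casimir] using hJ.casimir_commutes a v

/-- The Casimir operator is the scalar `μ (μ + 1)` on the string below `v`. A primitive vector of a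
non-zero stable subspace of it therefore has the same weight, and its own string already has full
dimension. -/
theorem exists_irreducible_string [FiniteDimensional ℂ V] {μ : ℂ} {v : V}
    (hv : IsPrimitive J μ v) : ∃ T, IsIrreducibleUnder J T ∧ v ∈ T := by
  obtain ⟨n, T, hn, hvT, hT, hdim, hle⟩ := hJ.exists_stable_string hv
  refine ⟨T, ⟨hT, ?_, fun T' hT'T hT' => or_iff_not_imp_left.2 fun hne => ?_⟩, hvT⟩
  · rintro rfl
    exact hv.ne_zero hvT
  · obtain ⟨w, hwT', ν, hw⟩ := hJ.exists_primitive hT' hne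
    obtain ⟨m, T₁, hm, -, -, hdim₁, hle₁⟩ := hJ.exists_stable_string hw
    have hstab : IsStable J (LinearMap.ker (casimir J - (μ * (μ + 1)) • 1)) := by
      intro a x hx
      have hc := congrArg (fun f : Module.End ℂ V => f x) (hJ.commute_casimir a).eq
      simp only [LinearMap.mem_ker, LinearMap.sub_apply, LinearMap.smul_apply,
        Module.End.one_apply, sub_eq_zero, Module.End.mul_apply] at hx hc ⊢
      rw [← hc, hx, map_smul]
    have hwC := hle _ hstab (by simp [hv.casimir_apply]) (hT'T hwT')
    simp only [LinearMap.mem_ker, LinearMap.sub_apply, LinearMap.smul_apply,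
      Module.End.one_apply, sub_eq_zero, hw.casimir_apply] at hwC
    have hμν := smul_left_injective ℂ hw.ne_zero hwC
    simp only [hn, hm] at hμν
    have hmn := half_mul_half_add_one_injective hμν
    refine le_antisymm hT'T ?_
    rw [← Submodule.eq_of_le_of_finrank_eq ((hle₁ T' hT' hwT').trans hT'T) (by omega)]
    exact hle₁ T' hT' hwT'

theorem semiconj_plus_pow (k : ℕ) (μ : ℂ) :
    SemiconjBy (J .plus ^ k) (J .three - μ • 1) (J .three - (μ + k) • 1) := by
  ext v
  simp only [Module.End.mul_apply, LinearMap.sub_apply, LinearMap.smul_apply,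
    Module.End.one_apply, map_sub, map_smul, hJ.three_plus_pow]
  module

/-- A generalised eigenvector of `J` annihilated by `J^+` is an eigenvector. -/
theorem three_apply_of_plus_eq_zero [FiniteDimensional ℂ V] {μ : ℂ} {v : V} (hv : J .plus v = 0)
    {a : ℕ} (ha : ((J .three - μ • 1) ^ a) v = 0) : J .three v = μ • v := by
  by_contra hne
  set X := J .three - μ • 1 with hX
  have hXv : ∀ u, X u = J .three u - μ • u := fun u => by simp [hX]
  have hXv0 : X v ≠ 0 := by rwa [hXv, Ne, sub_eq_zero]
  -- The last two non-zero members `v'` and `w = X v'` of the Jordan chain satisfy `J v' = μ v' +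
  -- w`, and `w` is primitive.
  obtain ⟨t, ht, ht'⟩ := Module.End.exists_last_iterate hXv0
    ⟨a, by rw [← Module.End.mul_apply, ← pow_succ, pow_succ', Module.End.mul_apply, ha, map_zero]⟩
  have hplus : ∀ i, J .plus ((X ^ i) v) = 0 := by
    intro i
    have h := congrArg (fun f : Module.End ℂ V => f v)
      ((hJ.semiconj_plus_pow 1 μ).pow_right i).eq
    simpa [hv] using h
  set v' := (X ^ t) v with hv'
  have hw : X v' = (X ^ t) (X v) := by
    rw [hv', ← Module.End.mul_apply, ← Module.End.mul_apply, ← pow_succ', ← pow_succ]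
  set w := X v' with hwdef
  have hJv' : J .three v' = w + μ • v' := by rw [hwdef, hXv]; abel
  have hwp : IsPrimitive J μ w := by
    refine ⟨by rw [hw]; exact ht, ?_, ?_⟩
    · have := hplus (t + 1)
      rwa [pow_succ', Module.End.mul_apply] at this
    · rw [← hw, hXv, sub_eq_zero] at ht'
      exact ht'
  have hv'0 : v' ≠ 0 := by
    rintro h0
    exact hwp.ne_zero (by rw [hwdef, h0, map_zero])
  obtain ⟨m, hm, hm1, hm2⟩ := hJ.exists_primitive_weight hwp
  obtain ⟨M, hM⟩ := hJ.isNilpotent_minus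
  obtain ⟨N, hN, hN'⟩ := Nat.exists_not_and_succ_of_not_zero_of_exists
    (p := fun k => (J .minus ^ k) v' = 0) (by simpa using hv'0) ⟨M, by simp [hM]⟩
  have hNw : (J .minus ^ (N + 1)) w = 0 := by
    have := hJ.three_minus_pow (N + 1) v'
    rw [hN', map_zero, hJv', map_add, map_smul, hN'] at this
    simpa using this.symm
  have hmN : m ≤ N := by
    by_contra hlt
    exact hm1 (N + 1) (by omega) hNw
  -- At the last non-zero power `N` of the lowering operator on `v'` this gives `(J^-)^N w + (μ -
  -- N/2) (J^-)^N v' = 0`. If `N = m`, then `(J^-)^m w = 0`, which is false; if `N > m`, the first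
  -- term vanishes and `μ = N/2` contradicts `μ = m/2`.
  have hkey := hJ.plus_minus_pow (hplus t) N
  rw [← hv', hN', map_zero, hJv', map_add, map_smul, add_sub_assoc, ← sub_smul] at hkey
  have hkey' := (smul_eq_zero.1 hkey.symm).resolve_left (Nat.cast_add_one_ne_zero N)
  rcases hmN.eq_or_lt with rfl | hlt
  · rw [hm, sub_self, zero_smul, add_zero] at hkey'
    exact hm1 m le_rfl hkey'
  · have h0 : (J .minus ^ N) w = 0 := by
      obtain ⟨d, rfl⟩ := Nat.exists_eq_add_of_lt hlt
      rw [show m + d + 1 = d + (m + 1) by omega, pow_add, Module.End.mul_apply, hm2, map_zero]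
    rw [h0, zero_add] at hkey'
    have h1 := (smul_eq_zero.1 hkey').resolve_right hN
    rw [hm] at h1
    have : (m : ℂ) = N := by linear_combination 2 * h1
    exact hlt.ne (by exact_mod_cast this)

theorem mapQ {N : Submodule ℂ V} (hN : IsStable J N) :
    IsSpinTriple fun a => N.mapQ N (J a) (hN a) := by
  refine ⟨fun v => ?_, fun v => ?_, fun v => ?_⟩ <;>
  obtain ⟨v, rfl⟩ := N.mkQ_surjective v
  · simpa using congrArg N.mkQ (hJ.three_plus v)
  · simpa using congrArg N.mkQ (hJ.three_minus v)
  · simpa using congrArg N.mkQ (hJ.plus_minus v)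

theorem restrict {N : Submodule ℂ V} (hN : IsStable J N) :
    IsSpinTriple fun a => (J a).restrict (hN a) := by
  refine ⟨fun v => ?_, fun v => ?_, fun v => ?_⟩ <;> apply Subtype.ext
  · simpa using hJ.three_plus v
  · simpa using hJ.three_minus v
  · simpa using hJ.plus_minus v

/-- Otherwise, raising `v` as often as possible and then extracting an eigenvector of `J .three`
gives a primitive vector of weight above `n / 2`. All operators applied commute with the Casimir
operator, so it would still have the Casimir eigenvalue of spin `n / 2`. -/
theorem plus_eq_zero_of_casimir [FiniteDimensional ℂ V] {n : ℕ} {v : V} {a b : ℕ}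
    (ha : ((J .three - (n / 2 : ℂ) • 1) ^ a) v = 0)
    (hb : ((casimir J - ((n / 2 : ℂ) * (n / 2 + 1)) • 1) ^ b) v = 0) : J .plus v = 0 := by
  by_contra hne
  obtain ⟨k, hk, hk'⟩ := Module.End.exists_last_iterate hne
    (X := J .plus) (hJ.isNilpotent_plus.imp fun i hi => by simp [hi])
  set y := (J .plus ^ (k + 1)) v with hy
  have hyk : (J .plus ^ k) (J .plus v) = y := by rw [hy, pow_succ, Module.End.mul_apply]
  rw [hyk] at hk hk'
  set ν : ℂ := n / 2 + (k + 1 : ℕ) with hν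
  have hya : ((J .three - ν • 1) ^ a) y = 0 := by
    have h := congrArg (fun f : Module.End ℂ V => f v)
      ((hJ.semiconj_plus_pow (k + 1) (n / 2 : ℂ)).pow_right a).eq
    simp only [Module.End.mul_apply, ha, map_zero] at h
    exact h.symm
  obtain ⟨t, ht, ht'⟩ := Module.End.exists_last_iterate hk ⟨a, hya⟩
  set z := ((J .three - ν • 1) ^ t) y with hz
  have hzp : IsPrimitive J ν z := by
    refine ⟨ht, ?_, ?_⟩
    · have h := congrArg (fun f : Module.End ℂ V => f y)
        ((hJ.semiconj_plus_pow 1 ν).pow_right t).eq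
      simpa [hk'] using h
    · simpa [sub_eq_zero] using ht'
  set c : ℂ := (n / 2 : ℂ) * (n / 2 + 1)
  have hcomm : ∀ x, Commute x (casimir J) → Commute x ((casimir J - c • 1) ^ b) := fun x hx =>
    (hx.sub_right ((Commute.one_right x).smul_right c)).pow_right b
  have hzb : ((casimir J - c • 1) ^ b) z = 0 := by
    have h3 := (hcomm _ (((hJ.commute_casimir .three).sub_left
      ((Commute.one_left (casimir J)).smul_left ν)).pow_left t)).eq
    have h1 := (hcomm _ ((hJ.commute_casimir .plus).pow_left (k + 1))).eq
    rw [hz, hy, ← Module.End.mul_apply, ← h3, Module.End.mul_apply,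
      ← Module.End.mul_apply _ (J .plus ^ (k + 1)),
      ← h1, Module.End.mul_apply, hb, map_zero, map_zero]
  have hpow : ∀ i : ℕ, ((casimir J - c • 1) ^ i) z = (ν * (ν + 1) - c) ^ i • z := by
    intro i
    induction i with
    | zero => simp
    | succ i ih =>
      rw [pow_succ', Module.End.mul_apply, ih, map_smul, LinearMap.sub_apply, hzp.casimir_apply,
        LinearMap.smul_apply, Module.End.one_apply, ← sub_smul, smul_smul, pow_succ]
  rw [hpow] at hzb
  have h0 := sub_eq_zero.1 (eq_zero_of_pow_eq_zero ((smul_eq_zero.1 hzb).resolve_right ht))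
  have h1 : (((n + 2 * (k + 1) : ℕ) : ℂ) / 2) * (((n + 2 * (k + 1) : ℕ) : ℂ) / 2 + 1) =
      (n / 2 : ℂ) * (n / 2 + 1) := by
    refine Eq.trans ?_ h0
    rw [hν]
    push_cast
    ring
  have := half_mul_half_add_one_injective h1
  omega

/-- Were the sum `N` of all irreducible subspaces proper, a primitive vector of `V ⧸ N` would lift
to a primitive vector of `V`, whose string is irreducible and not contained in `N`. -/
theorem sSup_irreducible_eq_top [FiniteDimensional ℂ V] :
    sSup {T | IsIrreducibleUnder J T} = ⊤ := by
  by_contra hne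
  set N := sSup {T | IsIrreducibleUnder J T} with hNdef
  have hN : IsStable J N := by
    intro a
    suffices h : N ≤ N.comap (J a) from h
    exact sSup_le fun T hT v hv => le_sSup hT (hT.stable a v hv)
  have hnt : Nontrivial (V ⧸ N) := Submodule.Quotient.nontrivial_iff.2 hne
  have hJq := hJ.mapQ hN
  obtain ⟨vq, -, μ, hvq⟩ := hJq.exists_primitive (U := ⊤) (fun _ _ _ => trivial) top_ne_bot
  obtain ⟨n, hn, -⟩ := hJq.exists_primitive_weight hvq
  obtain ⟨v₀, rfl⟩ := N.mkQ_surjective vq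
  have hN3 : ∀ u, N.mkQ (J .three u) = N.mapQ N (J .three) (hN .three) (N.mkQ u) := fun u => rfl
  have hC : ∀ u, N.mkQ (casimir J u) =
      casimir (fun a => N.mapQ N (J a) (hN a)) (N.mkQ u) := by
    intro u
    simp [casimir]
  have haeval : ∀ (A : Module.End ℂ V) (B : Module.End ℂ (V ⧸ N)) (x : V ⧸ N) (c : ℂ),
      x ≠ 0 → (∀ u, N.mkQ (A u) = B (N.mkQ u)) → B x = c • x → ∀ u, N.mkQ u = x →
      ∀ p : Polynomial ℂ, N.mkQ (Polynomial.aeval A p u) = p.eval c • N.mkQ u := by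
    intro A B x c hx hAB hB u hu p
    have h1 : N.mkQ (Polynomial.aeval A p u) = Polynomial.aeval B p (N.mkQ u) := by
      induction p using Polynomial.induction_on' with
      | add p q hp hq => simp only [map_add, LinearMap.add_apply, hp, hq]
      | monomial i r =>
        have hi : ∀ u, N.mkQ ((A ^ i) u) = (B ^ i) (N.mkQ u) := by
          induction i with
          | zero => intro u; rfl
          | succ i ih => intro u; rw [pow_succ, Module.End.mul_apply, ih, hAB, pow_succ,
              Module.End.mul_apply]
        simp only [Polynomial.aeval_monomial, Module.End.mul_apply,
          Module.algebraMap_end_apply, map_smul, hi]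
    rw [h1, hu, Module.End.aeval_apply_of_hasEigenvector
      ⟨Module.End.mem_eigenspace_iff.2 hB, hx⟩]
  -- Two polynomial corrections, first in `J .three` and then in the Casimir operator, make the lift
  -- a simultaneous generalised eigenvector without changing its class modulo `N`. The second
  -- preserves the effect of the first because the two operators commute.
  obtain ⟨p, hp, a, ha⟩ := Module.End.exists_lift_generalized_eigenvector N.mkQ (J .three)
    (haeval _ _ _ μ hvq.ne_zero hN3 hvq.three v₀ rfl)
  set v₁ := Polynomial.aeval (J .three) p v₀
  obtain ⟨q, hq, b, hb⟩ := Module.End.exists_lift_generalized_eigenvector N.mkQ (casimir J)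
    (haeval _ _ _ (μ * (μ + 1)) hvq.ne_zero hC hvq.casimir_apply v₁ hp)
  set v := Polynomial.aeval (casimir J) q v₁
  have hva : ((J .three - μ • 1) ^ a) v = 0 := by
    have hc1 : ∀ q : Polynomial ℂ, Commute (J .three) (Polynomial.aeval (casimir J) q) := by
      intro q
      induction q using Polynomial.induction_on' with
      | add q r hq hr => rw [map_add]; exact hq.add_right hr
      | monomial i r =>
        rw [Polynomial.aeval_monomial]
        exact (Algebra.commute_algebraMap_right r _).mul_right
          ((hJ.commute_casimir .three).pow_right i)
    have hc : Commute ((J .three - μ • 1) ^ a) (Polynomial.aeval (casimir J) q) := by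
      refine Commute.pow_left ?_ a
      refine Commute.sub_left ?_ ((Commute.one_left _).smul_left μ)
      exact hc1 q
    rw [← Module.End.mul_apply, hc.eq, Module.End.mul_apply, ha, map_zero]
  rw [hn] at hva hb
  have hplus := hJ.plus_eq_zero_of_casimir hva hb
  have hv3 := hJ.three_apply_of_plus_eq_zero hplus hva
  have hvN : N.mkQ v ≠ 0 := by rw [hq, hp]; exact hvq.ne_zero
  have hv0 : v ≠ 0 := by
    intro h0
    exact hvN (by rw [h0, map_zero])
  obtain ⟨T, hT, hvT⟩ := hJ.exists_irreducible_string ⟨hv0, hplus, hv3⟩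
  exact hvN ((Submodule.Quotient.mk_eq_zero N).2
    (le_sSup (show T ∈ {T | IsIrreducibleUnder J T} from hT) hvT))

/-- Complete reducibility. -/
theorem exists_irreducible_not_le [FiniteDimensional ℂ V] {U W : Submodule ℂ V}
    (hU : IsStable J U) (hUW : ¬ U ≤ W) : ∃ T ≤ U, IsIrreducibleUnder J T ∧ ¬ T ≤ W := by
  by_contra! hcon
  refine hUW ?_
  have htop := (hJ.restrict hU).sSup_irreducible_eq_top
  have hle : (⊤ : Submodule ℂ U) ≤ W.comap U.subtype := by
    rw [← htop]
    refine sSup_le fun T hT => ?_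
    rw [← Submodule.map_le_iff_le_comap]
    refine hcon _ (Submodule.map_subtype_le U T) ⟨?_, ?_, ?_⟩
    · rintro a _ ⟨x, hx, rfl⟩
      exact ⟨_, hT.stable a x hx, rfl⟩
    · intro h
      exact hT.ne_bot (Submodule.map_injective_of_injective U.injective_subtype
        (h.trans (Submodule.map_bot _).symm))
    · intro T' hT' hs
      have hT'U : T' ≤ U := hT'.trans (Submodule.map_subtype_le U T)
      have hmap : (T'.comap U.subtype).map U.subtype = T' := by
        rw [Submodule.map_comap_subtype, inf_eq_right.2 hT'U]
      have hle' : T'.comap U.subtype ≤ T := by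
        intro x hx
        obtain ⟨y, hy, hyx⟩ := hT' hx
        rwa [← U.injective_subtype hyx]
      refine (hT.eq_of_le _ hle' fun a x hx => hs a _ hx).imp (fun h => ?_) fun h => ?_
      · rw [← hmap, h, Submodule.map_bot]
      · rw [← hmap, h]
  intro x hx
  exact hle (x := ⟨x, hx⟩) trivial

end IsSpinTriple
end CompleteReducibility

/-! ### Vector operators and the selection rule -/

section VectorOperators

variable {V : Type*} [AddCommGroup V] [Module ℂ V]

/-- `B` is a vector operator with respect to `J`, in spherical components. -/
structure IsVectorOperator (J B : SphericalIndex → Module.End ℂ V) : Prop where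
  plus_plus : ∀ v, J .plus (B .plus v) = B .plus (J .plus v)
  plus_three : ∀ v, J .plus (B .three v) = B .three (J .plus v) + B .plus v
  plus_minus : ∀ v, J .plus (B .minus v) = B .minus (J .plus v) + B .three v
  three_plus : ∀ v, J .three (B .plus v) = B .plus (J .three v) + B .plus v
  three_three : ∀ v, J .three (B .three v) = B .three (J .three v)
  three_minus : ∀ v, J .three (B .minus v) = B .minus (J .three v) - B .minus v
  minus_plus : ∀ v, J .minus (B .plus v) = B .plus (J .minus v) + B .three v
  minus_three : ∀ v, J .minus (B .three v) = B .three (J .minus v) + B .minus v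
  minus_minus : ∀ v, J .minus (B .minus v) = B .minus (J .minus v)

/-- The antisymmetric square `B × B`. -/
def crossOperator (B : SphericalIndex → Module.End ℂ V) : SphericalIndex → Module.End ℂ V
  | .plus => B .three * B .plus - B .plus * B .three
  | .three => B .minus * B .plus - B .plus * B .minus
  | .minus => B .minus * B .three - B .three * B .minus

namespace IsVectorOperator

variable {J B : SphericalIndex → Module.End ℂ V} (hB : IsVectorOperator J B)
include hB

/-- A vector operator whose lowering component annihilates a highest weight vector of an
irreducible subspace vanishes on that subspace. -/
theorem eq_zero_of_minus_eq_zero {S : Submodule ℂ V} (hS : IsIrreducibleUnder J S) {v : V}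
    (hvS : v ∈ S) (hv : v ≠ 0) (hJv : J .plus v = 0) (hBv : B .minus v = 0) :
    ∀ a, ∀ u ∈ S, B a u = 0 := by
  -- Commutators of `J` with `B` are again components of `B` up to sign, or zero; hence the common
  -- kernel of `B` is stable.
  have hN : IsStable J (⨅ a, LinearMap.ker (B a)) := by
    intro a u hu
    simp only [Submodule.mem_iInf, LinearMap.mem_ker] at hu ⊢
    intro b
    have h1 := hB.plus_plus u
    have h2 := hB.plus_three u
    have h3 := hB.plus_minus u
    have h4 := hB.three_plus u
    have h5 := hB.three_three u
    have h6 := hB.three_minus u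
    have h7 := hB.minus_plus u
    have h8 := hB.minus_three u
    have h9 := hB.minus_minus u
    simp only [hu, map_zero, add_zero, sub_zero] at h1 h2 h3 h4 h5 h6 h7 h8 h9
    cases a <;> cases b <;> apply Eq.symm <;> assumption
  -- Since `J .plus` kills `v`, raising `B .minus v` yields `B .three v` and then `B .plus v`.
  have h3 : B .three v = 0 := by simpa [hJv, hBv] using (hB.plus_minus v).symm
  have hp : B .plus v = 0 := by simpa [hJv, h3] using (hB.plus_three v).symm
  have hvN : v ∈ ⨅ a, LinearMap.ker (B a) := by
    simp only [Submodule.mem_iInf, LinearMap.mem_ker]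
    rintro (_ | _ | _) <;> assumption
  rcases hS.eq_of_le (S ⊓ ⨅ a, LinearMap.ker (B a)) inf_le_left
    fun a u hu => ⟨hS.stable a u hu.1, hN a u hu.2⟩ with h | h
  · exact absurd ((Submodule.eq_bot_iff _).1 h v ⟨hvS, hvN⟩) hv
  · intro a u hu
    rw [← h] at hu
    exact (Submodule.mem_iInf _).1 hu.2 a

/-- Selection rule: a vector operator maps the spin `n / 2` to the spin `n' / 2` only if the latter
occurs in the product of the former with spin `1`. -/
theorem spinStep [FiniteDimensional ℂ V] (hJ : IsSpinTriple J) {S T : Submodule ℂ V} {n n' : ℕ}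
    (hS : IsIrreducibleUnder J S) (hn : Module.finrank ℂ S = n + 1)
    (hT : IsIrreducibleUnder J T) (hn' : Module.finrank ℂ T = n' + 1)
    (hST : ∀ a, ∀ v ∈ S, B a v ∈ T) (hne : ∃ a, ∃ v ∈ S, B a v ≠ 0) : SpinStep n n' := by
  obtain ⟨v, hvS, μ, hv⟩ := hJ.exists_primitive hS.stable hS.ne_bot
  obtain rfl := hJ.primitive_weight_of_mem hS hn hv hvS
  have hx : B .minus v ≠ 0 := by
    intro h
    obtain ⟨a, u, hu, hau⟩ := hne
    exact hau (hB.eq_zero_of_minus_eq_zero hS hvS hv.ne_zero hv.plus h a u hu)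
  have e1 := hB.plus_minus v
  have e2 := hB.plus_three v
  have e3 := hB.plus_plus v
  have w1 := hB.three_minus v
  have w2 := hB.three_three v
  have w3 := hB.three_plus v
  simp only [hv.plus, hv.three, map_zero, zero_add, map_smul] at e1 e2 e3 w1 w2 w3
  have hxT := hST .minus v hvS
  -- The last non-zero vector among `B .minus v`, `B .three v`, `B .plus v` is primitive; its weight
  -- `n/2 - 1`, `n/2` or `n/2 + 1` must be the spin of `T`.
  by_cases h3 : B .three v = 0
  · have hp : IsPrimitive J (n / 2 - 1) (B .minus v) :=
      ⟨hx, by rw [e1, h3], by rw [w1, sub_smul, one_smul]⟩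
    have h := hJ.primitive_weight_of_mem hT hn' hp hxT
    right; right
    have : (n : ℂ) = (n' + 2 : ℕ) := by push_cast; linear_combination 2 * h
    exact_mod_cast this
  by_cases hpl : B .plus v = 0
  · have hp : IsPrimitive J (n / 2) (B .three v) := ⟨h3, by rw [e2, hpl], w2⟩
    have h := hJ.primitive_weight_of_mem hT hn' hp (hST .three v hvS)
    right; left
    have hnn : n' = n := by
      have : (n' : ℂ) = n := by linear_combination -2 * h
      exact_mod_cast this
    refine ⟨hnn, fun hn0 => ?_⟩
    subst hnn hn0
    -- For spin 0 the one-dimensional `T` would contain non-zero vectors of the two weights `-1` and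
    -- `0`.
    obtain ⟨c, hc⟩ := exists_smul_eq_of_finrank_eq_one hn'
      (x := (⟨B .minus v, hxT⟩ : T)) (by simpa using hx) ⟨B .three v, hST .three v hvS⟩
    have hc' : c • B .minus v = B .three v := congrArg Subtype.val hc
    have h' := congrArg (J .three) hc'
    rw [map_smul, w1, w2] at h'
    simp only [Nat.cast_zero, zero_div, zero_smul, zero_sub, smul_neg, neg_eq_zero, hc'] at h'
    exact h3 h'
  · have hp : IsPrimitive J (n / 2 + 1) (B .plus v) :=
      ⟨hpl, by rw [e3], by rw [w3, add_smul, one_smul]⟩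
    have h := hJ.primitive_weight_of_mem hT hn' hp (hST .plus v hvS)
    left
    have : (n' : ℂ) = (n + 2 : ℕ) := by push_cast; linear_combination -2 * h
    exact_mod_cast this

theorem comp_left {P : Module.End ℂ V} (hP : ∀ a v, P (J a v) = J a (P v)) :
    IsVectorOperator J fun a => P * B a := by
  constructor <;> intro v <;> simp only [Module.End.mul_apply, ← hP]
  · rw [hB.plus_plus]
  · rw [hB.plus_three, map_add]
  · rw [hB.plus_minus, map_add]
  · rw [hB.three_plus, map_add]
  · rw [hB.three_three]
  · rw [hB.three_minus, map_sub]
  · rw [hB.minus_plus, map_add]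
  · rw [hB.minus_three, map_add]
  · rw [hB.minus_minus]

theorem sub {D : SphericalIndex → Module.End ℂ V} (hD : IsVectorOperator J D) :
    IsVectorOperator J fun a => B a - D a := by
  constructor <;> intro v <;> simp only [LinearMap.sub_apply, map_sub]
  · rw [hB.plus_plus, hD.plus_plus]
  · rw [hB.plus_three, hD.plus_three]; abel
  · rw [hB.plus_minus, hD.plus_minus]; abel
  · rw [hB.three_plus, hD.three_plus]; abel
  · rw [hB.three_three, hD.three_three]
  · rw [hB.three_minus, hD.three_minus]; abel
  · rw [hB.minus_plus, hD.minus_plus]; abel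
  · rw [hB.minus_three, hD.minus_three]; abel
  · rw [hB.minus_minus, hD.minus_minus]

/-- The antisymmetric square of spin 1 is again spin 1. Commutativity of the boosts thereby becomes
the vanishing of a vector operator, to which the selection rule applies. -/
theorem cross : IsVectorOperator J (crossOperator B) := by
  constructor <;> intro v <;>
  simp only [crossOperator, Module.End.mul_apply, LinearMap.sub_apply, map_sub, map_add,
    hB.plus_plus,
    hB.plus_three, hB.plus_minus, hB.three_plus, hB.three_three, hB.three_minus, hB.minus_plus,
    hB.minus_three, hB.minus_minus] <;> abel

end IsVectorOperator

/-- The projections of an internal direct sum. -/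
theorem DirectSum.IsInternal.exists_projections {ι : Type*} [Fintype ι] [DecidableEq ι]
    {S : ι → Submodule ℂ V} (hS : DirectSum.IsInternal S) :
    ∃ π : ι → Module.End ℂ V, (∀ l v, π l v ∈ S l) ∧ (∀ l, ∀ v ∈ S l, π l v = v) ∧
      (∀ k l, k ≠ l → ∀ v ∈ S k, π l v = 0) ∧ ∀ v, ∑ l, π l v = v := by
  let e := LinearEquiv.ofBijective (DirectSum.coeLinearMap S) hS
  have he : ∀ k (v : S k), e.symm v = DirectSum.lof ℂ ι (fun k => S k) k v := by
    intro k v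
    rw [LinearEquiv.symm_apply_eq]
    exact (DirectSum.coeLinearMap_lof S k v).symm
  refine ⟨fun l => (S l).subtype ∘ₗ DirectSum.component ℂ ι (fun k => S k) l ∘ₗ e.symm.toLinearMap,
    fun l v => by simp, fun l v hv => ?_, fun k l hkl v hv => ?_, fun v => ?_⟩
  · have := he l ⟨v, hv⟩
    simp only at this
    simp [this]
  · have := he k ⟨v, hv⟩
    simp only at this
    simp [this, DirectSum.component.of, hkl]
  · obtain ⟨x, rfl⟩ := e.surjective v
    simp only [LinearMap.comp_apply, LinearEquiv.coe_coe, LinearEquiv.symm_apply_apply]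
    induction x using DirectSum.induction_on with
    | zero => simp
    | add x y hx hy => simp only [map_add, Finset.sum_add_distrib, hx, hy]
    | of k x =>
      change ∑ l, _ = DirectSum.coeLinearMap S (DirectSum.lof ℂ ι (fun k => S k) k x)
      rw [DirectSum.coeLinearMap_lof, Finset.sum_eq_single k]
      · change ((DirectSum.component ℂ ι (fun k => S k) k (DirectSum.lof ℂ ι (fun k => S k) k x) : S k) : V) = x
        rw [DirectSum.component.lof_self]
      · intro l _ hl
        change ((DirectSum.component ℂ ι (fun k => S k) l (DirectSum.lof ℂ ι (fun k => S k) k x) : S l) : V) = 0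
        rw [DirectSum.component.of, dif_neg hl.symm]
        rfl
      · simp

/-- A vector operator maps an irreducible summand into the summands allowed by the
selection rule. -/
theorem IsVectorOperator.apply_mem_iSup [FiniteDimensional ℂ V] {ι : Type*} [Fintype ι]
    [DecidableEq ι] {J B : SphericalIndex → Module.End ℂ V} (hB : IsVectorOperator J B)
    (hJ : IsSpinTriple J) {S : ι → Submodule ℂ V} {n : ι → ℕ} (hS : DirectSum.IsInternal S)
    (hirr : ∀ k, IsIrreducibleUnder J (S k)) (hn : ∀ k, Module.finrank ℂ (S k) = n k + 1)
    {k : ι} (P : ι → Prop) {a : SphericalIndex} {v : V} (hv : v ∈ S k)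
    (hP : B a v ∈ ⨆ l, ⨆ _ : P l, S l) :
    B a v ∈ ⨆ l, ⨆ _ : P l ∧ SpinStep (n k) (n l), S l := by
  obtain ⟨π, h1, h2, h3, h4⟩ := hS.exists_projections
  have hcomm : ∀ l b w, π l (J b w) = J b (π l w) := by
    intro l b w
    conv_lhs => rw [← h4 w]
    simp only [map_sum]
    rw [Finset.sum_eq_single l]
    · exact h2 l _ ((hirr l).stable b _ (h1 l w))
    · intro i _ hil
      exact h3 i l hil _ ((hirr i).stable b _ (h1 i w))
    · simp
  rw [← h4 (B a v)]
  refine Submodule.sum_mem _ fun l _ => ?_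
  by_cases hl : P l
  · by_cases hstep : SpinStep (n k) (n l)
    · exact Submodule.mem_iSup_of_mem l (Submodule.mem_iSup_of_mem ⟨hl, hstep⟩ (h1 l _))
    -- The projections commute with the rotations, so `π l * B` is a vector operator from `S k` to
    -- `S l`.
    · have h0 : (π l * B a) v = 0 := by
        by_contra hne
        exact hstep ((hB.comp_left (hcomm l)).spinStep hJ (hirr k) (hn k) (hirr l) (hn l)
          (fun b w _ => h1 l _) ⟨a, v, hv, hne⟩)
      rw [Module.End.mul_apply] at h0
      rw [h0]
      exact Submodule.zero_mem _
  · have hle : (⨆ l, ⨆ _ : P l, S l) ≤ LinearMap.ker (π l) :=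
      iSup_le fun i => iSup_le fun hi w hw => h3 i l (by rintro rfl; exact hl hi) w hw
    rw [LinearMap.mem_ker.1 (hle hP)]
    exact Submodule.zero_mem _

end VectorOperators

/-! ### From Cartesian generators to spherical components -/

section SphericalComponents

variable {G : ConformalLimit} {V : Type*} [AddCommGroup V] [Module ℂ V] (ρ : RotationRep G V)

theorem RotationRep.lie_genJ_genJ (i j k l : Fin 3) (v : V) :
    ρ (genJ G i j) (ρ (genJ G k l) v) = ρ (genJ G k l) (ρ (genJ G i j) v) +
      ρ ((if i = k then genJ G j l else 0) - (if i = l then genJ G j k else 0)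
        + (if j = l then genJ G i k else 0) - (if j = k then genJ G i l else 0)) v := by
  have h : ⁅genJ G i j, genJ G k l⁆ =
      ((if i = k then genJ G j l else 0) - (if i = l then genJ G j k else 0)
        + (if j = l then genJ G i k else 0) - (if j = k then genJ G i l else 0)) := by
    apply Subtype.ext
    rw [LieSubalgebra.coe_bracket]
    refine (rotation_commutators G i j k l).1.trans ?_
    split_ifs <;> rfl
  rw [← h, LieHom.map_lie, Ring.lie_def]
  simp

theorem RotationRep.lie_genJ_genB (i j k : Fin 3) (v : V) :
    ρ (genJ G i j) (ρ (genB G k) v) = ρ (genB G k) (ρ (genJ G i j) v) +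
      ρ ((if i = k then genB G j else 0) - (if j = k then genB G i else 0)) v := by
  have h : ⁅genJ G i j, genB G k⁆ =
      ((if i = k then genB G j else 0) - (if j = k then genB G i else 0)) := by
    apply Subtype.ext
    rw [LieSubalgebra.coe_bracket]
    refine (rotation_commutators G i j k 0).2.1.trans ?_
    split_ifs <;> rfl
  rw [← h, LieHom.map_lie, Ring.lie_def]
  simp

theorem RotationRep.genB_comm (i j : Fin 3) (v : V) :
    ρ (genB G i) (ρ (genB G j) v) = ρ (genB G j) (ρ (genB G i) v) := by
  have h : ⁅genB G i, genB G j⁆ = 0 :=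
    Subtype.ext (rotation_commutators G i j 0 0).2.2
  have h' := congrArg ρ h
  rw [LieHom.map_lie, Ring.lie_def, map_zero, sub_eq_zero] at h'
  exact congrArg (fun f : Module.End ℂ V => f v) h'

theorem genJ_swap (G : ConformalLimit) (i j : Fin 3) : genJ G i j = -genJ G j i :=
  Subtype.ext (by simp [genJ, rotationMatrix])

theorem genJ_self (G : ConformalLimit) (i : Fin 3) : genJ G i i = 0 :=
  Subtype.ext (by simp [genJ, rotationMatrix])

theorem inv_sqrt_two_mul_self : ((√2 : ℝ) : ℂ)⁻¹ * ((√2 : ℝ) : ℂ)⁻¹ = 1 / 2 := by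
  rw [← mul_inv, ← Complex.ofReal_mul, Real.mul_self_sqrt (by norm_num)]
  norm_num

theorem RotationRep.cyclic_relations (v : V) :
    (ρ (genJ G 0 1) (ρ (genJ G 1 2) v) = ρ (genJ G 1 2) (ρ (genJ G 0 1) v) + ρ (genJ G 2 0) v ∧
    ρ (genJ G 0 1) (ρ (genJ G 2 0) v) = ρ (genJ G 2 0) (ρ (genJ G 0 1) v) - ρ (genJ G 1 2) v ∧
    ρ (genJ G 2 0) (ρ (genJ G 1 2) v) = ρ (genJ G 1 2) (ρ (genJ G 2 0) v) - ρ (genJ G 0 1) v) ∧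
    (ρ (genJ G 0 1) (ρ (genB G 0) v) = ρ (genB G 0) (ρ (genJ G 0 1) v) + ρ (genB G 1) v ∧
    ρ (genJ G 0 1) (ρ (genB G 1) v) = ρ (genB G 1) (ρ (genJ G 0 1) v) - ρ (genB G 0) v ∧
    ρ (genJ G 0 1) (ρ (genB G 2) v) = ρ (genB G 2) (ρ (genJ G 0 1) v)) ∧
    (ρ (genJ G 1 2) (ρ (genB G 0) v) = ρ (genB G 0) (ρ (genJ G 1 2) v) ∧
    ρ (genJ G 1 2) (ρ (genB G 1) v) = ρ (genB G 1) (ρ (genJ G 1 2) v) + ρ (genB G 2) v ∧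
    ρ (genJ G 1 2) (ρ (genB G 2) v) = ρ (genB G 2) (ρ (genJ G 1 2) v) - ρ (genB G 1) v) ∧
    (ρ (genJ G 2 0) (ρ (genB G 0) v) = ρ (genB G 0) (ρ (genJ G 2 0) v) - ρ (genB G 2) v ∧
    ρ (genJ G 2 0) (ρ (genB G 1) v) = ρ (genB G 1) (ρ (genJ G 2 0) v) ∧
    ρ (genJ G 2 0) (ρ (genB G 2) v) = ρ (genB G 2) (ρ (genJ G 2 0) v) + ρ (genB G 0) v) := by
  have h02 : genJ G 0 2 = -genJ G 2 0 := genJ_swap G 0 2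
  refine ⟨⟨?_, ?_, ?_⟩, ⟨?_, ?_, ?_⟩, ⟨?_, ?_, ?_⟩, ?_, ?_, ?_⟩ <;>
  first
  | rw [ρ.lie_genJ_genJ]; simp [h02, sub_eq_add_neg]
  | rw [ρ.lie_genJ_genB]; simp [sub_eq_add_neg]

theorem isSpinTriple_sphericalJ : IsSpinTriple (sphericalJ ρ) := by
  have hI := Complex.I_mul_I
  have hs := inv_sqrt_two_mul_self
  constructor <;> intro v <;>
  obtain ⟨⟨h1, h2, h3⟩, -⟩ := ρ.cyclic_relations v <;>
  simp only [sphericalJ, LinearMap.add_apply, LinearMap.smul_apply, LinearMap.neg_apply, map_add,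
    map_smul, map_neg, h1, h2, h3] <;>
  -- Only `s * s = 1 / 2` and `I * I = -1` enter, so the claim reduces to identities between
  -- coefficients.
  generalize ((√2 : ℝ) : ℂ)⁻¹ = s at hs ⊢ <;> match_scalars <;>
  clear h1 h2 h3 <;> grind

theorem isVectorOperator_sphericalB : IsVectorOperator (sphericalJ ρ) (sphericalB ρ) := by
  have hI := Complex.I_mul_I
  have hs := inv_sqrt_two_mul_self
  constructor <;> intro v <;>
  obtain ⟨-, ⟨h1, h2, h3⟩, ⟨h4, h5, h6⟩, h7, h8, h9⟩ := ρ.cyclic_relations v <;>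
  simp only [sphericalJ, sphericalB, LinearMap.add_apply, LinearMap.sub_apply, LinearMap.smul_apply,
    LinearMap.neg_apply, map_add, map_sub, map_smul, map_neg, h1, h2, h3, h4, h5, h6, h7, h8, h9] <;>
  generalize ((√2 : ℝ) : ℂ)⁻¹ = s at hs ⊢ <;> match_scalars <;>
  clear h1 h2 h3 h4 h5 h6 h7 h8 h9 <;> grind

theorem genJ_eq_sphericalJ :
    ρ (genJ G 0 1) = Complex.I • sphericalJ ρ .three ∧
    ρ (genJ G 1 2) = ((√2 : ℝ) : ℂ)⁻¹ • (sphericalJ ρ .minus - sphericalJ ρ .plus) ∧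
    ρ (genJ G 2 0) =
      (-Complex.I * ((√2 : ℝ) : ℂ)⁻¹) • (sphericalJ ρ .minus + sphericalJ ρ .plus) := by
  have hI := Complex.I_mul_I
  have hs := inv_sqrt_two_mul_self
  simp only [sphericalJ]
  generalize ((√2 : ℝ) : ℂ)⁻¹ = s at hs ⊢
  refine ⟨?_, ?_, ?_⟩ <;> match_scalars <;> grind

theorem genB_eq_sphericalB :
    ρ (genB G 0) =
      (-Complex.I * ((√2 : ℝ) : ℂ)⁻¹) • (sphericalB ρ .plus + sphericalB ρ .minus) ∧
    ρ (genB G 1) = ((√2 : ℝ) : ℂ)⁻¹ • (sphericalB ρ .plus - sphericalB ρ .minus) ∧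
    ρ (genB G 2) = sphericalB ρ .three := by
  have hI := Complex.I_mul_I
  have hs := inv_sqrt_two_mul_self
  simp only [sphericalB]
  generalize ((√2 : ℝ) : ℂ)⁻¹ = s at hs ⊢
  refine ⟨?_, ?_, trivial⟩ <;> match_scalars <;> grind

theorem isRotationInvariant_iff_isStable {U : Submodule ℂ V} :
    IsRotationInvariant ρ U ↔ IsStable (sphericalJ ρ) U := by
  constructor
  · rintro h (_ | _ | _) v hv
    · exact U.smul_mem _ (U.add_mem (U.neg_mem (h 1 2 v hv)) (U.smul_mem _ (h 2 0 v hv)))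
    · exact U.smul_mem _ (h 0 1 v hv)
    · exact U.smul_mem _ (U.add_mem (h 1 2 v hv) (U.smul_mem _ (h 2 0 v hv)))
  · intro h i j v hv
    obtain ⟨h1, h2, h3⟩ := genJ_eq_sphericalJ ρ
    have m1 : ρ (genJ G 0 1) v ∈ U := h1 ▸ U.smul_mem _ (h _ v hv)
    have m2 : ρ (genJ G 1 2) v ∈ U := h2 ▸ U.smul_mem _ (U.sub_mem (h _ v hv) (h _ v hv))
    have m3 : ρ (genJ G 2 0) v ∈ U := h3 ▸ U.smul_mem _ (U.add_mem (h _ v hv) (h _ v hv))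
    fin_cases i <;> fin_cases j <;>
    simp only [Fin.zero_eta, Fin.mk_one, Fin.reduceFinMk, genJ_self, map_zero,
      LinearMap.zero_apply, U.zero_mem, m1, m2, m3, genJ_swap G 1 0, genJ_swap G 0 2,
      genJ_swap G 2 1, map_neg, LinearMap.neg_apply, U.neg_mem_iff]

theorem isSector_iff {S : Submodule ℂ V} {n : ℕ} :
    IsSector ρ S n ↔ IsIrreducibleUnder (sphericalJ ρ) S ∧ Module.finrank ℂ S = n + 1 := by
  constructor
  · intro h
    exact ⟨⟨(isRotationInvariant_iff_isStable ρ).1 h.invariant, h.ne_bot, fun T hT hs =>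
      h.irreducible T hT ((isRotationInvariant_iff_isStable ρ).2 hs)⟩, h.finrank_eq⟩
  · rintro ⟨h, hn⟩
    exact ⟨(isRotationInvariant_iff_isStable ρ).2 h.stable, h.ne_bot, fun T hT hs =>
      h.eq_of_le T hT ((isRotationInvariant_iff_isStable ρ).1 hs), hn⟩

/-- Cartesian and spherical components span the same complex space of operators; only statements
about all components at once can be transferred. -/
theorem forall_genB_mem_iff {U : Submodule ℂ V} {v : V} :
    (∀ i, ρ (genB G i) v ∈ U) ↔ ∀ a, sphericalB ρ a v ∈ U := by
  constructor
  · rintro h (_ | _ | _)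
    · exact U.smul_mem _ (U.add_mem (U.smul_mem _ (h 0)) (h 1))
    · exact h 2
    · exact U.smul_mem _ (U.sub_mem (U.smul_mem _ (h 0)) (h 1))
  · intro h
    obtain ⟨h1, h2, h3⟩ := genB_eq_sphericalB ρ
    intro i
    fin_cases i
    · exact h1 ▸ U.smul_mem _ (U.add_mem (h _) (h _))
    · exact h2 ▸ U.smul_mem _ (U.sub_mem (h _) (h _))
    · exact h3 ▸ h _

theorem forall_genB_eq_zero_iff {v : V} :
    (∀ i, ρ (genB G i) v = 0) ↔ ∀ a, sphericalB ρ a v = 0 := by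
  simpa using forall_genB_mem_iff ρ (U := ⊥) (v := v)

theorem sphericalB_comm (a b : SphericalIndex) (v : V) :
    sphericalB ρ a (sphericalB ρ b v) = sphericalB ρ b (sphericalB ρ a v) := by
  have h10 := ρ.genB_comm 1 0 v
  have h20 := ρ.genB_comm 2 0 v
  have h21 := ρ.genB_comm 2 1 v
  cases a <;> cases b <;>
  simp only [sphericalB, LinearMap.add_apply, LinearMap.sub_apply, LinearMap.smul_apply, map_add,
    map_sub, map_smul, h10, h20, h21] <;>
  module

end SphericalComponents

/-! ### The filtration by boosts and the multiplet structure -/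

section Multiplets

variable {G : ConformalLimit} {V : Type*} [AddCommGroup V] [Module ℂ V] (ρ : RotationRep G V)

theorem isNilpotent_genB [FiniteDimensional ℂ V] (i : Fin 3) : IsNilpotent (ρ (genB G i)) := by
  obtain ⟨j, hj⟩ : ∃ j, i ≠ j := ⟨i + 1, by fin_cases i <;> decide⟩
  -- For `c = ± i` one has `[J^{ij}, B^i + c B^j] = -c (B^i + c B^j)`. The boost `B^i` is half the
  -- sum of the two commuting nilpotent operators obtained in this way.
  have key : ∀ c : ℂ, c * c = -1 → IsNilpotent (ρ (genB G i) + c • ρ (genB G j)) := by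
    intro c hc
    refine Module.End.isNilpotent_of_commutator_eq_smul (H := ρ (genJ G i j)) (c := -c)
      (by rintro h; simp [neg_eq_zero.1 h] at hc) fun v => ?_
    have h1 := ρ.lie_genJ_genB i j i v
    have h2 := ρ.lie_genJ_genB i j j v
    simp only [if_true, if_neg hj, if_neg hj.symm, sub_zero, zero_sub, map_neg,
      LinearMap.neg_apply] at h1 h2
    simp only [LinearMap.add_apply, LinearMap.smul_apply, map_add, map_smul, h1, h2]
    match_scalars <;> grind
  have hcomm : Commute (ρ (genB G i)) (ρ (genB G j)) := LinearMap.ext (ρ.genB_comm i j)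
  have hadd := Commute.isNilpotent_add (x := ρ (genB G i) + Complex.I • ρ (genB G j))
    (y := ρ (genB G i) + (-Complex.I) • ρ (genB G j))
    (((Commute.refl _).add_left (hcomm.symm.smul_left _)).add_right
      ((hcomm.add_left ((Commute.refl _).smul_left _)).smul_right _))
    (key _ Complex.I_mul_I) (key _ (by rw [neg_mul_neg, Complex.I_mul_I]))
  have h2 : ρ (genB G i) = (2 : ℂ)⁻¹ • (ρ (genB G i) + Complex.I • ρ (genB G j) +
      (ρ (genB G i) + (-Complex.I) • ρ (genB G j))) := by module
  rw [h2]
  exact hadd.smul _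

/-- If commuting nilpotent operators leave a proper subspace invariant, then they map some vector
outside of it into it. -/
theorem exists_notMem_forall_genB_mem [FiniteDimensional ℂ V] {W : Submodule ℂ V} (hW : W ≠ ⊤)
    (hB : ∀ i, ∀ v ∈ W, ρ (genB G i) v ∈ W) : ∃ v ∉ W, ∀ i, ρ (genB G i) v ∈ W := by
  have step : ∀ i, ∀ v ∉ W, ∃ k, (ρ (genB G i) ^ k) v ∉ W ∧
      ρ (genB G i) ((ρ (genB G i) ^ k) v) ∈ W := by
    intro i v hv
    obtain ⟨N, hN⟩ := isNilpotent_genB ρ i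
    obtain ⟨k, hk, hk'⟩ := Nat.exists_not_and_succ_of_not_zero_of_exists
      (p := fun k => (ρ (genB G i) ^ k) v ∈ W) (by simpa using hv) ⟨N, by simp [hN]⟩
    exact ⟨k, hk, by rw [← Module.End.mul_apply, ← pow_succ']; exact hk'⟩
  have keep : ∀ i j (k : ℕ), ∀ v, ρ (genB G i) v ∈ W →
      ρ (genB G i) ((ρ (genB G j) ^ k) v) ∈ W := by
    intro i j k
    induction k with
    | zero => intro v hv; simpa using hv
    | succ k ih =>
      intro v hv
      rw [pow_succ', Module.End.mul_apply, ρ.genB_comm]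
      exact hB j _ (ih v hv)
  obtain ⟨v, hv⟩ : ∃ v, v ∉ W := by
    by_contra! h
    exact hW (Submodule.eq_top_iff'.2 h)
  -- Each boost in turn is applied up to the last power that stays outside `W`; what was achieved
  -- for the earlier boosts survives because the boosts commute and preserve `W`.
  obtain ⟨a, ha, ha'⟩ := step 0 v hv
  obtain ⟨b, hb, hb'⟩ := step 1 _ ha
  obtain ⟨c, hc, hc'⟩ := step 2 _ hb
  refine ⟨_, hc, fun i => ?_⟩
  fin_cases i
  · exact keep _ _ _ _ (keep _ _ _ _ ha')
  · exact keep _ _ _ _ hb'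
  · exact hc'

/-- The `i`-th step consists of the vectors annihilated by all products of `i` boosts. -/
noncomputable def boostFiltration : ℕ → Submodule ℂ V
  | 0 => ⊥
  | i + 1 => ⨅ a, (boostFiltration i).comap (ρ (genB G a))

theorem mem_boostFiltration_succ {i : ℕ} {v : V} :
    v ∈ boostFiltration ρ (i + 1) ↔ ∀ a, ρ (genB G a) v ∈ boostFiltration ρ i := by
  simp [boostFiltration]

theorem boostFiltration_mono : Monotone (boostFiltration ρ) := by
  refine monotone_nat_of_le_succ fun i => ?_
  induction i with
  | zero => exact bot_le
  | succ i ih =>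
    intro v hv
    rw [mem_boostFiltration_succ] at hv ⊢
    exact fun a => ih (hv a)

theorem isRotationInvariant_boostFiltration (i : ℕ) :
    IsRotationInvariant ρ (boostFiltration ρ i) := by
  induction i with
  | zero =>
    intro i j v hv
    rw [boostFiltration, Submodule.mem_bot] at hv
    rw [hv, map_zero]
    exact Submodule.zero_mem _
  | succ n ih =>
    intro i j v hv
    rw [mem_boostFiltration_succ] at hv ⊢
    intro k
    have h := ρ.lie_genJ_genB i j k v
    rw [← sub_eq_iff_eq_add] at h
    rw [← h]
    refine Submodule.sub_mem _ (ih i j _ (hv k)) ?_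
    rw [map_sub, LinearMap.sub_apply]
    refine Submodule.sub_mem _ ?_ ?_ <;> split_ifs <;> simp [hv]

theorem boostFiltration_lt_succ [FiniteDimensional ℂ V] {i : ℕ} (h : boostFiltration ρ i ≠ ⊤) :
    boostFiltration ρ i < boostFiltration ρ (i + 1) := by
  have hmono := boostFiltration_mono ρ (Nat.le_succ i)
  obtain ⟨v, hv, hv'⟩ := exists_notMem_forall_genB_mem ρ h fun a v hv =>
    (mem_boostFiltration_succ ρ).1 (hmono hv) a
  exact lt_of_le_of_ne hmono fun heq => hv (heq ▸ (mem_boostFiltration_succ ρ).2 hv')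

theorem exists_boostFiltration_eq_top [FiniteDimensional ℂ V] :
    ∃ r, boostFiltration ρ r = ⊤ := by
  by_contra! h
  exact not_strictMono_of_wellFoundedGT (boostFiltration ρ)
    (strictMono_nat_of_lt_succ fun i => boostFiltration_lt_succ ρ (h i))

open Classical in
/-- An independent family of irreducible subspaces can be enlarged to one with a given larger
stable sum. -/
theorem IsSpinTriple.exists_supIndep_extension [FiniteDimensional ℂ V]
    {J : SphericalIndex → Module.End ℂ V} (hJ : IsSpinTriple J) {U : Submodule ℂ V}
    (hU : IsStable J U) (F : Finset (Submodule ℂ V)) (hF : ∀ T ∈ F, IsIrreducibleUnder J T)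
    (hind : F.SupIndep id) (hle : F.sup id ≤ U) :
    ∃ F', F ⊆ F' ∧ (∀ T ∈ F', IsIrreducibleUnder J T) ∧ F'.SupIndep id ∧ F'.sup id = U := by
  induction hW : F.sup id using WellFoundedGT.induction generalizing F with
  | ind W ih =>
    by_cases hUW : U ≤ W
    · exact ⟨F, subset_rfl, hF, hind, le_antisymm hle (hW ▸ hUW)⟩
    · obtain ⟨T, hTU, hT, hTW⟩ := hJ.exists_irreducible_not_le hU hUW
      have hstab : IsStable J W := by
        intro a
        suffices h : W ≤ W.comap (J a) from h
        rw [← hW]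
        refine Finset.sup_le fun S hS v hv => ?_
        exact (Finset.le_sup (f := id) hS : S ≤ F.sup id) ((hF S hS).stable a v hv)
      have hdisj : Disjoint T W := by
        rw [disjoint_iff]
        refine (hT.eq_of_le (T ⊓ W) inf_le_left
          fun a v hv => ⟨hT.stable a v hv.1, hstab a v hv.2⟩).resolve_right fun h => hTW ?_
        rw [← h]
        exact inf_le_right
      have hsup : (insert T F).sup id = T ⊔ W := by rw [Finset.sup_insert, hW, id]
      obtain ⟨F', h1, h2, h3, h4⟩ := ih (T ⊔ W)
        (lt_of_le_of_ne le_sup_right fun h => hTW (h ▸ le_sup_left)) (insert T F)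
        (fun S hS => (Finset.mem_insert.1 hS).elim (fun h => h ▸ hT) (hF S))
        (hind.insert (by rwa [hW])) (hsup.trans_le (sup_le hTU (hW ▸ hle))) hsup
      exact ⟨F', (Finset.subset_insert T F).trans h1, h2, h3, h4⟩

/-- One family of sectors has to split all steps of the filtration at once, so the family for one
step is extended, rather than replaced, at the next. -/
theorem exists_sectors_adapted [FiniteDimensional ℂ V] (i : ℕ) :
    ∃ (F : Finset (Submodule ℂ V)) (ord : Submodule ℂ V → ℕ),
      (∀ T ∈ F, IsIrreducibleUnder (sphericalJ ρ) T) ∧ F.SupIndep id ∧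
      F.sup id = boostFiltration ρ i ∧
      ∀ j ≤ i, (F.filter fun T => ord T ≤ j).sup id = boostFiltration ρ j := by
  classical
  induction i with
  | zero =>
    refine ⟨∅, fun _ => 0, by simp, by simp, by simp [boostFiltration], fun j hj => ?_⟩
    obtain rfl := Nat.le_zero.1 hj
    simp [boostFiltration]
  | succ i ih =>
    obtain ⟨F, ord, h1, h2, h3, h4⟩ := ih
    obtain ⟨F', hFF', h1', h2', h3'⟩ := (isSpinTriple_sphericalJ ρ).exists_supIndep_extension
      ((isRotationInvariant_iff_isStable ρ).1 (isRotationInvariant_boostFiltration ρ (i + 1)))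
      F h1 h2 (h3.trans_le (boostFiltration_mono ρ i.le_succ))
    -- Old orders are capped at `i`, since the induction hypothesis gives no explicit bound on them;
    -- the cap changes no filter with `j < i`, and for `j = i` it selects all of `F`.
    refine ⟨F', fun T => if T ∈ F then min (ord T) i else i + 1, h1', h2', h3', fun j hj => ?_⟩
    rcases hj.lt_or_eq with hlt | rfl
    · have hfilter : (F'.filter fun T => (if T ∈ F then min (ord T) i else i + 1) ≤ j) =
          F.filter fun T => min (ord T) i ≤ j := by
        ext T
        by_cases hT : T ∈ F
        · simp [hT, hFF' hT]
        · simp only [Finset.mem_filter, hT, if_false, false_and, iff_false, not_and]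
          omega
      rw [hfilter]
      rcases (Nat.lt_succ_iff.1 hlt).lt_or_eq with hji | rfl
      · rw [← h4 j hji.le]
        congr 1
        refine Finset.filter_congr fun T _ => ?_
        omega
      · rw [Finset.filter_true_of_mem fun T _ => min_le_right _ _, h3]
    · rw [Finset.filter_true_of_mem, h3']
      intro T _
      dsimp only
      split_ifs <;> omega

theorem exists_isMultiplet [FiniteDimensional ℂ V] :
    ∃ (r N : ℕ) (S : Fin N → Submodule ℂ V) (n ord : Fin N → ℕ), IsMultiplet ρ r S n ord := by
  classical
  have hex := exists_boostFiltration_eq_top ρ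
  obtain ⟨r, hr, hmin⟩ : ∃ r, boostFiltration ρ r = ⊤ ∧ ∀ i < r, boostFiltration ρ i ≠ ⊤ :=
    ⟨Nat.find hex, Nat.find_spec hex, fun i hi => Nat.find_min hex hi⟩
  obtain ⟨F, ord, h1, h2, h3, h4⟩ := exists_sectors_adapted ρ r
  let e := F.equivFin.symm
  let S : Fin F.card → Submodule ℂ V := fun k => (e k).1
  let o : Fin F.card → ℕ := fun k => ord (S k)
  have hS : ∀ k, IsIrreducibleUnder (sphericalJ ρ) (S k) := fun k => h1 _ (e k).2
  have hW : ∀ j ≤ r, orderFiltration S o j = boostFiltration ρ j := by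
    intro j hj
    rw [← h4 j hj, orderFiltration, Finset.sup_eq_iSup]
    refine le_antisymm (iSup_le fun k => iSup_le fun hk => ?_)
      (iSup_le fun T => iSup_le fun hT => ?_)
    · exact le_iSup₂_of_le (S k) (Finset.mem_filter.2 ⟨(e k).2, hk⟩) le_rfl
    · obtain ⟨hTF, hTj⟩ := Finset.mem_filter.1 hT
      have heT : S (e.symm ⟨T, hTF⟩) = T := by simp [S]
      refine le_iSup₂_of_le (e.symm ⟨T, hTF⟩) ?_ heT.ge
      simpa only [o, heT] using hTj
  have hord : ∀ k, o k ≤ r → 1 ≤ o k := by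
    intro k _
    by_contra h0
    have h0' : o k ≤ 0 := by omega
    have : S k ≤ orderFiltration S o 0 := le_iSup₂_of_le k h0' le_rfl
    rw [hW 0 (Nat.zero_le r), boostFiltration, le_bot_iff] at this
    exact (hS k).ne_bot this
  have hind : iSupIndep S := (h2.independent).comp e.injective
  have htop : iSup S = ⊤ := by
    rw [← hr, ← h3, Finset.sup_eq_iSup]
    refine le_antisymm (iSup_le fun k => le_iSup₂_of_le (S k) (e k).2 le_rfl)
      (iSup₂_le fun T hT => le_iSup_of_le (e.symm ⟨T, hT⟩) (by simp [S]))
  have hint := DirectSum.isInternal_submodule_of_iSupIndep_of_iSup_eq_top hind htop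
  have hle : ∀ k, o k ≤ r := by
    intro k
    by_contra hk
    have hdis := hind k
    have hsub : orderFiltration S o r ≤ ⨆ l, ⨆ _ : l ≠ k, S l :=
      iSup_le fun l => iSup_le fun hl => le_iSup₂_of_le l (by rintro rfl; exact hk hl) le_rfl
    rw [hW r le_rfl, hr] at hsub
    rw [top_le_iff.1 hsub, disjoint_top] at hdis
    exact (hS k).ne_bot hdis
  have hn : ∀ k, Module.finrank ℂ (S k) = (Module.finrank ℂ (S k) - 1) + 1 := by
    intro k
    have : 0 < Module.finrank ℂ (S k) :=
      Nat.pos_of_ne_zero fun h => (hS k).ne_bot (Submodule.finrank_eq_zero.1 h)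
    omega
  refine ⟨r, F.card, S, fun k => Module.finrank ℂ (S k) - 1, o, ?_, hint, ?_, ?_, ?_, ?_, ?_, ?_⟩
  · exact fun k => (isSector_iff ρ).2 ⟨hS k, hn k⟩
  · rw [hW 0 (Nat.zero_le r), boostFiltration]
  · intro i hi
    rw [hW i hi.le, hW (i + 1) hi]
    exact boostFiltration_lt_succ ρ (hmin i hi)
  · rw [hW r le_rfl, hr]
  · intro i hi a v hv
    rw [hW (i + 1) hi, mem_boostFiltration_succ] at hv
    rw [hW i hi.le]
    exact hv a
  · intro k a v hv
    refine (forall_genB_mem_iff ρ).2 (fun c => ?_) a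
    have h1k := hord k (hle k)
    obtain ⟨d, hd⟩ := Nat.exists_eq_add_of_le' h1k
    have hmem : v ∈ orderFiltration S o (d + 1) :=
      (le_iSup₂_of_le k hd.le le_rfl : S k ≤ _) hv
    rw [hW (d + 1) (hd ▸ hle k), mem_boostFiltration_succ,
      ← hW d (by have := hle k; omega), forall_genB_mem_iff] at hmem
    -- As `o k = d + 1`, the condition `o l ≤ d` is the required strict drop of the order.
    have := (isVectorOperator_sphericalB ρ).apply_mem_iSup (isSpinTriple_sphericalJ ρ) hint hS hn
      (fun l => o l ≤ d) hv (hmem c)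
    simpa only [hd, Nat.lt_succ_iff] using this
  · intro k hk
    obtain ⟨d, hd⟩ := Nat.exists_eq_add_of_le' hk
    have hlek := hle k
    by_contra! hcon
    -- A sector of order `d + 2` mapped into the `d`-th step would lie in the step `d + 1`, a sum of
    -- other sectors, against independence.
    have hsub : S k ≤ orderFiltration S o (d + 1) := by
      intro v hv
      rw [hW (d + 1) (by omega), mem_boostFiltration_succ, ← hW d (by omega)]
      intro a
      have := hcon a v hv
      rwa [hd, Nat.add_sub_cancel] at this
    have hsub' : orderFiltration S o (d + 1) ≤ ⨆ l, ⨆ _ : l ≠ k, S l :=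
      iSup_le fun l => iSup_le fun hl => le_iSup₂_of_le l (by rintro rfl; omega) le_rfl
    have hdis := (hind k).mono_right (hsub.trans hsub')
    exact (hS k).ne_bot (disjoint_self.1 hdis)

end Multiplets

/-! ### Identities between the matrix elements -/

section Coefficients

/-- Only one factor has to be non-negative: `Real.sqrt` vanishes on negative numbers, so the other
may run past the edge of the weight range. -/
theorem sqrt_half_mul {x y : ℝ} (hx : 0 ≤ x) : √(1 / 2 * x * y) = √(1 / 2) * √x * √y := by
  rw [Real.sqrt_mul (by positivity), Real.sqrt_mul (by norm_num)]

theorem rotationCoeff_minus (j m : ℝ) :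
    rotationCoeff j m .minus = rotationCoeff j (-m) .plus := by
  simp [rotationCoeff, sub_eq_add_neg]

/-- The relations between matrix elements which express that the matrix elements `d` define a
vector operator which raises the magnetic quantum number. -/
structure RaisingRelations (j j' : ℝ) (d : ℝ → SphericalIndex → ℝ) (m : ℝ) : Prop where
  plus : rotationCoeff j' (m + 1) .plus * d m .plus = d (m + 1) .plus * rotationCoeff j m .plus
  three : rotationCoeff j' m .plus * d m .three =
    d (m + 1) .three * rotationCoeff j m .plus + d m .plus
  minus : rotationCoeff j' (m + -1) .plus * d m .minus =
    d (m + 1) .minus * rotationCoeff j m .plus + d m .three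

theorem raisingRelations_up {j m : ℝ} (hx : 0 ≤ j + m) (hy : 0 ≤ j - m) :
    RaisingRelations j (j + 1) (boostCoeffUp j) m := by
  -- In terms of `x = j + m` and `y = j - m` all roots split into factors such as `√(x + 1)` and
  -- `√(y + 2)`, and only the squares of these are needed.
  obtain ⟨x, hx'⟩ : ∃ x, x = j + m := ⟨_, rfl⟩
  obtain ⟨y, hy'⟩ : ∃ y, y = j - m := ⟨_, rfl⟩
  rw [← hx'] at hx
  rw [← hy'] at hy
  obtain rfl : j = (x + y) / 2 := by linarith
  obtain rfl : m = (x - y) / 2 := by linarith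
  have hs : √(1 / 2 : ℝ) * √(1 / 2) = 1 / 2 := Real.mul_self_sqrt (by norm_num)
  have h1 : √(x + 1) * √(x + 1) = x + 1 := Real.mul_self_sqrt (by linarith)
  have h2 : √y * √y = y := Real.mul_self_sqrt hy
  have h3 : √(y + 1) * √(y + 1) = y + 1 := Real.mul_self_sqrt (by linarith)
  have h4 : √(y + 2) * √(y + 2) = y + 2 := Real.mul_self_sqrt (by linarith)
  constructor <;> simp only [rotationCoeff, boostCoeffUp]
  · have h : √(1 / 2 * (x + 3) * y) * √(1 / 2 * (x + 2) * (x + 1)) =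
        √(1 / 2 * (x + 3) * (x + 2)) * √(1 / 2 * (x + 1) * y) := by
      rw [sqrt_half_mul (by linarith), sqrt_half_mul (by linarith), sqrt_half_mul (by linarith),
        sqrt_half_mul (by linarith)]
      ring
    convert h using 4 <;> ring
  · have h : √(1 / 2 * (x + 2) * (y + 1)) * √((x + 1) * (y + 1)) =
        √((x + 2) * y) * √(1 / 2 * (x + 1) * y) + √(1 / 2 * (x + 2) * (x + 1)) := by
      rw [sqrt_half_mul (by linarith), sqrt_half_mul (by linarith), sqrt_half_mul (by linarith),
        Real.sqrt_mul (by linarith), Real.sqrt_mul (by linarith)]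
      grind
    convert h using 5 <;> ring
  · have h : √(1 / 2 * (x + 1) * (y + 2)) * √(1 / 2 * (y + 2) * (y + 1)) =
        √(1 / 2 * (y + 1) * y) * √(1 / 2 * (x + 1) * y) + √((x + 1) * (y + 1)) := by
      rw [sqrt_half_mul (by linarith), sqrt_half_mul (by linarith), sqrt_half_mul (by linarith),
        sqrt_half_mul (by linarith), Real.sqrt_mul (by linarith)]
      grind
    convert h using 5 <;> ring

theorem raisingRelations_level {j m : ℝ} (hx : 0 ≤ j + m) (hy : j - m = 0 ∨ 1 ≤ j - m) :
    RaisingRelations j j (boostCoeffLevel j) m := by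
  obtain ⟨x, hx'⟩ : ∃ x, x = j + m := ⟨_, rfl⟩
  obtain ⟨y, hy'⟩ : ∃ y, y = j - m := ⟨_, rfl⟩
  rw [← hx'] at hx
  rw [← hy'] at hy
  obtain rfl : j = (x + y) / 2 := by linarith
  obtain rfl : m = (x - y) / 2 := by linarith
  constructor <;> simp only [rotationCoeff, boostCoeffLevel]
  · ring
  · ring
  · have hy0 : 0 ≤ y := by rcases hy with h | h <;> linarith
    have hs : √(1 / 2 : ℝ) * √(1 / 2) = 1 / 2 := Real.mul_self_sqrt (by norm_num)
    have h1 : √(x + 1) * √(x + 1) = x + 1 := Real.mul_self_sqrt (by linarith)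
    have h0 : √x * √x = x := Real.mul_self_sqrt hx
    have h2 : √y * √y = y := Real.mul_self_sqrt hy0
    have h3 : √(y + 1) * √(y + 1) = y + 1 := Real.mul_self_sqrt (by linarith)
    have h : √(1 / 2 * x * (y + 1)) * √(1 / 2 * (y + 1) * x) =
        √(1 / 2 * y * (x + 1)) * √(1 / 2 * (x + 1) * y) + (x - y) / 2 := by
      rw [sqrt_half_mul (by linarith), sqrt_half_mul (by linarith), sqrt_half_mul (by linarith),
        sqrt_half_mul (by linarith)]
      grind
    convert h using 5 <;> ring

/-- The extreme weights are separate cases: at `y = 0` or `x = 0` the factors `y - 1` or `x - 1` are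
negative and the roots cannot be split, but both sides can then be evaluated directly. -/
theorem raisingRelations_down {j m : ℝ} (hx : j + m = 0 ∨ 1 ≤ j + m)
    (hy : j - m = 0 ∨ 1 ≤ j - m) :
    RaisingRelations j (j - 1) (boostCoeffDown j) m := by
  obtain ⟨x, hx'⟩ : ∃ x, x = j + m := ⟨_, rfl⟩
  obtain ⟨y, hy'⟩ : ∃ y, y = j - m := ⟨_, rfl⟩
  rw [← hx'] at hx
  rw [← hy'] at hy
  obtain rfl : j = (x + y) / 2 := by linarith
  obtain rfl : m = (x - y) / 2 := by linarith
  have hx0 : 0 ≤ x := by rcases hx with h | h <;> linarith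
  have hy0 : 0 ≤ y := by rcases hy with h | h <;> linarith
  have hs : √(1 / 2 : ℝ) * √(1 / 2) = 1 / 2 := Real.mul_self_sqrt (by norm_num)
  have h1 : √(x + 1) * √(x + 1) = x + 1 := Real.mul_self_sqrt (by linarith)
  have h0 : √x * √x = x := Real.mul_self_sqrt hx0
  have h2 : √y * √y = y := Real.mul_self_sqrt hy0
  constructor <;> simp only [rotationCoeff, boostCoeffDown]
  · have h : √(1 / 2 * (x + 1) * (y - 2)) * √(1 / 2 * y * (y - 1)) =
        √(1 / 2 * (y - 1) * (y - 2)) * √(1 / 2 * (x + 1) * y) := by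
      rcases hy with rfl | hy
      · simp
      · rw [sqrt_half_mul (by linarith), sqrt_half_mul (by linarith), sqrt_half_mul (by linarith),
          sqrt_half_mul (by linarith)]
        ring
    convert h using 4 <;> ring
  · have h : √(1 / 2 * x * (-1 + y)) * -√(x * y) =
        -√((x + 1) * (y - 1)) * √(1 / 2 * (x + 1) * y) + √(1 / 2 * y * (y - 1)) := by
      rcases hy with rfl | hy
      · simp
      · rw [neg_add_eq_sub, sqrt_half_mul (by linarith), sqrt_half_mul (by linarith),
          sqrt_half_mul (by linarith), Real.sqrt_mul (by linarith), Real.sqrt_mul (by linarith)]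
        grind
    convert h using 5 <;> ring
  · have h : √(1 / 2 * (x - 1) * y) * √(1 / 2 * x * (x - 1)) =
        √(1 / 2 * (x + 1) * x) * √(1 / 2 * (x + 1) * y) + -√(x * y) := by
      rcases hx with rfl | hx
      · simp
      · rw [sqrt_half_mul (by linarith), sqrt_half_mul (by linarith), sqrt_half_mul (by linarith),
          sqrt_half_mul (by linarith), Real.sqrt_mul (by linarith)]
        have h3 : √(x - 1) * √(x - 1) = x - 1 := Real.mul_self_sqrt (by linarith)
        grind
    convert h using 6 <;> ring

theorem magneticNumber_nonneg_cases {n : ℕ} (p : Fin (n + 1)) :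
    ((n / 2 : ℝ) + magneticNumber n p = 0 ∨ 1 ≤ (n / 2 : ℝ) + magneticNumber n p) ∧
      ((n / 2 : ℝ) - magneticNumber n p = 0 ∨ 1 ≤ (n / 2 : ℝ) - magneticNumber n p) := by
  obtain ⟨q, hq⟩ := Nat.exists_eq_add_of_le (Nat.lt_succ_iff.1 p.isLt)
  have hp : (n / 2 : ℝ) + magneticNumber n p = (p.val : ℕ) := by rw [magneticNumber]; ring
  have hq' : (n / 2 : ℝ) - magneticNumber n p = q := by
    have : (n : ℝ) = p.val + q := by exact_mod_cast hq
    rw [magneticNumber]; linarith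
  rw [hp, hq']
  constructor
  · rcases Nat.eq_zero_or_pos p.val with h | h
    · left; exact_mod_cast h
    · right; exact_mod_cast h
  · rcases Nat.eq_zero_or_pos q with h | h
    · left; exact_mod_cast h
    · right; exact_mod_cast h

theorem magneticNumber_rev {n : ℕ} (p : Fin (n + 1)) :
    magneticNumber n p.rev = -magneticNumber n p := by
  have h : ((p.rev).val : ℝ) = n - p.val := by
    rw [Fin.val_rev, Nat.add_sub_add_right, Nat.cast_sub (Nat.lt_succ_iff.1 p.isLt)]
  rw [magneticNumber, magneticNumber, h]
  ring

theorem raisingRelations_boostCoeff (n n' : ℕ) (p : Fin (n + 1)) :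
    RaisingRelations (n / 2) (n' / 2) (boostCoeff n n') (magneticNumber n p) := by
  obtain ⟨hx, hy⟩ := magneticNumber_nonneg_cases p
  have hx0 : 0 ≤ (n / 2 : ℝ) + magneticNumber n p := by rcases hx with h | h <;> linarith
  have hy0 : 0 ≤ (n / 2 : ℝ) - magneticNumber n p := by rcases hy with h | h <;> linarith
  by_cases h1 : n' = n + 2
  · have hd : boostCoeff n n' = boostCoeffUp (n / 2) := by
      funext m a; rw [boostCoeff, if_pos h1]
    have hj : (n' / 2 : ℝ) = n / 2 + 1 := by rw [h1]; push_cast; ring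
    rw [hd, hj]
    exact raisingRelations_up hx0 hy0
  by_cases h2 : n' = n
  · have hd : boostCoeff n n' = boostCoeffLevel (n / 2) := by
      funext m a; rw [boostCoeff, if_neg h1, if_pos h2]
    rw [hd, h2]
    exact raisingRelations_level hx0 hy
  by_cases h3 : n = n' + 2
  · have hd : boostCoeff n n' = boostCoeffDown (n / 2) := by
      funext m a; rw [boostCoeff, if_neg h1, if_neg h2, if_pos h3]
    have hj : (n' / 2 : ℝ) = n / 2 - 1 := by rw [h3]; push_cast; ring
    rw [hd, hj]
    exact raisingRelations_down hx hy
  · have hd : boostCoeff n n' = fun _ _ => 0 := by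
      funext m a; rw [boostCoeff, if_neg h1, if_neg h2, if_neg h3]
    rw [hd]
    constructor <;> simp

/-- The reflection symmetry `m ↦ -m` of the boost blocks. -/
theorem exists_sign_boostCoeff (n n' : ℕ) : ∃ ε : ℝ, ε * ε = 1 ∧ ∀ m,
    boostCoeff n n' m .minus = ε * boostCoeff n n' (-m) .plus ∧
    boostCoeff n n' m .three = ε * boostCoeff n n' (-m) .three ∧
    boostCoeff n n' m .plus = ε * boostCoeff n n' (-m) .minus := by
  by_cases h1 : n' = n + 2
  · refine ⟨1, by norm_num, fun m => ?_⟩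
    simp only [boostCoeff, if_pos h1, boostCoeffUp, sub_neg_eq_add, ← sub_eq_add_neg, one_mul,
      true_and, and_true]
    rw [mul_comm]
  by_cases h2 : n' = n
  · refine ⟨-1, by norm_num, fun m => ?_⟩
    simp [boostCoeff, h2, boostCoeffLevel, ← sub_eq_add_neg]
  by_cases h3 : n = n' + 2
  · refine ⟨1, by norm_num, fun m => ?_⟩
    simp only [boostCoeff, if_neg h1, if_neg h2, if_pos h3, boostCoeffDown, sub_neg_eq_add,
      ← sub_eq_add_neg, one_mul, true_and, and_true]
    rw [mul_comm]
  · exact ⟨1, by norm_num, fun m => by simp [boostCoeff, h1, h2, h3]⟩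

/-- The reflection `m ↦ -m` exchanges `J^+` with `J^-` and, up to a sign `ε`, `B^+` with `B^-`;
these are the raising relations at the reflected weight. -/
theorem loweringRelations_boostCoeff (n n' : ℕ) (p : Fin (n + 1)) {m : ℝ}
    (hm : m = magneticNumber n p) :
    rotationCoeff (n' / 2) (m + 1) .minus * boostCoeff n n' m .plus =
      boostCoeff n n' (m + -1) .plus * rotationCoeff (n / 2) m .minus +
        boostCoeff n n' m .three ∧
    rotationCoeff (n' / 2) m .minus * boostCoeff n n' m .three =
      boostCoeff n n' (m + -1) .three * rotationCoeff (n / 2) m .minus +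
        boostCoeff n n' m .minus ∧
    rotationCoeff (n' / 2) (m + -1) .minus * boostCoeff n n' m .minus =
      boostCoeff n n' (m + -1) .minus * rotationCoeff (n / 2) m .minus := by
  have h := raisingRelations_boostCoeff n n' p.rev
  rw [magneticNumber_rev, ← hm] at h
  obtain ⟨ε, hε, hs⟩ := exists_sign_boostCoeff n n'
  obtain ⟨h1, h2, h3⟩ := h
  simp only [rotationCoeff_minus, (hs m).1, (hs m).2.1, (hs m).2.2, (hs (m + -1)).1,
    (hs (m + -1)).2.1, (hs (m + -1)).2.2, neg_add, neg_neg]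
  refine ⟨?_, ?_, ?_⟩
  · linear_combination ε * h3
  · linear_combination ε * h2
  · linear_combination ε * h1

end Coefficients

/-! ### Vectors labelled by magnetic quantum numbers -/

section MagneticVectors

variable {V : Type*} [AddCommGroup V] [Module ℂ V]

open Classical in
/-- The member of the family `e` with magnetic quantum number `m`, or `0` if there is none. -/
noncomputable def magneticVector {n : ℕ} (e : Fin (n + 1) → V) (m : ℝ) : V :=
  ∑ p, if magneticNumber n p = m then e p else 0

theorem magneticNumber_injective (n : ℕ) : Function.Injective (magneticNumber n) := by
  intro p q h
  have : (p.val : ℝ) = q.val := by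
    rw [magneticNumber, magneticNumber] at h
    linarith
  exact Fin.ext (by exact_mod_cast this)

omit [Module ℂ V] in
theorem magneticVector_magneticNumber {n : ℕ} (e : Fin (n + 1) → V) (p : Fin (n + 1)) :
    magneticVector e (magneticNumber n p) = e p := by
  simp [magneticVector, (magneticNumber_injective n).eq_iff]

omit [Module ℂ V] in
theorem magneticVector_eq_zero {n : ℕ} (e : Fin (n + 1) → V) {m : ℝ}
    (h : ∀ p, magneticNumber n p ≠ m) : magneticVector e m = 0 := by
  simp [magneticVector, h]

theorem magneticVector_smul {n : ℕ} (e : Fin (n + 1) → V) (c : ℂ) (m : ℝ) :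
    magneticVector (fun p => c • e p) m = c • magneticVector e m := by
  simp [magneticVector, Finset.smul_sum]

theorem magneticVector_mem {n : ℕ} {e : Fin (n + 1) → V} {S : Submodule ℂ V}
    (he : ∀ p, e p ∈ S) (m : ℝ) : magneticVector e m ∈ S := by
  refine S.sum_mem fun p _ => ?_
  split_ifs
  exacts [he p, S.zero_mem]

/-- Makes the matrix formula valid for every real `m`, so that commutators can be computed without
boundary cases. The condition `h0` says that the coefficient vanishes whenever the target weight
exists but the source weight does not. -/
theorem apply_magneticVector {n n' : ℕ} {e : Fin (n + 1) → V} {e' : Fin (n' + 1) → V}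
    {A : Module.End ℂ V} {c : ℝ → ℝ} {s : ℝ}
    (h : ∀ p, A (e p) = (c (magneticNumber n p) : ℂ) • magneticVector e' (magneticNumber n p + s))
    (h0 : ∀ p', (∃ p, magneticNumber n p = magneticNumber n' p' - s) ∨
      c (magneticNumber n' p' - s) = 0) (m : ℝ) :
    A (magneticVector e m) = (c m : ℂ) • magneticVector e' (m + s) := by
  by_cases hm : ∃ p, magneticNumber n p = m
  · obtain ⟨p, rfl⟩ := hm
    rw [magneticVector_magneticNumber, h]
  · push Not at hm
    rw [magneticVector_eq_zero e hm, map_zero]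
    by_cases hm' : ∃ p', magneticNumber n' p' = m + s
    · obtain ⟨p', hp'⟩ := hm'
      have hms : magneticNumber n' p' - s = m := by rw [hp']; ring
      rcases hms ▸ h0 p' with ⟨p, hp⟩ | hc
      · exact absurd hp (hm p)
      · simp [hc]
    · push Not at hm'
      rw [magneticVector_eq_zero e' hm', smul_zero]

/-- The vectors `e p` are the vectors `|j, m⟩` of the spin `j = n / 2` representation. -/
def IsStandardTriple (J : SphericalIndex → Module.End ℂ V) {n : ℕ} (e : Fin (n + 1) → V) : Prop :=
  ∀ p a, J a (e p) = (rotationCoeff (n / 2) (magneticNumber n p) a : ℂ) •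
    magneticVector e (magneticNumber n p + a.shift)

/-- `B` maps the vectors `e p` to the vectors `e' p'` by the standard block. -/
def IsStandardBlock (B : SphericalIndex → Module.End ℂ V) {n n' : ℕ} (e : Fin (n + 1) → V)
    (e' : Fin (n' + 1) → V) : Prop :=
  ∀ p a, B a (e p) = (boostCoeff n n' (magneticNumber n p) a : ℂ) •
    magneticVector e' (magneticNumber n p + a.shift)

theorem rotationCoeff_eq_zero_of_range (n : ℕ) (a : SphericalIndex) (p' : Fin (n + 1)) :
    (∃ p, magneticNumber n p = magneticNumber n p' - a.shift) ∨
      rotationCoeff (n / 2) (magneticNumber n p' - a.shift) a = 0 := by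
  obtain ⟨k, hk⟩ := p'
  cases a with
  | plus =>
    rcases k with _ | k
    · right
      rw [rotationCoeff, Real.sqrt_eq_zero']
      refine le_of_eq ?_
      simp [magneticNumber, SphericalIndex.shift]
      ring_nf
      simp
    · left
      refine ⟨⟨k, by omega⟩, ?_⟩
      simp [magneticNumber, SphericalIndex.shift]
      ring
  | three => exact Or.inl ⟨⟨k, hk⟩, by simp [SphericalIndex.shift]⟩
  | minus =>
    by_cases hkn : k = n
    · right
      subst hkn
      rw [rotationCoeff, Real.sqrt_eq_zero']
      simp only [magneticNumber, SphericalIndex.shift]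
      ring_nf
      exact le_rfl
    · left
      refine ⟨⟨k + 1, by omega⟩, ?_⟩
      simp [magneticNumber, SphericalIndex.shift]
      ring

/-- Going up, spin `j + 1` has weights that a given component cannot reach from spin `j`, and there
a factor under the root vanishes. Going down, every shifted weight is a weight of the source. -/
theorem boostCoeff_eq_zero_of_range (n n' : ℕ) (a : SphericalIndex) (p' : Fin (n' + 1)) :
    (∃ p, magneticNumber n p = magneticNumber n' p' - a.shift) ∨
      boostCoeff n n' (magneticNumber n' p' - a.shift) a = 0 := by
  by_cases h1 : n' = n + 2
  · subst h1
    rcases p' with ⟨k, hk⟩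
    by_cases hr : (1 + a.shift ≤ k) ∧ (k ≤ 1 + a.shift + n)
    · left
      -- The offset 1 is the difference of the two spins, i.e. of the lowest weights.
      have : ∃ q : ℕ, (q : ℝ) = k - (1 + a.shift) ∧ q ≤ n := by
        cases a <;> simp only [SphericalIndex.shift] at hr ⊢
        · refine ⟨k - 2, ?_, ?_⟩
          · rw [Nat.cast_sub (by exact_mod_cast (by linarith : (2 : ℝ) ≤ k))]; norm_num
          · have : (k : ℝ) ≤ (n + 2 : ℕ) := by push_cast; linarith
            have := Nat.cast_le.1 this
            omega
        · refine ⟨k - 1, ?_, ?_⟩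
          · rw [Nat.cast_sub (by exact_mod_cast (by linarith : (1 : ℝ) ≤ k))]; norm_num
          · have : (k : ℝ) ≤ (n + 1 : ℕ) := by push_cast; linarith
            have := Nat.cast_le.1 this
            omega
        · refine ⟨k, by norm_num, ?_⟩
          have : (k : ℝ) ≤ n := by linarith
          exact Nat.cast_le.1 this
      obtain ⟨q, hq, hqn⟩ := this
      refine ⟨⟨q, by omega⟩, ?_⟩
      simp only [magneticNumber, hq]
      push_cast
      ring
    · right
      rw [boostCoeff, if_pos rfl]
      have hk' : k ≤ n + 2 := by omega
      cases a with
      | plus =>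
        have : k = 0 ∨ k = 1 := by
          by_contra hcon
          refine hr ⟨?_, ?_⟩ <;> simp only [SphericalIndex.shift]
          · have : ((2 : ℕ) : ℝ) ≤ k := Nat.cast_le.2 (by omega)
            push_cast at this; linarith
          · have : (k : ℝ) ≤ (n + 2 : ℕ) := Nat.cast_le.2 hk'
            push_cast at this; linarith
        rcases this with rfl | rfl <;>
        · simp only [boostCoeffUp, magneticNumber, SphericalIndex.shift]
          push_cast
          ring_nf
          simp
      | three =>
        have : k = 0 ∨ k = n + 2 := by
          by_contra hcon
          refine hr ⟨?_, ?_⟩ <;> simp only [SphericalIndex.shift]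
          · have : ((1 : ℕ) : ℝ) ≤ k := Nat.cast_le.2 (by omega)
            push_cast at this; linarith
          · have : (k : ℝ) ≤ (n + 1 : ℕ) := Nat.cast_le.2 (by omega)
            push_cast at this; linarith
        rcases this with rfl | rfl <;>
        · simp only [boostCoeffUp, magneticNumber, SphericalIndex.shift]
          push_cast
          ring_nf
          simp
      | minus =>
        have : k = n + 1 ∨ k = n + 2 := by
          by_contra hcon
          refine hr ⟨?_, ?_⟩ <;> simp only [SphericalIndex.shift]
          · have : (0 : ℝ) ≤ k := Nat.cast_nonneg k
            linarith
          · have : (k : ℝ) ≤ (n : ℕ) := Nat.cast_le.2 (by omega)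
            linarith
        rcases this with rfl | rfl <;>
        · simp only [boostCoeffUp, magneticNumber, SphericalIndex.shift]
          push_cast
          ring_nf
          simp
  by_cases h2 : n' = n
  · subst h2
    rcases rotationCoeff_eq_zero_of_range n' a p' with h | h
    · exact Or.inl h
    · right
      rw [boostCoeff, if_neg h1, if_pos rfl]
      cases a
      · exact neg_eq_zero.2 h
      · exact h
      · exact h
  by_cases h3 : n = n' + 2
  · subst h3
    left
    obtain ⟨k, hk⟩ := p'
    cases a
    · refine ⟨⟨k, by omega⟩, ?_⟩
      simp only [magneticNumber, SphericalIndex.shift]; push_cast; ring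
    · refine ⟨⟨k + 1, by omega⟩, ?_⟩
      simp only [magneticNumber, SphericalIndex.shift]; push_cast; ring
    · refine ⟨⟨k + 2, by omega⟩, ?_⟩
      simp only [magneticNumber, SphericalIndex.shift]; push_cast; ring
  · right
    rw [boostCoeff, if_neg h1, if_neg h2, if_neg h3]

theorem IsStandardTriple.apply {J : SphericalIndex → Module.End ℂ V} {n : ℕ}
    {e : Fin (n + 1) → V} (h : IsStandardTriple J e) (a : SphericalIndex) (m : ℝ) :
    J a (magneticVector e m) =
      (rotationCoeff (n / 2) m a : ℂ) • magneticVector e (m + a.shift) :=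
  apply_magneticVector (c := fun m => rotationCoeff (n / 2) m a) (fun p => h p a)
    (rotationCoeff_eq_zero_of_range n a) m

theorem IsStandardBlock.apply {B : SphericalIndex → Module.End ℂ V} {n n' : ℕ}
    {e : Fin (n + 1) → V} {e' : Fin (n' + 1) → V} (h : IsStandardBlock B e e')
    (a : SphericalIndex) (m : ℝ) :
    B a (magneticVector e m) =
      (boostCoeff n n' m a : ℂ) • magneticVector e' (m + a.shift) :=
  apply_magneticVector (c := fun m => boostCoeff n n' m a) (fun p => h p a)
    (boostCoeff_eq_zero_of_range n n' a) m

theorem isSpinTriple_of_basis {ι : Type*} (b : Module.Basis ι ℂ V)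
    {J : SphericalIndex → Module.End ℂ V}
    (h : ∀ i, ∃ (n : ℕ) (e : Fin (n + 1) → V), IsStandardTriple J e ∧ ∃ p, b i = e p) :
    IsSpinTriple J := by
  constructor
  · refine LinearMap.congr_fun (f := J .three * J .plus) (g := J .plus * J .three + J .plus)
      (b.ext fun i => ?_)
    obtain ⟨n, e, he, p, hp⟩ := h i
    rw [hp]
    simp only [Module.End.mul_apply, LinearMap.add_apply, he p, he.apply, map_smul, smul_smul,
      SphericalIndex.shift, add_zero, ← add_smul, rotationCoeff]
    congr 1
    push_cast
    ring
  · refine LinearMap.congr_fun (f := J .three * J .minus) (g := J .minus * J .three - J .minus)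
      (b.ext fun i => ?_)
    obtain ⟨n, e, he, p, hp⟩ := h i
    rw [hp]
    simp only [Module.End.mul_apply, LinearMap.sub_apply, he p, he.apply, map_smul, smul_smul,
      SphericalIndex.shift, add_zero, ← sub_smul, rotationCoeff]
    congr 1
    push_cast
    ring
  · refine LinearMap.congr_fun (f := J .plus * J .minus) (g := J .minus * J .plus + J .three)
      (b.ext fun i => ?_)
    obtain ⟨n, e, he, p, hp⟩ := h i
    obtain ⟨hx, hy⟩ := magneticNumber_nonneg_cases p
    -- The level block is `(-J^+, J, J^-)` itself, so its relation for the minus component is `[J^+,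
    -- J^-] = J`.
    have hr := (raisingRelations_level (by rcases hx with h | h <;> linarith) hy).minus
    rw [hp]
    simp only [Module.End.mul_apply, LinearMap.add_apply, he p, he.apply, map_smul, smul_smul,
      SphericalIndex.shift, add_zero, neg_add_cancel_right, add_neg_cancel_right, ← add_smul]
    congr 1
    replace hr := congrArg Complex.ofReal hr
    simp only [rotationCoeff, boostCoeffLevel, Complex.ofReal_mul, Complex.ofReal_add] at hr ⊢
    linear_combination hr

theorem isVectorOperator_of_basis {ι : Type*} (b : Module.Basis ι ℂ V)
    {J B : SphericalIndex → Module.End ℂ V}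
    (h : ∀ i, ∃ (n : ℕ) (e : Fin (n + 1) → V), IsStandardTriple J e ∧
      (∃ (n' : ℕ) (e' : Fin (n' + 1) → V), IsStandardTriple J e' ∧ IsStandardBlock B e e') ∧
      ∃ p, b i = e p) :
    IsVectorOperator J B := by
  have key : ∀ i, ∃ (n n' : ℕ) (p : Fin (n + 1)) (e : Fin (n + 1) → V) (e' : Fin (n' + 1) → V),
      b i = magneticVector e (magneticNumber n p) ∧ IsStandardTriple J e ∧ IsStandardTriple J e' ∧
        IsStandardBlock B e e' := by
    intro i
    obtain ⟨n, e, he, ⟨n', e', he', hB⟩, p, hp⟩ := h i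
    exact ⟨n, n', p, e, e', by rw [magneticVector_magneticNumber, hp], he, he', hB⟩
  constructor
  · refine LinearMap.congr_fun (f := J .plus * B .plus) (g := B .plus * J .plus)
      (b.ext fun i => ?_)
    obtain ⟨n, n', p, e, e', hp, he, he', hB⟩ := key i
    have hr := (raisingRelations_boostCoeff n n' p).plus
    rw [hp]
    simp only [Module.End.mul_apply, he.apply, he'.apply, hB.apply, map_smul, smul_smul,
      SphericalIndex.shift]
    congr 1
    exact_mod_cast (mul_comm _ _).trans (hr.trans (mul_comm _ _))
  · refine LinearMap.congr_fun (f := J .plus * B .three) (g := B .three * J .plus + B .plus)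
      (b.ext fun i => ?_)
    obtain ⟨n, n', p, e, e', hp, he, he', hB⟩ := key i
    have hr := (raisingRelations_boostCoeff n n' p).three
    rw [hp]
    simp only [Module.End.mul_apply, LinearMap.add_apply, he.apply, he'.apply, hB.apply, map_smul,
      smul_smul, SphericalIndex.shift, add_zero, ← add_smul]
    congr 1
    replace hr := congrArg Complex.ofReal hr
    simp only [Complex.ofReal_mul, Complex.ofReal_add] at hr
    linear_combination hr
  · refine LinearMap.congr_fun (f := J .plus * B .minus) (g := B .minus * J .plus + B .three)
      (b.ext fun i => ?_)
    obtain ⟨n, n', p, e, e', hp, he, he', hB⟩ := key i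
    have hr := (raisingRelations_boostCoeff n n' p).minus
    rw [hp]
    simp only [Module.End.mul_apply, LinearMap.add_apply, he.apply, he'.apply, hB.apply, map_smul,
      smul_smul, SphericalIndex.shift, add_zero, neg_add_cancel_right, add_neg_cancel_right,
      ← add_smul]
    congr 1
    replace hr := congrArg Complex.ofReal hr
    simp only [Complex.ofReal_mul, Complex.ofReal_add] at hr
    linear_combination hr
  · refine LinearMap.congr_fun (f := J .three * B .plus) (g := B .plus * J .three + B .plus)
      (b.ext fun i => ?_)
    obtain ⟨n, n', p, e, e', hp, he, he', hB⟩ := key i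
    rw [hp]
    simp only [Module.End.mul_apply, LinearMap.add_apply, he.apply, he'.apply, hB.apply, map_smul,
      smul_smul, SphericalIndex.shift, add_zero, ← add_smul, rotationCoeff]
    congr 1
    push_cast
    ring
  · refine LinearMap.congr_fun (f := J .three * B .three) (g := B .three * J .three)
      (b.ext fun i => ?_)
    obtain ⟨n, n', p, e, e', hp, he, he', hB⟩ := key i
    rw [hp]
    simp only [Module.End.mul_apply, he.apply, he'.apply, hB.apply, map_smul,
      smul_smul, SphericalIndex.shift, add_zero, rotationCoeff]
    congr 1
    ring
  · refine LinearMap.congr_fun (f := J .three * B .minus) (g := B .minus * J .three - B .minus)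
      (b.ext fun i => ?_)
    obtain ⟨n, n', p, e, e', hp, he, he', hB⟩ := key i
    rw [hp]
    simp only [Module.End.mul_apply, LinearMap.sub_apply, he.apply, he'.apply, hB.apply, map_smul,
      smul_smul, SphericalIndex.shift, add_zero, ← sub_smul, rotationCoeff]
    congr 1
    push_cast
    ring
  · refine LinearMap.congr_fun (f := J .minus * B .plus) (g := B .plus * J .minus + B .three)
      (b.ext fun i => ?_)
    obtain ⟨n, n', p, e, e', hp, he, he', hB⟩ := key i
    have hr := (loweringRelations_boostCoeff n n' p rfl).1
    rw [hp]
    simp only [Module.End.mul_apply, LinearMap.add_apply, he.apply, he'.apply, hB.apply, map_smul,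
      smul_smul, SphericalIndex.shift, add_zero, neg_add_cancel_right, add_neg_cancel_right,
      ← add_smul]
    congr 1
    replace hr := congrArg Complex.ofReal hr
    simp only [Complex.ofReal_mul, Complex.ofReal_add] at hr
    linear_combination hr
  · refine LinearMap.congr_fun (f := J .minus * B .three) (g := B .three * J .minus + B .minus)
      (b.ext fun i => ?_)
    obtain ⟨n, n', p, e, e', hp, he, he', hB⟩ := key i
    have hr := (loweringRelations_boostCoeff n n' p rfl).2.1
    rw [hp]
    simp only [Module.End.mul_apply, LinearMap.add_apply, he.apply, he'.apply, hB.apply, map_smul,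
      smul_smul, SphericalIndex.shift, add_zero, ← add_smul]
    congr 1
    replace hr := congrArg Complex.ofReal hr
    simp only [Complex.ofReal_mul, Complex.ofReal_add] at hr
    linear_combination hr
  · refine LinearMap.congr_fun (f := J .minus * B .minus) (g := B .minus * J .minus)
      (b.ext fun i => ?_)
    obtain ⟨n, n', p, e, e', hp, he, he', hB⟩ := key i
    have hr := (loweringRelations_boostCoeff n n' p rfl).2.2
    rw [hp]
    simp only [Module.End.mul_apply, he.apply, he'.apply, hB.apply, map_smul, smul_smul,
      SphericalIndex.shift]
    congr 1
    exact_mod_cast (mul_comm _ _).trans (hr.trans (mul_comm _ _))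

end MagneticVectors

/-! ### Standard bases and the Wigner–Eckart normal form -/

section StandardBases

variable {V : Type*} [AddCommGroup V] [Module ℂ V]

theorem IsStandardTriple.smul {J : SphericalIndex → Module.End ℂ V} {n : ℕ} {e : Fin (n + 1) → V}
    (h : IsStandardTriple J e) (c : ℂ) : IsStandardTriple J fun p => c • e p := by
  intro p a
  rw [map_smul, h p a, magneticVector_smul, smul_comm]

theorem isStandardTriple_zero (J : SphericalIndex → Module.End ℂ V) (n : ℕ) :
    IsStandardTriple J (0 : Fin (n + 1) → V) := by
  intro p a
  simp [magneticVector]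

theorem isStandardBlock_zero {B : SphericalIndex → Module.End ℂ V} {n : ℕ} (n' : ℕ)
    {e : Fin (n + 1) → V} (h : ∀ p a, B a (e p) = 0) :
    IsStandardBlock B e (0 : Fin (n' + 1) → V) := by
  intro p a
  simp [magneticVector, h]

theorem IsSpinTriple.exists_standardTriple [FiniteDimensional ℂ V]
    {J : SphericalIndex → Module.End ℂ V} (hJ : IsSpinTriple J) {S : Submodule ℂ V} {n : ℕ}
    (hS : IsIrreducibleUnder J S) (hn : Module.finrank ℂ S = n + 1) :
    ∃ e : Fin (n + 1) → V, (∀ p, e p ∈ S) ∧ (∀ p, e p ≠ 0) ∧ IsStandardTriple J e := by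
  obtain ⟨v, hvS, μ, hv⟩ := hJ.exists_primitive hS.stable hS.ne_bot
  obtain rfl := hJ.primitive_weight_of_mem hS hn hv hvS
  obtain ⟨n', hn', h1, h2⟩ := hJ.exists_primitive_weight hv
  obtain rfl : n = n' := by
    have : (n : ℂ) = n' := by linear_combination 2 * hn'
    exact_mod_cast this
  -- `c i` is the matrix element of `J^-` from the `i`-th to the next vector below the top. Its
  -- square is the constant `(i + 1) (n/2 - i/2)` of `plus_string`, so dividing by the product of
  -- the `c i` normalises both ladder operators.
  let c : ℕ → ℝ := fun i => √(1 / 2 * (i + 1) * (n - i))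
  have hc : ∀ i < n, 0 < c i := by
    intro i hi
    have : (i : ℝ) < n := by exact_mod_cast hi
    exact Real.sqrt_pos.2 (by have := sub_pos.2 this; positivity)
  have hcc : ∀ i ≤ n, ((c i : ℝ) : ℂ) * c i = 1 / 2 * (i + 1) * (n - i) := by
    intro i hi
    have : (i : ℝ) ≤ n := by exact_mod_cast hi
    rw [← Complex.ofReal_mul, Real.mul_self_sqrt (by have := sub_nonneg.2 this; positivity)]
    push_cast
    ring
  let C : ℕ → ℂ := fun k => ∏ i ∈ Finset.range k, ((c i : ℝ) : ℂ)⁻¹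
  have hC : ∀ k < n, ((c k : ℝ) : ℂ) * C (k + 1) = C k := by
    intro k hk
    have h0 : ((c k : ℝ) : ℂ) ≠ 0 := by exact_mod_cast (hc k hk).ne'
    simp only [C, Finset.prod_range_succ]
    field_simp
  let g : ℕ → V := fun k => C k • (J .minus ^ k) v
  let e : Fin (n + 1) → V := fun p => g (n - p.val)
  have hmem : ∀ k, (J .minus ^ k) v ∈ S := by
    intro k
    induction k with
    | zero => simpa using hvS
    | succ k ih => rw [pow_succ', Module.End.mul_apply]; exact hS.stable _ _ ih
  refine ⟨e, fun p => S.smul_mem _ (hmem _), fun p => smul_ne_zero ?_ (h1 _ (Nat.sub_le _ _)), ?_⟩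
  · refine Finset.prod_ne_zero_iff.2 fun i hi => inv_ne_zero ?_
    rw [Finset.mem_range] at hi
    exact_mod_cast (hc i (by omega)).ne'
  · intro p a
    obtain ⟨k, hk⟩ : ∃ k, n = p.val + k := Nat.exists_eq_add_of_le (Nat.lt_succ_iff.1 p.isLt)
    have hkr : (n : ℝ) = p.val + k := by exact_mod_cast hk
    have hep : e p = g k := by simp only [e]; congr 1; omega
    have hmag : magneticNumber n p = n / 2 - k := by rw [magneticNumber]; linarith
    cases a with
    | plus =>
      rcases k with _ | k
      · have h0 : rotationCoeff (n / 2) (magneticNumber n p) .plus = 0 := by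
          rw [rotationCoeff, hmag, Real.sqrt_eq_zero']
          simp
        rw [h0, hep]
        simp [g, hv.plus]
      · have hcoef : rotationCoeff (n / 2) (magneticNumber n p) .plus = c k := by
          rw [rotationCoeff, hmag]
          simp only [c]
          push_cast
          congr 1
          ring
        have hshift : magneticNumber n p + SphericalIndex.shift .plus =
            magneticNumber n ⟨p.val + 1, by omega⟩ := by
          simp only [magneticNumber, SphericalIndex.shift]
          push_cast
          ring
        have he' : e ⟨p.val + 1, by omega⟩ = g k := by simp only [e]; congr 1; omega
        rw [hcoef, hshift, magneticVector_magneticNumber, he', hep]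
        simp only [g]
        rw [map_smul, hJ.plus_string hv, smul_smul, smul_smul, ← hC k (by omega)]
        congr 1
        linear_combination -C (k + 1) * hcc k (by omega)
    | three =>
      have hshift : magneticNumber n p + SphericalIndex.shift .three = magneticNumber n p := by
        simp [SphericalIndex.shift]
      rw [hshift, magneticVector_magneticNumber, hep, rotationCoeff, hmag]
      simp only [g]
      rw [map_smul, hJ.three_string hv, smul_comm]
      push_cast
      rfl
    | minus =>
      have hcoef : rotationCoeff (n / 2) (magneticNumber n p) .minus = c k := by
        rw [rotationCoeff, hmag]
        simp only [c]
        congr 1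
        ring
      rw [hcoef, hep]
      simp only [g]
      rw [map_smul, ← Module.End.mul_apply, ← pow_succ']
      by_cases hkn : k = n
      · have hc0 : c n = 0 := by simp [c]
        rw [hkn, h2, hc0]
        simp
      · have hp : 1 ≤ p.val := by omega
        have hshift : magneticNumber n p + SphericalIndex.shift .minus =
            magneticNumber n ⟨p.val - 1, by omega⟩ := by
          simp only [magneticNumber, SphericalIndex.shift]
          rw [Nat.cast_sub hp]
          push_cast
          ring
        have he' : e ⟨p.val - 1, by omega⟩ = g (k + 1) := by simp only [e]; congr 1; omega
        rw [hshift, magneticVector_magneticNumber, he']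
        simp only [g]
        rw [smul_smul, hC k (by omega)]

theorem IsStandardTriple.three_apply {J : SphericalIndex → Module.End ℂ V} {n : ℕ}
    {e : Fin (n + 1) → V} (he : IsStandardTriple J e) (p : Fin (n + 1)) :
    J .three (e p) = (magneticNumber n p : ℂ) • e p := by
  rw [he p .three, rotationCoeff, SphericalIndex.shift, add_zero, magneticVector_magneticNumber]

theorem IsStandardTriple.linearIndependent {J : SphericalIndex → Module.End ℂ V} {n : ℕ}
    {e : Fin (n + 1) → V} (he : IsStandardTriple J e) (h0 : ∀ p, e p ≠ 0) :
    LinearIndependent ℂ e :=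
  Module.End.eigenvectors_linearIndependent' (J .three)
    (fun p => ((magneticNumber n p : ℝ) : ℂ))
    (Complex.ofReal_injective.comp (magneticNumber_injective n)) _
    fun p => ⟨Module.End.mem_eigenspace_iff.2 (he.three_apply p), h0 p⟩

theorem span_range_eq_of_linearIndependent [FiniteDimensional ℂ V] {S : Submodule ℂ V} {n : ℕ}
    (hn : Module.finrank ℂ S = n + 1) {e : Fin (n + 1) → V} (heS : ∀ p, e p ∈ S)
    (hli : LinearIndependent ℂ e) : Submodule.span ℂ (Set.range e) = S := by
  refine Submodule.eq_of_le_of_finrank_eq (Submodule.span_le.2 ?_) ?_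
  · rintro _ ⟨p, rfl⟩
    exact heS p
  · rw [finrank_span_eq_card hli, hn, Fintype.card_fin]

/-- The weight spaces of a sector are spanned by its standard vectors. -/
theorem IsStandardTriple.exists_eq_smul_magneticVector [FiniteDimensional ℂ V]
    {J : SphericalIndex → Module.End ℂ V} {S : Submodule ℂ V} {n : ℕ}
    (hn : Module.finrank ℂ S = n + 1) {e : Fin (n + 1) → V} (he : IsStandardTriple J e)
    (heS : ∀ p, e p ∈ S) (h0 : ∀ p, e p ≠ 0) {x : V} (hx : x ∈ S) {m : ℝ}
    (hxm : J .three x = (m : ℂ) • x) : ∃ c : ℂ, x = c • magneticVector e m := by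
  have hli := he.linearIndependent h0
  rw [← span_range_eq_of_linearIndependent hn heS hli,
    Submodule.mem_span_range_iff_exists_fun] at hx
  obtain ⟨c, rfl⟩ := hx
  have hz : ∑ p, (c p * ((magneticNumber n p : ℂ) - m)) • e p = 0 := by
    rw [map_sum, Finset.smul_sum, ← sub_eq_zero, ← Finset.sum_sub_distrib] at hxm
    rw [← hxm]
    refine Finset.sum_congr rfl fun p _ => ?_
    rw [map_smul, he.three_apply]
    module
  have hc := Fintype.linearIndependent_iff.1 hli _ hz
  have hcz : ∀ p, magneticNumber n p ≠ m → c p = 0 := by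
    intro p hp
    refine (mul_eq_zero.1 (hc p)).resolve_right (sub_ne_zero.2 ?_)
    exact_mod_cast hp
  by_cases hm : ∃ p, magneticNumber n p = m
  · obtain ⟨p, rfl⟩ := hm
    refine ⟨c p, ?_⟩
    rw [magneticVector_magneticNumber]
    refine Finset.sum_eq_single p (fun q _ hq => ?_) (by simp)
    rw [hcz q fun h => hq (magneticNumber_injective n h), zero_smul]
  · push Not at hm
    refine ⟨0, ?_⟩
    rw [zero_smul]
    exact Finset.sum_eq_zero fun p _ => by rw [hcz p (hm p), zero_smul]

theorem IsStandardTriple.plus_last {J : SphericalIndex → Module.End ℂ V} {n : ℕ}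
    {e : Fin (n + 1) → V} (he : IsStandardTriple J e) : J .plus (e (Fin.last n)) = 0 := by
  have h0 : rotationCoeff (n / 2) (magneticNumber n (Fin.last n)) .plus = 0 := by
    rw [rotationCoeff, Real.sqrt_eq_zero', magneticNumber]
    refine le_of_eq ?_
    simp only [Fin.val_last]
    ring
  rw [he, h0]
  simp

/-- The coefficient of the standard block which determines the others is non-zero. -/
theorem boostCoeff_minus_last_ne_zero {n n' : ℕ} (h : SpinStep n n') :
    boostCoeff n n' (magneticNumber n (Fin.last n)) .minus ≠ 0 := by
  rcases h with rfl | ⟨rfl, hn⟩ | rfl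
  · rw [boostCoeff, if_pos rfl, boostCoeffUp, magneticNumber, Fin.val_last]
    refine (Real.sqrt_pos.2 (lt_of_lt_of_eq one_pos ?_)).ne'
    ring
  · rw [boostCoeff, if_neg (by omega), if_pos rfl, boostCoeffLevel, magneticNumber, Fin.val_last]
    have : (0 : ℝ) < n' := by exact_mod_cast Nat.pos_of_ne_zero hn
    refine (Real.sqrt_pos.2 (lt_of_lt_of_eq (half_pos this) ?_)).ne'
    ring
  · rw [boostCoeff, if_neg (by omega), if_neg (by omega), if_pos rfl, boostCoeffDown,
      magneticNumber, Fin.val_last]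
    refine (Real.sqrt_pos.2 (lt_of_lt_of_eq
      (show (0 : ℝ) < 1 / 2 * (n' + 2) * (n' + 1) by positivity) ?_)).ne'
    push_cast
    ring

section StandardBoost

variable {l : List ℕ} (b : Module.Basis (Σ k : Fin l.length, Fin (l.get k + 1)) ℂ V)

/-- The standard vectors of the `k`-th sector. -/
noncomputable def sectorVectors (k : Fin l.length) : Fin (l.get k + 1) → V := fun p => b ⟨k, p⟩

/-- The operators with the standard blocks between consecutive sectors. -/
noncomputable def standardBoost (a : SphericalIndex) : Module.End ℂ V :=
  b.constr ℂ fun i => if h : i.1.val + 1 < l.length then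
    (boostCoeff (l.get i.1) (l.get ⟨i.1.val + 1, h⟩) (magneticNumber (l.get i.1) i.2) a : ℂ) •
      magneticVector (sectorVectors b ⟨i.1.val + 1, h⟩) (magneticNumber (l.get i.1) i.2 + a.shift)
    else 0

theorem standardBoost_isStandardBlock {k k' : Fin l.length} (h : k'.val = k.val + 1) :
    IsStandardBlock (standardBoost b) (sectorVectors b k) (sectorVectors b k') := by
  obtain ⟨i, hi⟩ := k'
  obtain rfl : i = k.val + 1 := h
  intro p a
  rw [standardBoost, sectorVectors, Module.Basis.constr_basis, dif_pos hi]

theorem standardBoost_last {k : Fin l.length} (h : k.val + 1 = l.length) (p : Fin (l.get k + 1))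
    (a : SphericalIndex) : standardBoost b a (sectorVectors b k p) = 0 := by
  rw [standardBoost, sectorVectors, Module.Basis.constr_basis, dif_neg (by simp [h])]

theorem isVectorOperator_standardBoost {J : SphericalIndex → Module.End ℂ V}
    (hJ : ∀ k, IsStandardTriple J (sectorVectors b k)) :
    IsVectorOperator J (standardBoost b) := by
  refine isVectorOperator_of_basis b fun i => ⟨_, sectorVectors b i.1, hJ i.1, ?_, i.2, rfl⟩
  by_cases h : i.1.val + 1 < l.length
  · exact ⟨_, sectorVectors b ⟨i.1.val + 1, h⟩, hJ _, standardBoost_isStandardBlock b rfl⟩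
  · have hi := i.1.isLt
    exact ⟨0, 0, isStandardTriple_zero J 0,
      isStandardBlock_zero 0 fun p a => standardBoost_last b (by omega) p a⟩

end StandardBoost

/-- Bases of the summands of an internal direct sum combine to a basis. -/
theorem exists_basis_of_isInternal [FiniteDimensional ℂ V] {l : List ℕ}
    {S : Fin l.length → Submodule ℂ V} (hS : DirectSum.IsInternal S)
    (hn : ∀ k, Module.finrank ℂ (S k) = l.get k + 1)
    (e : ∀ k, Fin (l.get k + 1) → V) (heS : ∀ k p, e k p ∈ S k)
    (hli : ∀ k, LinearIndependent ℂ (e k)) :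
    ∃ b : Module.Basis (Σ k : Fin l.length, Fin (l.get k + 1)) ℂ V,
      ∀ k, sectorVectors b k = e k := by
  let e' : ∀ k, Fin (l.get k + 1) → S k := fun k p => ⟨e k p, heS k p⟩
  have hli' : ∀ k, LinearIndependent ℂ (e' k) := fun k =>
    LinearIndependent.of_comp (S k).subtype (hli k)
  let bS := fun k => basisOfLinearIndependentOfCardEqFinrank (hli' k)
    (by rw [hn, Fintype.card_fin])
  refine ⟨hS.collectedBasis bS, fun k => ?_⟩
  funext p
  simp [sectorVectors, bS, e']

variable {G : ConformalLimit} {ρ : RotationRep G V}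

namespace IsChainRep

variable {l : List ℕ} {S : Fin l.length → Submodule ℂ V} (h : IsChainRep ρ l S)
include h

theorem irreducible (k : Fin l.length) : IsIrreducibleUnder (sphericalJ ρ) (S k) :=
  ((isSector_iff ρ).1 (h.sector k)).1

theorem sphericalB_mem {k k' : Fin l.length} (hk : k'.val = k.val + 1) (a : SphericalIndex)
    {v : V} (hv : v ∈ S k) : sphericalB ρ a v ∈ S k' :=
  (forall_genB_mem_iff ρ).1 (fun i => h.boost_next k k' hk i v hv) a

theorem sphericalB_last {k : Fin l.length} (hk : k.val + 1 = l.length) (a : SphericalIndex)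
    {v : V} (hv : v ∈ S k) : sphericalB ρ a v = 0 :=
  (forall_genB_eq_zero_iff ρ).1 (fun i => h.boost_last k hk i v hv) a

theorem exists_sphericalB_ne_zero {k : Fin l.length} (hk : k.val + 1 < l.length) :
    ∃ a, ∃ v ∈ S k, sphericalB ρ a v ≠ 0 := by
  obtain ⟨i, v, hv, hne⟩ := h.arrow k hk
  by_contra! hcon
  exact hne ((forall_genB_eq_zero_iff ρ).2 (fun a => hcon a v hv) i)

theorem spinStep [FiniteDimensional ℂ V] {k k' : Fin l.length} (hk : k'.val = k.val + 1) :
    SpinStep (l.get k) (l.get k') :=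
  (isVectorOperator_sphericalB ρ).spinStep (isSpinTriple_sphericalJ ρ) (h.irreducible k)
    (h.sector k).finrank_eq (h.irreducible k') (h.sector k').finrank_eq
    (fun a _ hv => h.sphericalB_mem hk a hv)
    (h.exists_sphericalB_ne_zero (by rw [← hk]; exact k'.isLt))

theorem exists_standardBoost [FiniteDimensional ℂ V] :
    ∃ b : Module.Basis (Σ k : Fin l.length, Fin (l.get k + 1)) ℂ V,
      (∀ k p, b ⟨k, p⟩ ∈ S k) ∧ (∀ k, IsStandardTriple (sphericalJ ρ) (sectorVectors b k)) ∧
        sphericalB ρ = standardBoost b := by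
  have hJ := isSpinTriple_sphericalJ ρ
  have hB := isVectorOperator_sphericalB ρ
  choose e heS he0 he using fun k =>
    hJ.exists_standardTriple (h.irreducible k) (h.sector k).finrank_eq
  have hscale : ∀ i : ℕ, ∃ c : ℂ, c ≠ 0 ∧ ∀ hi : i + 1 < l.length,
      sphericalB ρ .minus (e ⟨i, by omega⟩ (Fin.last _)) =
        c • (boostCoeff (l.get ⟨i, by omega⟩) (l.get ⟨i + 1, hi⟩)
          (magneticNumber _ (Fin.last (l.get ⟨i, by omega⟩))) .minus : ℂ) •
        magneticVector (e ⟨i + 1, hi⟩)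
          (magneticNumber _ (Fin.last (l.get ⟨i, by omega⟩)) + SphericalIndex.shift .minus) := by
    intro i
    by_cases hi : i + 1 < l.length
    · set k : Fin l.length := ⟨i, by omega⟩ with hk
      set k' : Fin l.length := ⟨i + 1, hi⟩ with hk'
      have hkk' : k'.val = k.val + 1 := rfl
      have hd := boostCoeff_minus_last_ne_zero (h.spinStep hkk')
      have hd' : ((boostCoeff (l.get k) (l.get k')
          (magneticNumber _ (Fin.last (l.get k))) .minus : ℝ) : ℂ) ≠ 0 := by exact_mod_cast hd
      have hx : sphericalB ρ .minus (e k (Fin.last _)) ≠ 0 := by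
        intro h0
        obtain ⟨a, v, hv, hne⟩ := h.exists_sphericalB_ne_zero (k := k) hi
        exact hne (hB.eq_zero_of_minus_eq_zero (h.irreducible k) (heS k _) (he0 k _)
          (he k).plus_last h0 a v hv)
      obtain ⟨c, hc⟩ := (he k').exists_eq_smul_magneticVector (h.sector k').finrank_eq (heS k')
        (he0 k') (h.sphericalB_mem hkk' .minus (heS k (Fin.last _)))
        (m := magneticNumber _ (Fin.last (l.get k)) + SphericalIndex.shift .minus) (by
          rw [hB.three_minus, (he k).three_apply, map_smul]
          simp only [SphericalIndex.shift]
          push_cast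
          module)
      refine ⟨c / ((boostCoeff (l.get k) (l.get k')
          (magneticNumber _ (Fin.last (l.get k))) .minus : ℝ) : ℂ), div_ne_zero ?_ hd',
          fun _ => ?_⟩
      · rintro rfl
        exact hx (by rw [hc, zero_smul])
      · rw [hc, smul_smul, div_mul_cancel₀ _ hd']
    · exact ⟨1, one_ne_zero, fun hi' => absurd hi' hi⟩
  choose c hc0 hc using hscale
  -- With `s (k + 1) = s k * c k`, multiplying the `k`-th basis by `s k` absorbs the ratios of all
  -- preceding arrows.
  let s : ℕ → ℂ := fun k => ∏ i ∈ Finset.range k, c i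
  have hs0 : ∀ k, s k ≠ 0 := fun k => Finset.prod_ne_zero_iff.2 fun i _ => hc0 i
  obtain ⟨b, hb⟩ := exists_basis_of_isInternal h.internal (fun k => (h.sector k).finrank_eq)
    (fun k p => s k.val • e k p) (fun k p => (S k).smul_mem _ (heS k p))
    (fun k => ((he k).smul _).linearIndependent fun p => smul_ne_zero (hs0 _) (he0 k p))
  have hbS : ∀ k p, b ⟨k, p⟩ ∈ S k := by
    intro k p
    have := congrFun (hb k) p
    rw [sectorVectors] at this
    rw [this]
    exact (S k).smul_mem _ (heS k p)
  have hbJ : ∀ k, IsStandardTriple (sphericalJ ρ) (sectorVectors b k) := by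
    intro k
    rw [hb k]
    exact (he k).smul _
  refine ⟨b, hbS, hbJ, ?_⟩
  -- The boosts and the standard blocks now agree in the lowering component on each top vector, so
  -- their difference, a vector operator, vanishes.
  have hdiff := hB.sub (isVectorOperator_standardBoost b hbJ)
  funext a
  refine b.ext fun i => ?_
  obtain ⟨k, p⟩ := i
  by_cases hk : k.val + 1 < l.length
  · rw [← sub_eq_zero, ← LinearMap.sub_apply]
    refine hdiff.eq_zero_of_minus_eq_zero (h.irreducible k) (hbS k (Fin.last _)) (b.ne_zero _)
      (hbJ k).plus_last ?_ a _ (hbS k p)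
    have h1 := standardBoost_isStandardBlock b (k := k) (k' := ⟨k.val + 1, hk⟩) rfl
      (Fin.last _) .minus
    have h2 := hc k.val hk
    rw [LinearMap.sub_apply, sub_eq_zero]
    refine Eq.trans ?_ h1.symm
    have h3 := congrFun (hb k) (Fin.last _)
    rw [sectorVectors] at h3
    rw [h3, map_smul, hb, magneticVector_smul]
    simp only [Fin.eta] at h2
    have hs : s (k.val + 1) = s k * c k := Finset.prod_range_succ _ _
    rw [h2, hs]
    module
  · have hk' : k.val + 1 = l.length := by have := k.isLt; omega
    rw [h.sphericalB_last hk' a (hbS k p)]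
    exact (standardBoost_last b hk' p a).symm

theorem exists_isStandardBasis [FiniteDimensional ℂ V] :
    ∃ b : Module.Basis (Σ k : Fin l.length, Fin (l.get k + 1)) ℂ V,
      (∀ k p, b ⟨k, p⟩ ∈ S k) ∧ IsStandardBasis ρ l b := by
  obtain ⟨b, hbS, hJ, hB⟩ := h.exists_standardBoost
  refine ⟨b, hbS, ⟨fun k p a => hJ k p a, fun k k' hk p a => ?_, fun k hk p a => ?_⟩⟩
  · rw [hB]
    exact standardBoost_isStandardBlock b hk p a
  · rw [hB]
    exact standardBoost_last b hk p a

end IsChainRep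

end StandardBases

/-! ### Non-commutativity of consecutive blocks -/

section ConsecutiveBlocks

/-- Two consecutive standard blocks do not commute if the third spin occurs in the product of the
first with spin `1`. -/
theorem boostCoeff_commutator_ne {n₁ n₂ n₃ : ℕ} (h₁₂ : SpinStep n₁ n₂) (h₂₃ : SpinStep n₂ n₃)
    (h₁₃ : SpinStep n₁ n₃) :
    boostCoeff n₁ n₂ (n₁ / 2) .three * boostCoeff n₂ n₃ (n₁ / 2) .minus ≠
      boostCoeff n₁ n₂ (n₁ / 2) .minus * boostCoeff n₂ n₃ (n₁ / 2 + -1) .three := by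
  have hN : (0 : ℝ) ≤ n₁ := Nat.cast_nonneg _
  -- The two sides are the matrix elements of the two orderings of `B^-` and `B^3` on the top
  -- vector. Of the nine combinations of steps, up-up and down-down contradict `h₁₃`; the others are
  -- told apart by explicit values or by sign.
  rcases h₁₂ with rfl | ⟨rfl, hn⟩ | rfl
  · have a3 : boostCoeff n₁ (n₁ + 2) (n₁ / 2) .three = √(n₁ + 1 : ℝ) := by
      rw [boostCoeff, if_pos rfl, boostCoeffUp]
      congr 1; ring
    have am : boostCoeff n₁ (n₁ + 2) (n₁ / 2) .minus = 1 := by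
      rw [boostCoeff, if_pos rfl, boostCoeffUp, Real.sqrt_eq_one]
      ring
    rw [a3, am]
    rcases h₂₃ with rfl | ⟨rfl, hn₂⟩ | h
    · exfalso
      simp only [SpinStep] at h₁₃
      omega
    · have bm : boostCoeff (n₁ + 2) (n₁ + 2) (n₁ / 2) .minus = √(n₁ + 1 : ℝ) := by
        rw [boostCoeff, if_neg (by omega), if_pos rfl, boostCoeffLevel]
        congr 1; push_cast; ring
      have b3 : boostCoeff (n₁ + 2) (n₁ + 2) (n₁ / 2 + -1) .three = n₁ / 2 + -1 := by
        rw [boostCoeff, if_neg (by omega), if_pos rfl, boostCoeffLevel]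
      rw [bm, b3, Real.mul_self_sqrt (by positivity)]
      intro h
      linarith
    · obtain rfl : n₁ = n₃ := by omega
      -- Returning to the same spin satisfies `h₁₃` only for non-zero spin; this leaves room for
      -- `(0) → (1) → (0)`.
      have hpos : (0 : ℝ) < n₁ := by
        simp only [SpinStep] at h₁₃
        exact_mod_cast (by omega : 0 < n₁)
      have b3 : boostCoeff (n₁ + 2) n₁ (n₁ / 2 + -1) .three = -√(n₁ * 2 : ℝ) := by
        rw [boostCoeff, if_neg (by omega), if_neg (by omega), if_pos rfl, boostCoeffDown]
        congr 2; push_cast; ring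
      have bm : 0 ≤ boostCoeff (n₁ + 2) n₁ (n₁ / 2) .minus := by
        rw [boostCoeff, if_neg (by omega), if_neg (by omega), if_pos rfl, boostCoeffDown]
        exact Real.sqrt_nonneg _
      rw [b3, one_mul]
      have h1 : 0 < √(n₁ * 2 : ℝ) := Real.sqrt_pos.2 (by positivity)
      have h2 := mul_nonneg (Real.sqrt_nonneg (n₁ + 1 : ℝ)) bm
      intro h
      linarith
  · have hpos : (0 : ℝ) < n₂ := by exact_mod_cast Nat.pos_of_ne_zero hn
    have a3 : boostCoeff n₂ n₂ (n₂ / 2) .three = n₂ / 2 := by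
      rw [boostCoeff, if_neg (by omega), if_pos rfl, boostCoeffLevel]
    have am : boostCoeff n₂ n₂ (n₂ / 2) .minus = √(n₂ / 2 : ℝ) := by
      rw [boostCoeff, if_neg (by omega), if_pos rfl, boostCoeffLevel]
      congr 1; ring
    have hs : 0 < √(n₂ / 2 : ℝ) := Real.sqrt_pos.2 (by positivity)
    rw [a3, am]
    rcases h₂₃ with rfl | ⟨rfl, -⟩ | h
    · have bm : boostCoeff n₂ (n₂ + 2) (n₂ / 2) .minus = 1 := by
        rw [boostCoeff, if_pos rfl, boostCoeffUp, Real.sqrt_eq_one]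
        ring
      have b3 : boostCoeff n₂ (n₂ + 2) (n₂ / 2 + -1) .three = √(n₂ * 2 : ℝ) := by
        rw [boostCoeff, if_pos rfl, boostCoeffUp]
        congr 1; ring
      rw [bm, b3, ← Real.sqrt_mul (by positivity),
        show (n₂ / 2 * (n₂ * 2) : ℝ) = n₂ * n₂ by ring, Real.sqrt_mul_self hpos.le]
      intro h
      linarith
    · have b3 : boostCoeff n₃ n₃ (n₃ / 2 + -1) .three = n₃ / 2 + -1 := by
        rw [boostCoeff, if_neg (by omega), if_pos rfl, boostCoeffLevel]
      rw [am, b3]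
      intro h
      nlinarith
    · subst h
      have b3 : boostCoeff (n₃ + 2) n₃ ((n₃ + 2 : ℕ) / 2 + -1) .three = -√(n₃ + 1 : ℝ) := by
        rw [boostCoeff, if_neg (by omega), if_neg (by omega), if_pos rfl, boostCoeffDown]
        congr 2; push_cast; ring
      have bm : 0 ≤ boostCoeff (n₃ + 2) n₃ ((n₃ + 2 : ℕ) / 2) .minus := by
        rw [boostCoeff, if_neg (by omega), if_neg (by omega), if_pos rfl, boostCoeffDown]
        exact Real.sqrt_nonneg _
      rw [b3]
      have h1 : 0 < √(n₃ + 1 : ℝ) := Real.sqrt_pos.2 (by positivity)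
      have h2 := mul_nonneg (half_pos hpos).le bm
      have h3 := mul_pos hs h1
      intro h
      linarith
  · have a3 : boostCoeff (n₂ + 2) n₂ ((n₂ + 2 : ℕ) / 2) .three = 0 := by
      rw [boostCoeff, if_neg (by omega), if_neg (by omega), if_pos rfl, boostCoeffDown]
      simp
    have am : 0 < boostCoeff (n₂ + 2) n₂ ((n₂ + 2 : ℕ) / 2) .minus := by
      rw [boostCoeff, if_neg (by omega), if_neg (by omega), if_pos rfl, boostCoeffDown]
      refine Real.sqrt_pos.2 (lt_of_lt_of_eq
        (show (0 : ℝ) < 1 / 2 * (n₂ + 2) * (n₂ + 1) by positivity) ?_)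
      push_cast
      ring
    have b3 : 0 < boostCoeff n₂ n₃ ((n₂ + 2 : ℕ) / 2 + -1) .three := by
      rcases h₂₃ with rfl | ⟨rfl, hn₂⟩ | h
      · rw [boostCoeff, if_pos rfl, boostCoeffUp]
        refine Real.sqrt_pos.2 (lt_of_lt_of_eq (show (0 : ℝ) < n₂ + 1 by positivity) ?_)
        push_cast
        ring
      · have hpos : (0 : ℝ) < n₃ := by exact_mod_cast Nat.pos_of_ne_zero hn₂
        rw [boostCoeff, if_neg (by omega), if_pos rfl, boostCoeffLevel]
        push_cast
        linarith
      · exfalso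
        simp only [SpinStep] at h₁₃
        omega
    rw [a3, zero_mul]
    exact (mul_pos am b3).ne

theorem SpinStep.exists_magneticNumber {n n' : ℕ} (h : SpinStep n n') :
    ∃ p, magneticNumber n' p = (n / 2 : ℝ) + -1 := by
  rcases h with rfl | ⟨rfl, hn⟩ | rfl
  · exact ⟨⟨n, by omega⟩, by rw [magneticNumber]; push_cast; ring⟩
  · refine ⟨⟨n' - 1, by omega⟩, ?_⟩
    rw [magneticNumber, Nat.cast_sub (by omega)]
    push_cast
    ring
  · exact ⟨Fin.last n', by rw [magneticNumber, Fin.val_last]; push_cast; ring⟩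

theorem magneticNumber_last (n : ℕ) : magneticNumber n (Fin.last n) = n / 2 := by
  rw [magneticNumber, Fin.val_last]
  ring

/-- In the standard basis, commuting boosts would equate the two orderings at weight `j - 1`. The
selection rule ensures that this weight occurs in the third sector, so the equality can be read off
there. -/
theorem IsChainRep.not_spinStep {G : ConformalLimit} {V : Type*} [AddCommGroup V] [Module ℂ V]
    [FiniteDimensional ℂ V] {ρ : RotationRep G V} {l : List ℕ} {S : Fin l.length → Submodule ℂ V}
    (h : IsChainRep ρ l S) {k₁ k₂ k₃ : Fin l.length} (h₁₂ : k₂.val = k₁.val + 1)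
    (h₂₃ : k₃.val = k₂.val + 1) : ¬ SpinStep (l.get k₁) (l.get k₃) := by
  intro h₁₃
  obtain ⟨b, -, -, hB⟩ := h.exists_standardBoost
  have e₁₂ := standardBoost_isStandardBlock b h₁₂
  have e₂₃ := standardBoost_isStandardBlock b h₂₃
  rw [← hB] at e₁₂ e₂₃
  obtain ⟨p, hp⟩ := h₁₃.exists_magneticNumber
  have hcomm := sphericalB_comm ρ .minus .three
    (magneticVector (sectorVectors b k₁) ((l.get k₁ : ℝ) / 2))
  simp only [e₁₂.apply, e₂₃.apply, map_smul, smul_smul, SphericalIndex.shift, add_zero, ← hp,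
    magneticVector_magneticNumber] at hcomm
  have hcomm' := smul_left_injective ℂ (b.ne_zero _) hcomm
  rw [hp] at hcomm'
  refine boostCoeff_commutator_ne (h.spinStep h₁₂) (h.spinStep h₂₃) h₁₃ ?_
  exact_mod_cast hcomm'

end ConsecutiveBlocks

/-! ### Combinatorics of the chain patterns -/

section ChainPatterns

/-- A repeated spin next to any other arrow, or a turn back to a non-zero spin, relates
next-to-consecutive spins by the selection rule. So the direction of the first two steps persists,
except for the turn at spin 0. -/
theorem monotone_or_exceptional {f : ℕ → ℕ} {N : ℕ} (hN : 3 ≤ N)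
    (h1 : ∀ i, i + 1 < N → SpinStep (f i) (f (i + 1)))
    (h2 : ∀ i, i + 2 < N → ¬ SpinStep (f i) (f (i + 2))) :
    (∀ i, i + 1 < N → f (i + 1) = f i + 2) ∨ (∀ i, i + 1 < N → f i = f (i + 1) + 2) ∨
      (N = 3 ∧ f 0 = 0 ∧ f 1 = 2 ∧ f 2 = 0) := by
  simp only [SpinStep] at h1 h2
  have a1 := h1 0 (by omega)
  have a2 := h1 1 (by omega)
  have a3 := h2 0 (by omega)
  simp only [zero_add, Nat.reduceAdd] at a1 a2 a3
  have hcases : (f 1 = f 0 + 2 ∧ f 2 = f 1 + 2) ∨ (f 0 = f 1 + 2 ∧ f 1 = f 2 + 2) ∨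
      (f 0 = 0 ∧ f 1 = 2 ∧ f 2 = 0) := by omega
  rcases hcases with h | h | h
  · left
    have key : ∀ i, i + 2 < N → f (i + 1) = f i + 2 ∧ f (i + 2) = f (i + 1) + 2 := by
      intro i
      induction i with
      | zero => exact fun _ => h
      | succ i ih =>
        intro hi
        have := ih (by omega)
        have b1 := h1 (i + 1 + 1) (by omega)
        have b2 := h2 (i + 1) (by omega)
        simp only [add_assoc, Nat.reduceAdd] at *
        omega
    intro i hi
    by_cases hi2 : i + 2 < N
    · exact (key i hi2).1
    · obtain ⟨d, rfl⟩ := Nat.exists_eq_add_of_le' (show 1 ≤ i by omega)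
      exact (key d (by omega)).2
  · right; left
    have key : ∀ i, i + 2 < N → f i = f (i + 1) + 2 ∧ f (i + 1) = f (i + 2) + 2 := by
      intro i
      induction i with
      | zero => exact fun _ => h
      | succ i ih =>
        intro hi
        have := ih (by omega)
        have b1 := h1 (i + 1 + 1) (by omega)
        have b2 := h2 (i + 1) (by omega)
        simp only [add_assoc, Nat.reduceAdd] at *
        omega
    intro i hi
    by_cases hi2 : i + 2 < N
    · exact (key i hi2).1
    · obtain ⟨d, rfl⟩ := Nat.exists_eq_add_of_le' (show 1 ≤ i by omega)
      exact (key d (by omega)).2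
  · right; right
    refine ⟨?_, h⟩
    -- After `0, 2, 0` the next entry can only be `2`, but then `2, 0, 2` returns to a non-zero
    -- spin.
    by_contra hne
    have b1 := h1 2 (by omega)
    have b2 := h2 1 (by omega)
    simp only [Nat.reduceAdd] at b1 b2
    omega

/-- The chain patterns are those in which consecutive spins are related by the selection rule,
while next-to-consecutive spins are not. -/
theorem allowedChain_iff {l : List ℕ} :
    AllowedChain l ↔ l ≠ [] ∧
      (∀ i (hi : i + 1 < l.length), SpinStep l[i] l[i + 1]) ∧
      ∀ i (hi : i + 2 < l.length), ¬ SpinStep l[i] l[i + 2] := by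
  constructor
  · intro h
    cases h with
    | singlet n => simp
    | up n =>
      refine ⟨by simp, fun i hi => ?_, fun i hi => by simp at hi⟩
      obtain rfl : i = 0 := by simpa using hi
      simp [SpinStep]
    | level n hn =>
      refine ⟨by simp, fun i hi => ?_, fun i hi => by simp at hi⟩
      obtain rfl : i = 0 := by simpa using hi
      simp [SpinStep, hn]
    | down n =>
      refine ⟨by simp, fun i hi => ?_, fun i hi => by simp at hi⟩
      obtain rfl : i = 0 := by simpa using hi
      simp [SpinStep]
    | increasing l hl h =>
      refine ⟨by rintro rfl; simp at hl, fun i hi => Or.inl (h.getElem i hi), fun i hi => ?_⟩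
      have e1 := h.getElem i (by omega)
      have e2 := h.getElem (i + 1) (by omega)
      simp only [SpinStep, add_assoc, Nat.reduceAdd] at *
      omega
    | decreasing l hl h =>
      refine ⟨by rintro rfl; simp at hl, fun i hi => Or.inr (Or.inr (h.getElem i hi)),
        fun i hi => ?_⟩
      have e1 := h.getElem i (by omega)
      have e2 := h.getElem (i + 1) (by omega)
      simp only [SpinStep, add_assoc, Nat.reduceAdd] at *
      omega
    | exceptional =>
      refine ⟨by simp, fun i hi => ?_, fun i hi => ?_⟩
      · have : i = 0 ∨ i = 1 := by simp at hi; omega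
        rcases this with rfl | rfl <;> simp [SpinStep]
      · have : i = 0 := by simp at hi; omega
        subst this
        simp [SpinStep]
  · rintro ⟨h0, h1, h2⟩
    by_cases hl : 3 ≤ l.length
    · have hget : ∀ i (hi : i < l.length), l.getD i 0 = l[i] := fun i hi => by simp [hi]
      rcases monotone_or_exceptional (f := fun i => l.getD i 0) hl
        (fun i hi => by
          simp only [hget i (by omega), hget (i + 1) hi]
          exact h1 i hi)
        (fun i hi => by
          simp only [hget i (by omega), hget (i + 2) hi]
          exact h2 i hi) with h | h | ⟨hN, e0, e1, e2⟩
      · refine .increasing l hl (List.isChain_iff_getElem.2 fun i hi => ?_)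
        have := h i hi
        simpa only [hget i (by omega), hget (i + 1) hi] using this
      · refine .decreasing l hl (List.isChain_iff_getElem.2 fun i hi => ?_)
        have := h i hi
        simpa only [hget i (by omega), hget (i + 1) hi] using this
      · obtain ⟨a, b, c, rfl⟩ := List.length_eq_three.1 hN
        simp at e0 e1 e2
        subst e0 e1 e2
        exact .exceptional
    · match l, h0, hl, h1 with
      | [n], _, _, _ => exact .singlet n
      | [n, n'], _, _, h1 =>
        have := h1 0 (by simp)
        simp only [List.getElem_cons_zero, zero_add, List.getElem_cons_succ] at this
        rcases this with rfl | ⟨rfl, hn⟩ | rfl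
        · exact .up n
        · exact .level n' hn
        · exact .down n'
      | _ :: _ :: _ :: _, _, hl, _ => simp at hl

theorem IsChainRep.allowedChain {G : ConformalLimit} {V : Type*} [AddCommGroup V] [Module ℂ V]
    [FiniteDimensional ℂ V] {ρ : RotationRep G V} {l : List ℕ} {S : Fin l.length → Submodule ℂ V}
    (h : IsChainRep ρ l S) : AllowedChain l :=
  allowedChain_iff.2 ⟨h.ne_nil,
    fun i hi => h.spinStep (k := ⟨i, by omega⟩) (k' := ⟨i + 1, hi⟩) rfl,
    fun i hi => h.not_spinStep (k₁ := ⟨i, by omega⟩) (k₂ := ⟨i + 1, by omega⟩)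
      (k₃ := ⟨i + 2, hi⟩) rfl rfl⟩

end ChainPatterns

/-! ### Constructing representations from operators -/

section Representations

variable {V : Type*} [AddCommGroup V] [Module ℂ V]

/-- The antisymmetric family of rotations with given independent components. -/
def rotationFamily (X Y Z : Module.End ℂ V) : Fin 3 → Fin 3 → Module.End ℂ V :=
  ![![0, Z, -Y], ![-Z, 0, X], ![Y, -X, 0]]

/-- The linear map with given values on the rotation and boost matrices. -/
noncomputable def generatorMap (G : ConformalLimit) (X Y Z : Module.End ℂ V)
    (B : Fin 3 → Module.End ℂ V) : Matrix (Fin 4) (Fin 4) ℝ →ₗ[ℝ] Module.End ℂ V :=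
  (Matrix.entryLinearMap ℝ ℝ 3 2).smulRight X + (Matrix.entryLinearMap ℝ ℝ 1 3).smulRight Y +
    (Matrix.entryLinearMap ℝ ℝ 2 1).smulRight Z +
    ∑ i : Fin 3, (match G with
      | .carrollian => (Matrix.entryLinearMap ℝ ℝ 0 i.succ).smulRight (B i)
      | .galilean => -(Matrix.entryLinearMap ℝ ℝ i.succ 0).smulRight (B i))

theorem generatorMap_rotationMatrix (G : ConformalLimit) (X Y Z : Module.End ℂ V)
    (B : Fin 3 → Module.End ℂ V) (i j : Fin 3) :
    generatorMap G X Y Z B (rotationMatrix i j) = rotationFamily X Y Z i j := by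
  cases G <;> fin_cases i <;> fin_cases j <;>
  simp [generatorMap, rotationMatrix, rotationFamily, Fin.sum_univ_three, Matrix.single]

theorem generatorMap_boostMatrix (G : ConformalLimit) (X Y Z : Module.End ℂ V)
    (B : Fin 3 → Module.End ℂ V) (i : Fin 3) :
    generatorMap G X Y Z B (boostMatrix G i) = B i := by
  cases G <;> fin_cases i <;>
  simp [generatorMap, boostMatrix, Fin.sum_univ_three, Matrix.single]

/-- Operators which satisfy the commutation relations define a representation. -/
theorem exists_rotationRep_of_commutators (G : ConformalLimit) {X Y Z : Module.End ℂ V}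
    {B : Fin 3 → Module.End ℂ V} (hXY : ⁅X, Y⁆ = Z) (hYZ : ⁅Y, Z⁆ = X) (hZX : ⁅Z, X⁆ = Y)
    (hX : ⁅X, B 0⁆ = 0 ∧ ⁅X, B 1⁆ = B 2 ∧ ⁅X, B 2⁆ = -B 1)
    (hY : ⁅Y, B 0⁆ = -B 2 ∧ ⁅Y, B 1⁆ = 0 ∧ ⁅Y, B 2⁆ = B 0)
    (hZ : ⁅Z, B 0⁆ = B 1 ∧ ⁅Z, B 1⁆ = -B 0 ∧ ⁅Z, B 2⁆ = 0)
    (hB : ∀ i j, ⁅B i, B j⁆ = 0) :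
    ∃ ρ : RotationRep G V, (ρ (genJ G 1 2) = X ∧ ρ (genJ G 2 0) = Y ∧ ρ (genJ G 0 1) = Z) ∧
      ∀ i, ρ (genB G i) = B i := by
  let R := rotationFamily X Y Z
  let φ := generatorMap G X Y Z B
  have hRR : ∀ i j k l, ⁅R i j, R k l⁆ =
      (if i = k then R j l else 0) - (if i = l then R j k else 0)
        + (if j = l then R i k else 0) - (if j = k then R i l else 0) := by
    have hYX : ⁅Y, X⁆ = -Z := by rw [← lie_skew, hXY]
    have hZY : ⁅Z, Y⁆ = -X := by rw [← lie_skew, hYZ]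
    have hXZ : ⁅X, Z⁆ = -Y := by rw [← lie_skew, hZX]
    intro i j k l
    fin_cases i <;> fin_cases j <;> fin_cases k <;> fin_cases l <;>
    simp [R, rotationFamily, hXY, hYZ, hZX, hYX, hZY, hXZ]
  have hRB : ∀ i j k, ⁅R i j, B k⁆ = (if i = k then B j else 0) - (if j = k then B i else 0) := by
    obtain ⟨x0, x1, x2⟩ := hX
    obtain ⟨y0, y1, y2⟩ := hY
    obtain ⟨z0, z1, z2⟩ := hZ
    intro i j k
    fin_cases i <;> fin_cases j <;> fin_cases k <;>
    simp [R, rotationFamily, x0, x1, x2, y0, y1, y2, z0, z1, z2]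
  have hφR : ∀ i j, φ (rotationMatrix i j) = R i j := generatorMap_rotationMatrix G X Y Z B
  have hφB : ∀ i, φ (boostMatrix G i) = B i := generatorMap_boostMatrix G X Y Z B
  let s := Set.range (fun p : Fin 3 × Fin 3 => rotationMatrix p.1 p.2) ∪ Set.range (boostMatrix G)
  have hsR : ∀ i j, rotationMatrix i j ∈ Submodule.span ℝ s := fun i j =>
    Submodule.subset_span (Or.inl ⟨(i, j), rfl⟩)
  have hsB : ∀ i, boostMatrix G i ∈ Submodule.span ℝ s := fun i =>
    Submodule.subset_span (Or.inr ⟨i, rfl⟩)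
  have hite : ∀ (P : Prop) [Decidable P] (M : Matrix (Fin 4) (Fin 4) ℝ),
      φ (if P then M else 0) = if P then φ M else 0 := fun P _ M => by split_ifs <;> simp
  have hmem : ∀ (P : Prop) [Decidable P] (M : Matrix (Fin 4) (Fin 4) ℝ),
      M ∈ Submodule.span ℝ s → (if P then M else 0) ∈ Submodule.span ℝ s := fun P _ M hM => by
    split_ifs
    exacts [hM, Submodule.zero_mem _]
  have hgen : ∀ x ∈ s, ∀ y ∈ s, ⁅x, y⁆ ∈ Submodule.span ℝ s ∧ φ ⁅x, y⁆ = ⁅φ x, φ y⁆ := by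
    rintro _ (⟨⟨i, j⟩, rfl⟩ | ⟨i, rfl⟩) _ (⟨⟨k, l⟩, rfl⟩ | ⟨k, rfl⟩)
    · simp only [(rotation_commutators G i j k l).1, map_add, map_sub, hite, hφR, hRR]
      refine ⟨?_, trivial⟩
      exact Submodule.sub_mem _ (Submodule.add_mem _ (Submodule.sub_mem _ (hmem _ _ (hsR _ _))
        (hmem _ _ (hsR _ _))) (hmem _ _ (hsR _ _))) (hmem _ _ (hsR _ _))
    · simp only [(rotation_commutators G i j k 0).2.1, map_sub, hite, hφR, hφB, hRB]
      exact ⟨Submodule.sub_mem _ (hmem _ _ (hsB _)) (hmem _ _ (hsB _)), trivial⟩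
    · simp only [← lie_skew (boostMatrix G i), ← lie_skew (B i),
        (rotation_commutators G k l i 0).2.1, map_neg, map_sub, hite, hφR, hφB, hRB]
      exact ⟨Submodule.neg_mem _
        (Submodule.sub_mem _ (hmem _ _ (hsB _)) (hmem _ _ (hsB _))), trivial⟩
    · simp only [(rotation_commutators G i k 0 0).2.2, map_zero, hφB, hB]
      exact ⟨Submodule.zero_mem _, trivial⟩
  -- The linear map `φ` on all matrices need not respect brackets; it does on the span of the
  -- generators, by bilinearity. This span is closed under brackets and so contains the rotation
  -- algebra.
  have hspan : ∀ x ∈ Submodule.span ℝ s, ∀ y ∈ Submodule.span ℝ s,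
      ⁅x, y⁆ ∈ Submodule.span ℝ s ∧ φ ⁅x, y⁆ = ⁅φ x, φ y⁆ := by
    intro x hx y hy
    induction hx, hy using Submodule.span_induction₂ with
    | mem_mem x y hx hy => exact hgen x hx y hy
    | zero_left y hy => simp
    | zero_right x hx => simp
    | add_left x y z _ _ _ h1 h2 =>
      simp only [add_lie, map_add, h1.2, h2.2, and_true]
      exact Submodule.add_mem _ h1.1 h2.1
    | add_right x y z _ _ _ h1 h2 =>
      simp only [lie_add, map_add, h1.2, h2.2, and_true]
      exact Submodule.add_mem _ h1.1 h2.1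
    | smul_left r x y _ _ h =>
      simp only [smul_lie, map_smul, h.2, and_true]
      exact Submodule.smul_mem _ r h.1
    | smul_right r x y _ _ h =>
      simp only [lie_smul, map_smul, h.2, and_true]
      exact Submodule.smul_mem _ r h.1
  let K : LieSubalgebra ℝ (Matrix (Fin 4) (Fin 4) ℝ) :=
    { Submodule.span ℝ s with lie_mem' := fun {x y} hx hy => (hspan x hx y hy).1 }
  have hK : ∀ x : rotationAlgebra G, x.1 ∈ Submodule.span ℝ s := fun x =>
    (LieSubalgebra.lieSpan_le (K := K)).2 Submodule.subset_span x.2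
  let ρ : RotationRep G V :=
    { φ ∘ₗ (rotationAlgebra G).toSubmodule.subtype with
      map_lie' := fun {x y} => (hspan x.1 (hK x) y.1 (hK y)).2 }
  exact ⟨ρ, ⟨hφR 1 2, hφR 2 0, hφR 0 1⟩, hφB⟩

theorem exists_rotationRep (G : ConformalLimit) {J B : SphericalIndex → Module.End ℂ V}
    (hJ : IsSpinTriple J) (hB : IsVectorOperator J B)
    (hcomm : ∀ a b v, B a (B b v) = B b (B a v)) :
    ∃ ρ : RotationRep G V, sphericalJ ρ = J ∧ sphericalB ρ = B := by
  have hI := Complex.I_mul_I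
  have hs := inv_sqrt_two_mul_self
  generalize hsdef : ((√2 : ℝ) : ℂ)⁻¹ = s at hs
  obtain ⟨ρ, ⟨h12, h20, h01⟩, hρB⟩ := exists_rotationRep_of_commutators G
    (X := s • (J .minus - J .plus)) (Y := (-Complex.I * s) • (J .minus + J .plus))
    (Z := Complex.I • J .three)
    (B := ![(-Complex.I * s) • (B .plus + B .minus), s • (B .plus - B .minus), B .three])
    (by
      ext v
      simp only [Ring.lie_def, LinearMap.sub_apply, Module.End.mul_apply, LinearMap.smul_apply,
        LinearMap.add_apply, map_smul, map_add, map_sub, hJ.plus_minus]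
      match_scalars <;> grind)
    (by
      ext v
      simp only [Ring.lie_def, LinearMap.sub_apply, Module.End.mul_apply, LinearMap.smul_apply,
        LinearMap.add_apply, map_smul, map_add, hJ.three_plus, hJ.three_minus]
      match_scalars <;> grind)
    (by
      ext v
      simp only [Ring.lie_def, LinearMap.sub_apply, Module.End.mul_apply, LinearMap.smul_apply,
        LinearMap.add_apply, map_smul, map_sub, hJ.three_plus, hJ.three_minus]
      match_scalars <;> grind)
    (by
      refine ⟨?_, ?_, ?_⟩ <;> ext v <;>
      simp only [Ring.lie_def, LinearMap.sub_apply, Module.End.mul_apply, LinearMap.smul_apply,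
        LinearMap.add_apply, LinearMap.neg_apply, LinearMap.zero_apply, map_smul, map_add, map_sub,
        Matrix.cons_val, hB.plus_plus, hB.plus_three, hB.plus_minus, hB.minus_plus, hB.minus_three,
        hB.minus_minus] <;>
      match_scalars <;> grind)
    (by
      refine ⟨?_, ?_, ?_⟩ <;> ext v <;>
      simp only [Ring.lie_def, LinearMap.sub_apply, Module.End.mul_apply, LinearMap.smul_apply,
        LinearMap.add_apply, LinearMap.neg_apply, LinearMap.zero_apply, map_smul, map_add, map_sub,
        Matrix.cons_val, hB.plus_plus, hB.plus_three, hB.plus_minus, hB.minus_plus, hB.minus_three,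
        hB.minus_minus] <;>
      match_scalars <;> grind)
    (by
      refine ⟨?_, ?_, ?_⟩ <;> ext v <;>
      simp only [Ring.lie_def, LinearMap.sub_apply, Module.End.mul_apply, LinearMap.smul_apply,
        LinearMap.add_apply, LinearMap.neg_apply, LinearMap.zero_apply, map_smul, map_add, map_sub,
        Matrix.cons_val, hB.three_plus, hB.three_three, hB.three_minus] <;>
      match_scalars <;> grind)
    (by
      have h3 := hcomm .minus .plus
      have h4 := hcomm .three .plus
      have h5 := hcomm .three .minus
      intro i j
      ext v
      fin_cases i <;> fin_cases j <;>
      simp [Ring.lie_def, h3, h4, h5] <;>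
      module)
  refine ⟨ρ, ?_, ?_⟩ <;> funext a <;> cases a <;>
  simp only [sphericalJ, sphericalB, h12, h20, h01, hρB, Matrix.cons_val, hsdef] <;>
  clear h12 h20 h01 hρB hsdef <;>
  match_scalars <;> grind

end Representations

/-! ### Existence of the allowed chains -/

section ChainExistence

variable {V : Type*} [AddCommGroup V] [Module ℂ V]

/-- The irreducible subspace through the top vector lies in the span, and the weight `n / 2` of that
vector forces its dimension to be `n + 1`. -/
theorem IsStandardTriple.isIrreducibleUnder_span [FiniteDimensional ℂ V]
    {J : SphericalIndex → Module.End ℂ V} (hJ : IsSpinTriple J) {n : ℕ} {e : Fin (n + 1) → V}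
    (he : IsStandardTriple J e) (h0 : ∀ p, e p ≠ 0) :
    IsIrreducibleUnder J (Submodule.span ℂ (Set.range e)) ∧
      Module.finrank ℂ (Submodule.span ℂ (Set.range e)) = n + 1 := by
  have hmem : ∀ p, e p ∈ Submodule.span ℂ (Set.range e) := fun p => Submodule.subset_span ⟨p, rfl⟩
  have hdim : Module.finrank ℂ (Submodule.span ℂ (Set.range e)) = n + 1 := by
    rw [finrank_span_eq_card (he.linearIndependent h0), Fintype.card_fin]
  have hstab : IsStable J (Submodule.span ℂ (Set.range e)) := by
    intro a
    suffices h : Submodule.span ℂ (Set.range e) ≤ (Submodule.span ℂ (Set.range e)).comap (J a)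
      from h
    rw [Submodule.span_le]
    rintro _ ⟨p, rfl⟩
    rw [SetLike.mem_coe, Submodule.mem_comap, he p a]
    exact Submodule.smul_mem _ _ (magneticVector_mem hmem _)
  have hprim : IsPrimitive J (n / 2) (e (Fin.last n)) := by
    refine ⟨h0 _, he.plus_last, ?_⟩
    rw [he.three_apply, magneticNumber_last]
    push_cast
    rfl
  obtain ⟨T, hT, hTv⟩ := hJ.exists_irreducible_string hprim
  have hTle : T ≤ Submodule.span ℂ (Set.range e) := by
    rcases hT.eq_of_le (T ⊓ Submodule.span ℂ (Set.range e)) inf_le_left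
      fun a u hu => ⟨hT.stable a u hu.1, hstab a u hu.2⟩ with h | h
    · exact absurd ((Submodule.eq_bot_iff _).1 h _ ⟨hTv, hmem _⟩) (h0 _)
    · exact h ▸ inf_le_right
  obtain ⟨m, hm⟩ := Nat.exists_eq_succ_of_ne_zero
    (fun h => hT.ne_bot (Submodule.finrank_eq_zero.1 h))
  have hnm : n = m := by
    have h := hJ.primitive_weight_of_mem hT hm hprim hTv
    have : (n : ℂ) = m := by linear_combination 2 * h
    exact_mod_cast this
  refine ⟨?_, hdim⟩
  rwa [← Submodule.eq_of_le_of_finrank_eq hTle (by omega)]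

variable {l : List ℕ} (b : Module.Basis (Σ k : Fin l.length, Fin (l.get k + 1)) ℂ V)

/-- The span of the standard vectors of the `k`-th sector. -/
noncomputable def sectorSpan (k : Fin l.length) : Submodule ℂ V :=
  Submodule.span ℂ (Set.range (sectorVectors b k))

theorem sectorVectors_mem (k : Fin l.length) (p : Fin (l.get k + 1)) :
    sectorVectors b k p ∈ sectorSpan b k :=
  Submodule.subset_span ⟨p, rfl⟩

theorem isInternal_sectorSpan : DirectSum.IsInternal (sectorSpan b) := by
  refine DirectSum.isInternal_submodule_of_iSupIndep_of_iSup_eq_top (fun k => ?_) ?_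
  · refine (b.linearIndependent.disjoint_span_image (s := {i | i.1 = k}) (t := {i | i.1 ≠ k})
      (Set.disjoint_left.2 fun i h h' => h' h)).mono (Submodule.span_mono ?_)
      (iSup₂_le fun k' hk' => Submodule.span_mono ?_)
    · rintro _ ⟨p, rfl⟩
      exact ⟨⟨k, p⟩, rfl, rfl⟩
    · rintro _ ⟨p, rfl⟩
      exact ⟨⟨k', p⟩, hk', rfl⟩
  · rw [eq_top_iff, ← b.span_eq, Submodule.span_le]
    rintro _ ⟨⟨k, p⟩, rfl⟩
    exact le_iSup (sectorSpan b) k (sectorVectors_mem b k p)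

theorem standardBoost_mem {k k' : Fin l.length} (hk : k'.val = k.val + 1) (a : SphericalIndex)
    {v : V} (hv : v ∈ sectorSpan b k) : standardBoost b a v ∈ sectorSpan b k' := by
  suffices h : sectorSpan b k ≤ (sectorSpan b k').comap (standardBoost b a) from h hv
  rw [sectorSpan, Submodule.span_le]
  rintro _ ⟨p, rfl⟩
  rw [SetLike.mem_coe, Submodule.mem_comap, standardBoost_isStandardBlock b hk p a]
  exact Submodule.smul_mem _ _ (magneticVector_mem (sectorVectors_mem b k') _)

theorem standardBoost_eq_zero {k : Fin l.length} (hk : k.val + 1 = l.length) (a : SphericalIndex)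
    {v : V} (hv : v ∈ sectorSpan b k) : standardBoost b a v = 0 := by
  suffices h : sectorSpan b k ≤ LinearMap.ker (standardBoost b a) from h hv
  rw [sectorSpan, Submodule.span_le]
  rintro _ ⟨p, rfl⟩
  exact standardBoost_last b hk p a

/-- The standard blocks commute if next-to-consecutive spins violate the selection rule. -/
theorem standardBoost_comm [FiniteDimensional ℂ V] {J : SphericalIndex → Module.End ℂ V}
    (hJb : ∀ k, IsStandardTriple J (sectorVectors b k)) (hJ : IsSpinTriple J)
    (hl : ∀ k k' : Fin l.length, k'.val = k.val + 2 → ¬ SpinStep (l.get k) (l.get k'))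
    (a c : SphericalIndex) (v : V) :
    standardBoost b a (standardBoost b c v) = standardBoost b c (standardBoost b a v) := by
  have hcross := (isVectorOperator_standardBoost b hJb).cross
  have hirr : ∀ k, IsIrreducibleUnder J (sectorSpan b k) ∧
      Module.finrank ℂ (sectorSpan b k) = l.get k + 1 := fun k =>
    (hJb k).isIrreducibleUnder_span hJ fun p => b.ne_zero ⟨k, p⟩
  have hzero : ∀ k, ∀ v ∈ sectorSpan b k, ∀ a c,
      standardBoost b a (standardBoost b c v) = standardBoost b c (standardBoost b a v) := by
    intro k
    by_cases hk : k.val + 1 < l.length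
    · by_cases hk2 : k.val + 2 < l.length
      · have hmem : ∀ a c, ∀ v ∈ sectorSpan b k,
            standardBoost b a (standardBoost b c v) ∈ sectorSpan b ⟨k.val + 2, hk2⟩ :=
          fun a c v hv => standardBoost_mem b (k := ⟨k.val + 1, hk⟩) rfl a
            (standardBoost_mem b (k' := ⟨k.val + 1, hk⟩) rfl c hv)
        -- The antisymmetric square is a vector operator from the sector `k` to the sector `k + 2`;
        -- the selection rule forbids it to be non-zero.
        have h0 : ∀ a, ∀ v ∈ sectorSpan b k, crossOperator (standardBoost b) a v = 0 := by
          by_contra! hne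
          refine hl k ⟨k.val + 2, hk2⟩ rfl (hcross.spinStep hJ (hirr k).1 (hirr k).2
            (hirr ⟨k.val + 2, hk2⟩).1 (hirr ⟨k.val + 2, hk2⟩).2 (fun a v hv => ?_) hne)
          cases a <;> simp only [crossOperator, LinearMap.sub_apply, Module.End.mul_apply] <;>
            exact Submodule.sub_mem _ (hmem _ _ v hv) (hmem _ _ v hv)
        intro v hv a c
        have hp := h0 .plus v hv
        have h3 := h0 .three v hv
        have hm := h0 .minus v hv
        simp only [crossOperator, LinearMap.sub_apply, Module.End.mul_apply, sub_eq_zero]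
          at hp h3 hm
        match a, c with
        | .plus, .plus | .three, .three | .minus, .minus => rfl
        | .three, .plus => exact hp
        | .plus, .three => exact hp.symm
        | .minus, .plus => exact h3
        | .plus, .minus => exact h3.symm
        | .minus, .three => exact hm
        | .three, .minus => exact hm.symm
      · intro v hv a c
        have hz : ∀ a c, standardBoost b a (standardBoost b c v) = 0 := fun a c =>
          standardBoost_eq_zero b (k := ⟨k.val + 1, hk⟩) (by simp only; omega) a
            (standardBoost_mem b rfl c hv)
        rw [hz, hz]
    · intro v hv a c
      have hk' : k.val + 1 = l.length := by have := k.isLt; omega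
      rw [standardBoost_eq_zero b hk' c hv, standardBoost_eq_zero b hk' a hv, map_zero, map_zero]
  refine LinearMap.congr_fun (f := standardBoost b a * standardBoost b c)
    (g := standardBoost b c * standardBoost b a) (b.ext fun i => ?_) v
  exact hzero i.1 _ (sectorVectors_mem b i.1 i.2) a c

theorem exists_isChainRep_of_basis [FiniteDimensional ℂ V] (G : ConformalLimit) (hl0 : l ≠ [])
    (hl1 : ∀ k k' : Fin l.length, k'.val = k.val + 1 → SpinStep (l.get k) (l.get k'))
    (hl2 : ∀ k k' : Fin l.length, k'.val = k.val + 2 → ¬ SpinStep (l.get k) (l.get k')) :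
    ∃ ρ : RotationRep G V, IsChainRep ρ l (sectorSpan b) := by
  let J : SphericalIndex → Module.End ℂ V := fun a => b.constr ℂ fun i =>
    (rotationCoeff (l.get i.1 / 2) (magneticNumber (l.get i.1) i.2) a : ℂ) •
      magneticVector (sectorVectors b i.1) (magneticNumber (l.get i.1) i.2 + a.shift)
  have hJb : ∀ k, IsStandardTriple J (sectorVectors b k) := fun k p a => by
    simp only [J]
    rw [sectorVectors, Module.Basis.constr_basis]
  have hJ : IsSpinTriple J := isSpinTriple_of_basis b fun i => ⟨_, _, hJb i.1, i.2, rfl⟩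
  obtain ⟨ρ, hρJ, hρB⟩ := exists_rotationRep G hJ (isVectorOperator_standardBoost b hJb)
    (standardBoost_comm b hJb hJ hl2)
  refine ⟨ρ, hl0, fun k => (isSector_iff ρ).2 ?_, isInternal_sectorSpan b, ?_, ?_, ?_⟩
  · rw [hρJ]
    exact (hJb k).isIrreducibleUnder_span hJ fun p => b.ne_zero ⟨k, p⟩
  · intro k k' hk a v hv
    refine (forall_genB_mem_iff ρ).2 (fun c => ?_) a
    rw [hρB]
    exact standardBoost_mem b hk c hv
  · intro k hk a v hv
    refine (forall_genB_eq_zero_iff ρ).2 (fun c => ?_) a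
    rw [hρB]
    exact standardBoost_eq_zero b hk c hv
  · intro k hk
    have hstep := hl1 k ⟨k.val + 1, hk⟩ rfl
    by_contra! hcon
    -- The arrow is detected by `B^-` on the top vector, where the standard coefficient is non-zero
    -- and the target weight exists.
    have h := (forall_genB_eq_zero_iff ρ).1
      (fun a => hcon a _ (sectorVectors_mem b k (Fin.last _))) .minus
    obtain ⟨p, hp⟩ := hstep.exists_magneticNumber
    have hblock := standardBoost_isStandardBlock b (k := k) (k' := ⟨k.val + 1, hk⟩) rfl
      (Fin.last _) .minus
    have hshift : magneticNumber (l.get k) (Fin.last _) + SphericalIndex.shift .minus =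
        magneticNumber _ p := by rw [hp, magneticNumber_last, SphericalIndex.shift]
    rw [hρB, hblock, hshift, magneticVector_magneticNumber] at h
    refine (smul_ne_zero ?_ (b.ne_zero _)) h
    exact_mod_cast boostCoeff_minus_last_ne_zero hstep

theorem AllowedChain.exists_isChainRep (G : ConformalLimit) {l : List ℕ} (h : AllowedChain l) :
    ∃ (V : Type u) (_ : AddCommGroup V) (_ : Module ℂ V) (_ : FiniteDimensional ℂ V)
      (ρ : RotationRep G V) (S : Fin l.length → Submodule ℂ V), IsChainRep ρ l S := by
  obtain ⟨h0, h1, h2⟩ := allowedChain_iff.1 h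
  -- `ULift` places the space of functions on the index set in the prescribed universe.
  let b := (Pi.basisFun ℂ (ULift.{u} (Σ k : Fin l.length, Fin (l.get k + 1)))).reindex Equiv.ulift
  obtain ⟨ρ, hρ⟩ := exists_isChainRep_of_basis b G h0
    (fun k k' hk => by
      obtain ⟨i, hi⟩ := k'
      obtain rfl : i = k.val + 1 := hk
      exact h1 k.val hi)
    (fun k k' hk => by
      obtain ⟨i, hi⟩ := k'
      obtain rfl : i = k.val + 2 := hk
      exact h2 k.val hi)
  exact ⟨_, _, _, inferInstance, ρ, _, hρ⟩

end ChainExistence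

theorem mainTheorem1 (G : ConformalLimit) :
    (∀ (V : Type u) [AddCommGroup V] [Module ℂ V] [FiniteDimensional ℂ V] (ρ : RotationRep G V),
      ∃ (r N : ℕ) (S : Fin N → Submodule ℂ V) (n ord : Fin N → ℕ), IsMultiplet ρ r S n ord) ∧
    (∀ l : List ℕ,
      (∃ (V : Type u) (_ : AddCommGroup V) (_ : Module ℂ V) (_ : FiniteDimensional ℂ V)
        (ρ : RotationRep G V) (S : Fin l.length → Submodule ℂ V), IsChainRep ρ l S) ↔
      AllowedChain l) ∧
    (∀ (V : Type u) [AddCommGroup V] [Module ℂ V] [FiniteDimensional ℂ V] (ρ : RotationRep G V)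
      (l : List ℕ) (S : Fin l.length → Submodule ℂ V), IsChainRep ρ l S →
      ∃ b : Module.Basis (Σ k : Fin l.length, Fin (l.get k + 1)) ℂ V,
        (∀ k p, b ⟨k, p⟩ ∈ S k) ∧ IsStandardBasis ρ l b) := by
  refine ⟨fun V _ _ _ ρ => exists_isMultiplet ρ, fun l => ⟨?_, fun h => h.exists_isChainRep G⟩,
    fun V _ _ _ ρ l S h => h.exists_isStandardBasis⟩
  rintro ⟨V, _, _, _, ρ, S, h⟩
  exact h.allowedChain
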